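/- Let $\mathbb M$ be a smooth connected manifold of dimension $d+\mathfrak h$ with a smooth bracket generating distribution $\mathcal H$ of rank $d$ and a smooth fiberwise inner product $g_{\mathcal H}$ on $\mathcal H$. A smooth vector field $Z$ is a sub-Riemannian Killing field if $[Z,X]$ is horizontal for every horizontal $X$ and $Z\,g_{\mathcal H}(X,Y)=g_{\mathcal H}([Z,X],Y)+g_{\mathcal H}(X,[Z,Y])$ for all horizontal $X,Y$. Let $\mathcal V$ be an $\mathfrak h$-dimensional Lie algebra of such fields with $T_x\mathbb M=\mathcal H(x)\oplus\mathcal V(x)$ for all $x$, where $\mathcal V(x)=\{Z(x):Z\in\mathcal V\}$, and let $g_{\mathcal V}$ be an inner product on $\mathcal V$. Extend $g_{\mathcal H}$ and $g_{\mathcal V}$ to $T\mathbb M$ by zero on the vertical, respectively horizontal, vectors, and put $g_\varepsilon=g_{\mathcal H}\oplus\frac1\varepsilon g_{\mathcal V}$. Let $\nabla$ be the canonical connection, that is, the smooth affine connection, with torsion $T$, such that: $\nabla g_\varepsilon=0$ for all $\varepsilon>0$; $\nabla_XY$ is horizontal for $X,Y$ horizontal; $\nabla Z=0$ for $Z\in\mathcal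 V$; $T(X,Y)$ is vertical and $T(X,Z)=0$ for $X,Y$ horizontal and $Z\in\mathcal V$. (Such a connection exists; this is part of the statement.) Let $X_1,\dots,X_d$ denote local $g_{\mathcal H}$-orthonormal frames of $\mathcal H$ and $Z_1,\dots,Z_{\mathfrak h}$ a $g_{\mathcal V}$-orthonormal basis of $\mathcal V$. Define: - the sub-Laplacian on functions, $Lf=\operatorname{div}_\mu(\nabla_{\mathcal H}f)$, where $\mu$ is the Riemannian measure of $g_1$ and $\nabla_{\mathcal H}f$ is the horizontal gradient; - its covariant extension to one-forms, $L\eta=\sum_{i=1}^d\left(\nabla_{X_i}\nabla_{X_i}\eta-\nabla_{\nabla_{X_i}X_i}\eta\right)$; - $\mathfrak J\eta=\sum_{m=1}^{\mathfrak h}J_{Z_m}\big(d(\eta(Z_m))\big)$, where $J_Z$ is given on $\mathcal H$ by $g_{\mathcal H}(J_ZX,Y)=g_{\mathcal V}(Z,T(X,Y))$, is carried to horizontal one-forms by the duality of $g_{\mathcal H}$, and is zero on one-forms that vanish on $\mathcal H$; - $\mathfrak{Ric}_{\mathcal H}$, the fiberwise linear map on one-forms, with horizontal values, such that $\langle\mathfrak{Ric}_{\mathcal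 H}(df),dg\rangle_\varepsilon=\mathbf{Ricci}(\nabla_{\mathcal H}f,\nabla_{\mathcal H}g)$ for all smooth $f,g$, where $\mathbf{Ricci}(V,W)=\operatorname{tr}(U\mapsto R(U,V)W)$ is the Ricci curvature of $\nabla$ and $\langle\cdot,\cdot\rangle_\varepsilon$ is the cometric of $g_\varepsilon$. Assume that $\mathbb M$ is of Yang–Mills type: $\sum_{i=1}^d(\nabla_{X_i}T)(X_i,X)=0$ for every horizontal $X$ and every such frame. Put $$\square_\infty=L+2\mathfrak J-\mathfrak{Ric}_{\mathcal H}.$$ Then for every smooth function $f$ on $\mathbb M$ the function $Lf$ is smooth and $$dLf=\square_\infty\,df .$$ -/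

import Mathlib

open Bundle Manifold ContDiff Module

noncomputable section

namespace SubRiem

/-! ### Inner products on finite-dimensional vector spaces -/

/-- A real bilinear form that is symmetric and positive definite. -/
structure IsInner {V : Type*} [AddCommGroup V] [Module ℝ V] (B : LinearMap.BilinForm ℝ V) :
    Prop where
  symm : ∀ u v, B u v = B v u
  pos : ∀ u, u ≠ 0 → 0 < B u u

/-- A basis is orthonormal for `B`. -/
def IsOrthonormal {V : Type*} [AddCommGroup V] [Module ℝ V] (B : LinearMap.BilinForm ℝ V)
    {n : ℕ} (e : Basis (Fin n) ℝ V) : Prop :=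
  ∀ i j, B (e i) (e j) = if i = j then 1 else 0

theorem IsInner.nondegenerate {V : Type*} [AddCommGroup V] [Module ℝ V]
    {B : LinearMap.BilinForm ℝ V} (hB : IsInner B) : B.Nondegenerate := by
  refine ⟨fun u hu => ?_, fun u hu => ?_⟩
  · by_contra h
    exact (hB.pos u h).ne' (hu u)
  · by_contra h
    exact (hB.pos u h).ne' (hu u)

/-- The vector that represents a linear functional with respect to `B`:
`B (riesz φ) v = φ v` for all `v`. -/
def IsInner.riesz {V : Type*} [AddCommGroup V] [Module ℝ V] [FiniteDimensional ℝ V]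
    {B : LinearMap.BilinForm ℝ V} (hB : IsInner B) : Dual ℝ V ≃ₗ[ℝ] V :=
  (B.toDual hB.nondegenerate).symm

theorem IsInner.exists_orthonormal {V : Type*} [AddCommGroup V] [Module ℝ V]
    [FiniteDimensional ℝ V] {B : LinearMap.BilinForm ℝ V} (hB : IsInner B) {n : ℕ}
    (hn : finrank ℝ V = n) : ∃ e : Basis (Fin n) ℝ V, IsOrthonormal B e := by
  subst hn
  obtain ⟨v, hv⟩ := LinearMap.BilinForm.exists_orthogonal_basis (B := B) ⟨hB.symm⟩
  have hpos : ∀ i, 0 < B (v i) (v i) := fun i => hB.pos _ (v.ne_zero i)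
  have hs : ∀ i, IsUnit (Real.sqrt (B (v i) (v i)))⁻¹ := fun i =>
    (inv_ne_zero (Real.sqrt_pos.2 (hpos i)).ne').isUnit
  refine ⟨v.isUnitSMul hs, fun i j => ?_⟩
  simp only [Basis.isUnitSMul_apply, map_smul, LinearMap.smul_apply, smul_eq_mul]
  split_ifs with h
  · subst h
    have h1 := Real.mul_self_sqrt (hpos i).le
    have h2 := (Real.sqrt_pos.2 (hpos i)).ne'
    field_simp
    nlinarith
  · have : B (v i) (v j) = 0 := hv h
    simp [this]

/-- An orthonormal basis. -/
def IsInner.orthobasis {V : Type*} [AddCommGroup V] [Module ℝ V]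
    [FiniteDimensional ℝ V] {B : LinearMap.BilinForm ℝ V} (hB : IsInner B) {n : ℕ}
    (hn : finrank ℝ V = n) : Basis (Fin n) ℝ V :=
  (hB.exists_orthonormal hn).choose

/-! ### Vector fields on an `n`-dimensional manifold -/

/-- Model space of an `n`-dimensional manifold. -/
abbrev Model (n : ℕ) : Type := EuclideanSpace ℝ (Fin n)

/-- The tangent space at `x`. -/
abbrev Tan (n : ℕ) {M : Type*} [TopologicalSpace M] [ChartedSpace (Model n) M] (x : M) : Type :=
  TangentSpace (𝓡 n) x

instance (n : ℕ) {M : Type*} [TopologicalSpace M] [ChartedSpace (Model n) M] (x : M) :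
    FiniteDimensional ℝ (Tan n x) :=
  inferInstanceAs (FiniteDimensional ℝ (Model n))

instance (n : ℕ) {M : Type*} [TopologicalSpace M] [ChartedSpace (Model n) M] (x : M) :
    T2Space (Tan n x) :=
  inferInstanceAs (T2Space (Model n))

section Fields

variable {n : ℕ} {M : Type*} [TopologicalSpace M] [ChartedSpace (Model n) M]
  [IsManifold (𝓡 n) ∞ M]

/-- The vector field `X` is of class `C^∞` on the set `U`. -/
def SmoothOn (U : Set M) (X : ∀ x : M, Tan n x) : Prop :=
  ContMDiffOn (𝓡 n) (𝓡 n).tangent ∞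
    (fun x => (TotalSpace.mk' (Model n) x (X x) : TangentBundle (𝓡 n) M)) U

/-- The Lie bracket `[X, Y]` of vector fields. -/
abbrev bracket (X Y : ∀ x : M, Tan n x) : ∀ x : M, Tan n x :=
  VectorField.mlieBracket (𝓡 n) X Y

/-- The differential `df` of a function. -/
abbrev diff (f : M → ℝ) (x : M) : Tan n x →L[ℝ] ℝ := mvfderiv (𝓡 n) f x

/-- The iterated brackets of smooth vector fields tangent to a distribution. -/
inductive IteratedBracket (hor : ∀ x : M, Submodule ℝ (Tan n x)) : (∀ x : M, Tan n x) → Prop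
  | field (X : ∀ x : M, hor x) (hX : SmoothOn Set.univ (fun x => (X x : Tan n x))) :
      IteratedBracket hor (fun x => (X x : Tan n x))
  | bracket (X Y : ∀ x : M, Tan n x) (hX : IteratedBracket hor X) (hY : IteratedBracket hor Y) :
      IteratedBracket hor (bracket X Y)

/-- A vector field near `x` with value `v` at `x` (of class `C^∞` near `x`). -/
abbrev ext {x : M} (v : Tan n x) : ∀ y : M, Tan n y := FiberBundle.extend (Model n) v

end Fields

/-! ### Affine connections

For a connection `cov`, the vector `cov Y x u` is `∇_u Y` at the point `x`. -/

/-- A connection on the tangent bundle. -/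
abbrev Connection (n : ℕ) (M : Type*) [TopologicalSpace M] [ChartedSpace (Model n) M]
    [IsManifold (𝓡 n) ∞ M] :=
  CovariantDerivative (𝓡 n) (Model n) (TangentSpace (𝓡 n) : M → Type _)

namespace Connection

variable {n : ℕ} {M : Type*} [TopologicalSpace M] [ChartedSpace (Model n) M]
  [IsManifold (𝓡 n) ∞ M] (cov : Connection n M)

/-- The torsion tensor `T(u, v)`. -/
abbrev tor (x : M) (u v : Tan n x) : Tan n x := CovariantDerivative.torsion cov x u v

/-- The covariant derivative of the torsion,
`(∇_u T)(v, w) = ∇_u (T(V, W)) - T(∇_u V, w) - T(v, ∇_u W)`, where `V`, `W` extend `v`, `w`. -/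
def covTor (x : M) (u v w : Tan n x) : Tan n x :=
  cov (fun y => tor cov y (ext v y) (ext w y)) x u
    - tor cov x (cov (ext v) x u) w - tor cov x v (cov (ext w) x u)

/-- The curvature `R(u, v) w`, that is, `∇_U ∇_V W - ∇_V ∇_U W - ∇_[U, V] W` at `x`,
where `U`, `V`, `W` extend `u`, `v`, `w`. -/
def curv (x : M) (u v w : Tan n x) : Tan n x :=
  cov (fun y => cov (ext w) y (ext v y)) x u - cov (fun y => cov (ext w) y (ext u y)) x v
    - cov (ext w) x (bracket (ext u) (ext v) x)

/-- The Ricci curvature `Ricci(v, w)`, the trace of `u ↦ R(u, v) w`. -/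
def ricci (x : M) (v w : Tan n x) : ℝ :=
  ∑ a, (finBasis ℝ (Tan n x)).coord a (curv cov x (finBasis ℝ (Tan n x) a) v w)

/-- A one-form `η` is differentiable at `x`. -/
def FormDiffAt (η : ∀ x : M, Tan n x →L[ℝ] ℝ) (x : M) : Prop :=
  ∀ Y : ∀ x : M, Tan n x,
    MDifferentiableAt (𝓡 n) (𝓡 n).tangent
      (fun y => (TotalSpace.mk' (Model n) y (Y y) : TangentBundle (𝓡 n) M)) x →
    MDifferentiableAt (𝓡 n) 𝓘(ℝ, ℝ) (fun y => η y (Y y)) x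

/-- For a one-form `η`, a vector field `Y` and a vector `u` at `x`, the number
`u (η(Y)) - η(∇_u Y)`. -/
def covFormAux (η : ∀ x : M, Tan n x →L[ℝ] ℝ) (x : M) (u : Tan n x) (Y : ∀ x : M, Tan n x) : ℝ :=
  diff (fun y => η y (Y y)) x u - η x (cov Y x u)

theorem covFormAux_tensorial {η : ∀ x : M, Tan n x →L[ℝ] ℝ} {x : M} (hη : FormDiffAt η x)
    (u : Tan n x) : TensorialAt (𝓡 n) (Model n) (covFormAux cov η x u) x where
  smul {f Y} hf hY := by
    simp [covFormAux, diff, mvfderiv_fun_mul hf (hη Y hY),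
      cov.isCovariantDerivativeOn.leibniz hY hf]
    ring
  add {Y Y'} hY hY' := by
    simp [covFormAux, diff, mvfderiv_fun_add (hη Y hY) (hη Y' hY'),
      cov.isCovariantDerivativeOn.add hY hY']
    ring

open Classical in
/-- The covariant derivative `∇_u η` at `x` of a one-form that is differentiable at `x`: the
covector with `(∇_u η)(Y) = u (η(Y)) - η(∇_u Y)`. -/
def covForm (η : ∀ x : M, Tan n x →L[ℝ] ℝ) (x : M) (u : Tan n x) : Tan n x →L[ℝ] ℝ :=
  if hη : FormDiffAt η x then
    TensorialAt.mkHom (covFormAux cov η x u) x (covFormAux_tensorial cov hη u)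
  else 0

/-- The second covariant derivative `∇_u ∇_V η - ∇_{∇_u V} η` of a one-form at `x`,
where `V` extends `v`. -/
def covForm₂ (η : ∀ x : M, Tan n x →L[ℝ] ℝ) (x : M) (u v : Tan n x) : Tan n x →L[ℝ] ℝ :=
  covForm cov (fun y => covForm cov η y (ext v y)) x u - covForm cov η x (cov (ext v) x u)

end Connection

/-! ### Divergence with respect to a Riemannian metric -/

section Divergence

variable {n : ℕ} {M : Type*} [TopologicalSpace M] [ChartedSpace (Model n) M]
  [IsManifold (𝓡 n) ∞ M]

/-- The density `√(det (g(∂_k, ∂_l)))` of the Riemannian measure of `g` in the preferred chart at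
`x₀`, at the point with coordinates `p`. -/
def chartDensity (g : ∀ x : M, LinearMap.BilinForm ℝ (Tan n x)) (x₀ : M) (p : Model n) : ℝ :=
  Real.sqrt (Matrix.det (Matrix.of fun k l : Fin n =>
    g ((extChartAt (𝓡 n) x₀).symm p)
      (mfderiv (𝓡 n) (𝓡 n) (extChartAt (𝓡 n) x₀).symm p (EuclideanSpace.single k (1 : ℝ)))
      (mfderiv (𝓡 n) (𝓡 n) (extChartAt (𝓡 n) x₀).symm p (EuclideanSpace.single l (1 : ℝ)))))

/-- The coordinates `(Y^1, …, Y^n)` of the vector field `Y` in the preferred chart at `x₀`. -/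
def chartField (Y : ∀ x : M, Tan n x) (x₀ : M) (p : Model n) : Model n :=
  mfderiv (𝓡 n) (𝓡 n) (extChartAt (𝓡 n) x₀) ((extChartAt (𝓡 n) x₀).symm p)
    (Y ((extChartAt (𝓡 n) x₀).symm p))

/-- The divergence of `Y` with respect to the Riemannian measure of `g`, that is,
`ρ⁻¹ ∑ k, ∂_k (ρ Y^k)`, where `ρ = √(det g)` is the density of that measure in a chart. -/
def divergence (g : ∀ x : M, LinearMap.BilinForm ℝ (Tan n x)) (Y : ∀ x : M, Tan n x) (x₀ : M) :
    ℝ :=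
  (chartDensity g x₀ (extChartAt (𝓡 n) x₀ x₀))⁻¹ *
    LinearMap.trace ℝ (Model n)
      (fderiv ℝ (fun p => chartDensity g x₀ p • chartField Y x₀ p)
        (extChartAt (𝓡 n) x₀ x₀)).toLinearMap

end Divergence

/-! ### Sub-Riemannian structures -/

/-- A sub-Riemannian structure of rank `d` on an `n`-dimensional manifold: a smooth bracket
generating distribution of rank `d` with a smooth fiberwise inner product. -/
structure SubRiemannian (n d : ℕ) (M : Type*) [TopologicalSpace M] [ChartedSpace (Model n) M]
    [IsManifold (𝓡 n) ∞ M] where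
  /-- the horizontal distribution -/
  hor : ∀ x : M, Submodule ℝ (Tan n x)
  /-- the inner product on the distribution -/
  metric : ∀ x : M, LinearMap.BilinForm ℝ (hor x)
  /-- the distribution is smooth of rank `d` -/
  exists_frame : ∀ x₀ : M, ∃ U : Set M, IsOpen U ∧ x₀ ∈ U ∧ ∃ X : Fin d → ∀ x : M, hor x,
    (∀ i, SmoothOn U (fun x => (X i x : Tan n x))) ∧
    ∀ x ∈ U, LinearIndependent ℝ (fun i => X i x) ∧ ⊤ ≤ Submodule.span ℝ (Set.range fun i => X i x)
  metric_inner : ∀ x, IsInner (metric x)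
  metric_smooth : ∀ (U : Set M) (X Y : ∀ x : M, hor x), IsOpen U →
    SmoothOn U (fun x => (X x : Tan n x)) → SmoothOn U (fun x => (Y x : Tan n x)) →
    ContMDiffOn (𝓡 n) 𝓘(ℝ, ℝ) ∞ (fun x => metric x (X x) (Y x)) U
  bracket_generating : ∀ x : M,
    Submodule.span ℝ {v : Tan n x | ∃ X, IteratedBracket hor X ∧ X x = v} = ⊤

namespace SubRiemannian

variable {n d : ℕ} {M : Type*} [TopologicalSpace M] [ChartedSpace (Model n) M]
  [IsManifold (𝓡 n) ∞ M] (S : SubRiemannian n d M)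

theorem finrank_hor (x : M) : finrank ℝ (S.hor x) = d := by
  obtain ⟨U, -, hx, X, -, hX⟩ := S.exists_frame x
  obtain ⟨h1, h2⟩ := hX x hx
  simpa using finrank_eq_card_basis (Basis.mk h1 h2)

/-- A smooth vector field `Z` is a sub-Riemannian Killing field: `[Z, X]` is horizontal for every
horizontal `X`, and `L_Z g = 0`, that is, `Z (g(X, Y)) = g([Z, X], Y) + g(X, [Z, Y])`. -/
structure IsKilling (Z : ∀ x : M, Tan n x) : Prop where
  smooth : SmoothOn Set.univ Z
  bracket_mem : ∀ (U : Set M) (X : ∀ x : M, S.hor x), IsOpen U →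
    SmoothOn U (fun x => (X x : Tan n x)) → ∀ x ∈ U, bracket Z (fun y => (X y : Tan n y)) x ∈ S.hor x
  lie_metric : ∀ (U : Set M) (X Y : ∀ x : M, S.hor x) (hU : IsOpen U)
    (hX : SmoothOn U (fun x => (X x : Tan n x))) (hY : SmoothOn U (fun x => (Y x : Tan n x)))
    (x : M) (hx : x ∈ U),
    diff (fun y => S.metric y (X y) (Y y)) x (Z x) =
      S.metric x ⟨bracket Z (fun y => (X y : Tan n y)) x, bracket_mem U X hU hX x hx⟩ (Y x) +
      S.metric x (X x) ⟨bracket Z (fun y => (Y y : Tan n y)) x, bracket_mem U Y hU hY x hx⟩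

end SubRiemannian

/-- A sub-Riemannian structure of rank `d` with transverse symmetries on a manifold of dimension
`d + h`: there is an `h`-dimensional Lie algebra `sym` of sub-Riemannian Killing vector fields whose
values span a complement of the horizontal space at each point.  The Lie algebra carries an
inner product. -/
structure TransverseSymmetric (d h : ℕ) (M : Type*) [TopologicalSpace M]
    [ChartedSpace (Model (d + h)) M] [IsManifold (𝓡 (d + h)) ∞ M] extends
    SubRiemannian (d + h) d M where
  /-- the Lie algebra of transverse symmetries -/
  sym : Submodule ℝ (∀ x : M, Tan (d + h) x)
  sym_finite : FiniteDimensional ℝ sym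
  finrank_sym : finrank ℝ sym = h
  sym_killing : ∀ Z ∈ sym, toSubRiemannian.IsKilling Z
  sym_bracket : ∀ Z ∈ sym, ∀ W ∈ sym, bracket Z W ∈ sym
  isCompl : ∀ x : M, IsCompl (hor x) (sym.map (LinearMap.proj x))
  /-- the inner product on the Lie algebra of transverse symmetries -/
  symMetric : LinearMap.BilinForm ℝ sym
  symMetric_inner : IsInner symMetric

namespace TransverseSymmetric

variable {d h : ℕ} {M : Type*} [TopologicalSpace M] [ChartedSpace (Model (d + h)) M]
  [IsManifold (𝓡 (d + h)) ∞ M] (S : TransverseSymmetric d h M)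

instance : FiniteDimensional ℝ S.sym := S.sym_finite

/-- The vertical space at `x`. -/
def ver (x : M) : Submodule ℝ (Tan (d + h) x) := S.sym.map (LinearMap.proj x)

/-- The map `(u, Z) ↦ u + Z(x)`. -/
def splitMap (x : M) : (S.hor x × S.sym) →ₗ[ℝ] Tan (d + h) x :=
  (S.hor x).subtype.coprod ((LinearMap.proj x).comp S.sym.subtype)

theorem splitMap_bijective (x : M) : Function.Bijective (S.splitMap x) := by
  have hs : Function.Surjective (S.splitMap x) := by
    rw [← LinearMap.range_eq_top, splitMap, LinearMap.range_coprod, Submodule.range_subtype,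
      LinearMap.range_comp, Submodule.range_subtype]
    exact (S.isCompl x).sup_eq_top
  have hr : finrank ℝ (S.hor x × S.sym) = finrank ℝ (Tan (d + h) x) := by
    have h1 : finrank ℝ (Tan (d + h) x) = d + h :=
      finrank_euclideanSpace_fin (𝕜 := ℝ) (n := d + h)
    rw [finrank_prod, S.finrank_hor x, S.finrank_sym, h1]
  exact ⟨(LinearMap.injective_iff_surjective_of_finrank_eq_finrank hr).2 hs, hs⟩

/-- The linear isomorphism `(u, Z) ↦ u + Z(x)` from the sum of the horizontal space at `x` and the
Lie algebra of transverse symmetries onto the tangent space at `x`. -/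
def split (x : M) : (S.hor x × S.sym) ≃ₗ[ℝ] Tan (d + h) x :=
  LinearEquiv.ofBijective (S.splitMap x) (S.splitMap_bijective x)

/-- The horizontal part of a tangent vector. -/
def horPart (x : M) : Tan (d + h) x →ₗ[ℝ] S.hor x :=
  (LinearMap.fst ℝ _ _).comp (S.split x).symm.toLinearMap

/-- The element of the Lie algebra of transverse symmetries whose value at `x` is the vertical part
of a given tangent vector. -/
def symPart (x : M) : Tan (d + h) x →ₗ[ℝ] S.sym :=
  (LinearMap.snd ℝ _ _).comp (S.split x).symm.toLinearMap

/-- The horizontal inner product, extended by zero to the vertical space. -/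
def gH (x : M) : LinearMap.BilinForm ℝ (Tan (d + h) x) :=
  (S.metric x).compl₁₂ (S.horPart x) (S.horPart x)

/-- The vertical inner product, extended by zero to the horizontal space. -/
def gV (x : M) : LinearMap.BilinForm ℝ (Tan (d + h) x) :=
  S.symMetric.compl₁₂ (S.symPart x) (S.symPart x)

/-- The Riemannian metric `g_ε = g_H ⊕ ε⁻¹ g_V`. -/
def gEps (ε : ℝ) (x : M) : LinearMap.BilinForm ℝ (Tan (d + h) x) :=
  S.gH x + ε⁻¹ • S.gV x

/-- A `g_H`-orthonormal basis of the horizontal space at `x`. -/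
def horBasis (x : M) : Basis (Fin d) ℝ (S.hor x) :=
  (S.metric_inner x).orthobasis (S.finrank_hor x)

/-- A `g_V`-orthonormal basis of the Lie algebra of transverse symmetries. -/
def symBasis : Basis (Fin h) ℝ S.sym :=
  S.symMetric_inner.orthobasis S.finrank_sym

/-- The canonical connection of a sub-Riemannian manifold with transverse symmetries is the
connection with the following properties. -/
structure IsCanonical (cov : Connection (d + h) M) : Prop where
  smooth : CovariantDerivative.ContMDiffCovariantDerivative cov ∞
  metric : ∀ ε : ℝ, 0 < ε → ∀ (U : Set M) (X Y : ∀ x : M, Tan (d + h) x), IsOpen U →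
    SmoothOn U X → SmoothOn U Y → ∀ x ∈ U, ∀ u : Tan (d + h) x,
    diff (fun y => S.gEps ε y (X y) (Y y)) x u =
      S.gEps ε x (cov X x u) (Y x) + S.gEps ε x (X x) (cov Y x u)
  horizontal : ∀ (U : Set M) (Y : ∀ x : M, S.hor x), IsOpen U →
    SmoothOn U (fun x => (Y x : Tan (d + h) x)) →
    ∀ x ∈ U, ∀ u ∈ S.hor x, cov (fun y => (Y y : Tan (d + h) y)) x u ∈ S.hor x
  vertical : ∀ Z ∈ S.sym, ∀ x, cov Z x = 0
  torsion_vertical : ∀ x, ∀ u ∈ S.hor x, ∀ v ∈ S.hor x, Connection.tor cov x u v ∈ S.ver x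
  torsion_zero : ∀ x, ∀ u ∈ S.hor x, ∀ Z ∈ S.sym, Connection.tor cov x u (Z x) = 0

/-- The Yang–Mills condition for the connection `cov`: `∑ i, (∇_{X_i} T)(X_i, X) = 0` for every
horizontal `X` and every horizontal orthonormal frame `X_1, …, X_d`. -/
def IsYangMills (cov : Connection (d + h) M) : Prop :=
  ∀ (x : M) (e : Basis (Fin d) ℝ (S.hor x)), IsOrthonormal (S.metric x) e →
    ∀ u : S.hor x, ∑ i, Connection.covTor cov x (e i : Tan (d + h) x) (e i) u = 0

/-- The horizontal vector dual to a covector: `g_H(sharp η, u) = η(u)` for all horizontal `u`. -/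
def sharp (x : M) (η : Tan (d + h) x →L[ℝ] ℝ) : S.hor x :=
  (S.metric_inner x).riesz (η.toLinearMap.comp (S.hor x).subtype)

/-- The horizontal covector `g_H(u, ·)`, which vanishes on the vertical space. -/
def flat (x : M) (u : S.hor x) : Tan (d + h) x →L[ℝ] ℝ :=
  LinearMap.toContinuousLinearMap (S.gH x u)

/-- The horizontal gradient of a function. -/
def horGrad (f : M → ℝ) (x : M) : Tan (d + h) x := S.sharp x (diff f x)

/-- The sub-Laplacian on functions: `L f` is the divergence of the horizontal gradient of `f` with
respect to the Riemannian measure `μ` of `g_1`.  By the divergence theorem, `L` is the generator of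
the Dirichlet form `(f, g) ↦ ∫ g_H(∇_H f, ∇_H g) dμ`. -/
def subLaplacian (f : M → ℝ) (x : M) : ℝ := divergence (S.gEps 1) (S.horGrad f) x

/-- The covariant extension of the sub-Laplacian to one-forms,
`L η = ∑ i, (∇_{X_i} ∇_{X_i} η - ∇_{∇_{X_i} X_i} η)`. -/
def subLaplacianForm (cov : Connection (d + h) M) (η : ∀ x : M, Tan (d + h) x →L[ℝ] ℝ) (x : M) :
    Tan (d + h) x →L[ℝ] ℝ :=
  ∑ i, Connection.covForm₂ cov η x (S.horBasis x i) (S.horBasis x i)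

/-- The map `J_Z` on horizontal vectors: `g_H(J_Z u, v) = g_V(Z, T(u, v))` for all
horizontal `v`. -/
def J (cov : Connection (d + h) M) (Z : S.sym) (x : M) (u : S.hor x) : S.hor x :=
  (S.metric_inner x).riesz
    ((S.symMetric Z).comp ((S.symPart x).comp
      ((CovariantDerivative.torsion cov x (u : Tan (d + h) x)).toLinearMap.comp
        (S.hor x).subtype)))

/-- The map `J_Z` on covectors, by duality; it vanishes on vertical covectors. -/
def JForm (cov : Connection (d + h) M) (Z : S.sym) (x : M) (η : Tan (d + h) x →L[ℝ] ℝ) :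
    Tan (d + h) x →L[ℝ] ℝ :=
  S.flat x (S.J cov Z x (S.sharp x η))

/-- The first order operator `𝔍 η = ∑ m, J_{Z_m} (d (ι_{Z_m} η))` on one-forms. -/
def frakJ (cov : Connection (d + h) M) (η : ∀ x : M, Tan (d + h) x →L[ℝ] ℝ) (x : M) :
    Tan (d + h) x →L[ℝ] ℝ :=
  ∑ m, S.JForm cov (S.symBasis m) x (diff (fun y => η y ((S.symBasis m : ∀ y, Tan (d + h) y) y)) x)

/-- The fiberwise linear map `Ric_H` on one-forms: `Ric_H η` is the horizontal covector with
`(Ric_H η)(u) = Ricci(sharp η, u)` for all horizontal `u`, so that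
`⟨Ric_H df, dg⟩ = Ricci(∇_H f, ∇_H g)`. -/
def frakRic (cov : Connection (d + h) M) (η : ∀ x : M, Tan (d + h) x →L[ℝ] ℝ) (x : M) :
    Tan (d + h) x →L[ℝ] ℝ :=
  ∑ i, Connection.ricci cov x (S.sharp x (η x)) (S.horBasis x i) • S.flat x (S.horBasis x i)

/-- The operator `□_∞ = L + 2 𝔍 - Ric_H` on one-forms. -/
def boxInfty (cov : Connection (d + h) M) (η : ∀ x : M, Tan (d + h) x →L[ℝ] ℝ) (x : M) :
    Tan (d + h) x →L[ℝ] ℝ :=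
  S.subLaplacianForm cov η x + (2 : ℝ) • S.frakJ cov η x - S.frakRic cov η x

end TransverseSymmetric

end SubRiem

end

noncomputable section

namespace SubRiem

set_option linter.unusedSectionVars false

/-! ### Algebra of connections -/

/-! Write `Hess f(U, V) = U V f - (∇_U V) f`. In an orthonormal frame the divergence of `Y` is `∑
⟨[E_a, Y], E_a⟩` (`divergence_eq`), and for the horizontal gradient this sum is `∑ Hess f(X_i, X_i)`
(`AdaptedConn.sum_G_br_eq_lap`), so `L f` is the horizontal trace of the Hessian. Since `∇` is
metric and preserves the horizontal bundle, it commutes with this trace: `U (L f) = ∑ (∇_U Hess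
f)(X_i, X_i)` (`AdaptedConn.act_lap`). On the other side `(L df)(U) = ∑ (∇_{X_i} Hess f)(X_i, U)`.
The theorem therefore amounts to moving `U` from the slot of differentiation to the last slot of the
Hessian. `ConnAlg.covHess_comm` does this; the price is a curvature term, two Hessians with an entry
`T(U, X_i)`, and a derivative of the torsion.

For vertical `U` every error term vanishes: `T(Z, X) = 0`, and `R(Z, X) = 0` because its components
are symmetric in one pair of indices and skew in an overlapping pair (`AdaptedConn.G_curv_Z_X`).
Both `𝔍 df` and `Ric_H df` vanish on vertical vectors as well. For horizontal `U` the torsion is a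
combination of the `Z_m`. The two Hessian terms then coincide, and they reduce to `X_i Z_m f`
because `∇ Z_m = 0`; this is `2 𝔍`. The curvature term becomes `Ricci(∇_H f, U)` once the horizontal
Ricci curvature is known to be symmetric, which follows from the first Bianchi identity, whose
torsion terms are all vertical. The remaining term is the divergence of the torsion, which the
Yang–Mills condition removes.

These identities are proved for an abstract module of fields over a commutative ring of functions
(`ConnAlg`, `AdaptedConn`), where being a tensor means being linear over the ring. Smooth functions
and fields on an open set that carries an orthonormal horizontal frame give an instance (`connAlg`,
`Frame.adaptedConn`), and the result is evaluated at a point. Gram–Schmidt produces a frame that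
takes at that point the values of the basis used to define the operators.

For existence, Koszul's formula dictates the coefficients of the connection in an adapted frame, and
the Killing property makes them skew. At each point the connection is defined with a frame of that
point. The uniqueness argument does not need smoothness, so it applies to this pointwise definition,
and shows that near any point it agrees with the connection of one fixed smooth frame
(`IsPreCanonical.eq_canonical`). -/

/-- A module `𝔛` of abstract vector fields over a commutative ring `A` of functions, with a bracket
and a connection. -/
structure ConnAlg (A 𝔛 : Type*) [CommRing A] [Algebra ℝ A] [AddCommGroup 𝔛] [Module A 𝔛] where
  /-- the derivative of a function along a field -/
  act : 𝔛 →ₗ[A] Derivation ℝ A A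
  /-- the bracket -/
  br : 𝔛 → 𝔛 → 𝔛
  /-- the connection -/
  nab : 𝔛 →ₗ[A] (𝔛 →+ 𝔛)
  nab_smul : ∀ U f V, nab U (f • V) = f • nab U V + act U f • V
  act_br : ∀ U V f, act (br U V) f = act U (act V f) - act V (act U f)
  br_add : ∀ U V W, br U (V + W) = br U V + br U W
  br_smul : ∀ U f V, br U (f • V) = act U f • V + f • br U V
  br_swap : ∀ U V, br U V = - br V U
  jacobi : ∀ U V W, br U (br V W) = br (br U V) W + br V (br U W)

namespace ConnAlg

variable {A 𝔛 : Type*} [CommRing A] [Algebra ℝ A] [AddCommGroup 𝔛] [Module A 𝔛]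
  (C : ConnAlg A 𝔛)

theorem br_add_left (U V W : 𝔛) : C.br (U + V) W = C.br U W + C.br V W := by
  rw [C.br_swap, C.br_add, C.br_swap W U, C.br_swap W V]
  abel

theorem br_smul_left (f : A) (U V : 𝔛) : C.br (f • U) V = f • C.br U V - C.act V f • U := by
  rw [C.br_swap, C.br_smul, C.br_swap V U, smul_neg]
  abel

theorem act_sum {α : Type*} (s : Finset α) (V : α → 𝔛) (f : A) :
    C.act (∑ i ∈ s, V i) f = ∑ i ∈ s, C.act (V i) f := by
  rw [map_sum, ← Derivation.coeFnAddMonoidHom_apply, map_sum, Finset.sum_apply]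
  rfl

theorem br_neg (U V : 𝔛) : C.br U (-V) = - C.br U V := by
  have h := C.br_smul U (-1) V
  simpa using h

/-- The torsion. -/
def tor : 𝔛 →ₗ[A] 𝔛 →ₗ[A] 𝔛 :=
  LinearMap.mk₂ A (fun U V => C.nab U V - C.nab V U - C.br U V)
    (fun U U' V => by simp only [map_add, AddMonoidHom.add_apply, br_add_left]; abel)
    (fun f U V => by
      simp only [map_smul, AddMonoidHom.smul_apply, nab_smul, br_smul_left]; module)
    (fun U V V' => by simp only [map_add, AddMonoidHom.add_apply, br_add]; abel)
    (fun f U V => by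
      simp only [map_smul, AddMonoidHom.smul_apply, nab_smul, br_smul]; module)

theorem tor_apply (U V : 𝔛) : C.tor U V = C.nab U V - C.nab V U - C.br U V := rfl

theorem tor_swap (U V : 𝔛) : C.tor U V = - C.tor V U := by
  rw [tor_apply, tor_apply, C.br_swap]
  abel

/-- The Hessian of a function. -/
def hess (f : A) : 𝔛 →ₗ[A] 𝔛 →ₗ[A] A :=
  LinearMap.mk₂ A (fun U V => C.act U (C.act V f) - C.act (C.nab U V) f)
    (fun U U' V => by simp only [map_add, AddMonoidHom.add_apply, Derivation.add_apply]; ring)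
    (fun f U V => by
      simp only [map_smul, AddMonoidHom.smul_apply, Derivation.smul_apply, smul_eq_mul]; ring)
    (fun U V V' => by simp only [map_add, Derivation.add_apply]; ring)
    (fun f U V => by
      simp only [map_smul, nab_smul, map_add, Derivation.add_apply, Derivation.smul_apply,
        Derivation.leibniz, smul_eq_mul]
      ring)

theorem hess_apply (f : A) (U V : 𝔛) :
    C.hess f U V = C.act U (C.act V f) - C.act (C.nab U V) f := rfl

theorem hess_swap (f : A) (U V : 𝔛) :
    C.hess f U V = C.hess f V U - C.act (C.tor U V) f := by
  simp only [hess_apply, tor_apply, map_sub, Derivation.sub_apply, act_br]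
  ring

/-- The covariant derivative of the Hessian, as a linear map in its second argument. -/
def covHess (f : A) (U W : 𝔛) : 𝔛 →ₗ[A] A where
  toFun V := C.act U (C.hess f V W) - C.hess f (C.nab U V) W - C.hess f V (C.nab U W)
  map_add' V V' := by simp only [map_add, LinearMap.add_apply]; ring
  map_smul' g V := by
    simp only [map_smul, nab_smul, map_add, LinearMap.add_apply, LinearMap.smul_apply,
      Derivation.leibniz, smul_eq_mul, RingHom.id_apply]
    ring

theorem covHess_apply (f : A) (U V W : 𝔛) : C.covHess f U W V =
    C.act U (C.hess f V W) - C.hess f (C.nab U V) W - C.hess f V (C.nab U W) := rfl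

/-- The curvature. -/
def curv (U V W : 𝔛) : 𝔛 := C.nab U (C.nab V W) - C.nab V (C.nab U W) - C.nab (C.br U V) W

theorem curv_swap (U V W : 𝔛) : C.curv U V W = - C.curv V U W := by
  simp only [curv, C.br_swap U V, map_neg, AddMonoidHom.neg_apply]
  abel

/-- The curvature as a linear map in its first argument. -/
def curvFst (V W : 𝔛) : 𝔛 →ₗ[A] 𝔛 where
  toFun U := C.curv U V W
  map_add' U U' := by
    simp only [curv, map_add, AddMonoidHom.add_apply, br_add_left]; abel
  map_smul' g U := by
    simp only [curv, map_smul, AddMonoidHom.smul_apply, nab_smul, br_smul_left, map_sub,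
      AddMonoidHom.sub_apply, RingHom.id_apply]
    module

/-- The curvature as a linear map in its second argument. -/
def curvSnd (U W : 𝔛) : 𝔛 →ₗ[A] 𝔛 where
  toFun V := C.curv U V W
  map_add' V V' := by
    simp only [curv, map_add, AddMonoidHom.add_apply, br_add]; abel
  map_smul' g V := by
    simp only [curv, map_smul, AddMonoidHom.smul_apply, nab_smul, br_smul, map_add,
      AddMonoidHom.add_apply, RingHom.id_apply]
    module

/-- The curvature as a linear map in its third argument. -/
def curvThd (U V : 𝔛) : 𝔛 →ₗ[A] 𝔛 where
  toFun W := C.curv U V W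
  map_add' W W' := by
    simp only [curv, map_add]; abel
  map_smul' g W := by
    simp only [curv, nab_smul, map_add, act_br, RingHom.id_apply]
    module

/-- The covariant derivative of the torsion. -/
def covTor (U V W : 𝔛) : 𝔛 :=
  C.nab U (C.tor V W) - C.tor (C.nab U V) W - C.tor V (C.nab U W)

theorem covTor_swap (U V W : 𝔛) : C.covTor U V W = - C.covTor U W V := by
  simp only [covTor, C.tor_swap V W, C.tor_swap (C.nab U V), C.tor_swap V (C.nab U W), map_neg]
  abel

/-- The covariant derivative of the torsion as a linear map in its second argument. -/
def covTorFst (U W : 𝔛) : 𝔛 →ₗ[A] 𝔛 where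
  toFun V := C.covTor U V W
  map_add' V V' := by simp only [covTor, map_add, LinearMap.add_apply]; abel
  map_smul' g V := by
    simp only [covTor, map_smul, nab_smul, map_add, LinearMap.add_apply, LinearMap.smul_apply,
      RingHom.id_apply]
    module

/-- The covariant derivative of the torsion as a linear map in its third argument. -/
def covTorSnd (U V : 𝔛) : 𝔛 →ₗ[A] 𝔛 where
  toFun W := C.covTor U V W
  map_add' W W' := by simp only [covTor, map_add]; abel
  map_smul' g W := by
    simp only [covTor, map_smul, nab_smul, map_add, RingHom.id_apply]
    module

/-- The Ricci identity for the one-form `df`: antisymmetrizing a second covariant derivative gives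
the curvature and, for a connection with torsion, a first derivative along the torsion. -/
theorem covHess_comm_fst (f : A) (U V W : 𝔛) : C.covHess f U W V =
    C.covHess f V W U - C.act (C.curv U V W) f - C.hess f (C.tor U V) W := by
  simp only [covHess_apply, curv, tor_apply, map_sub, LinearMap.sub_apply, Derivation.sub_apply]
  simp only [hess_apply, act_br, map_sub]
  ring

/-- The covariant derivative of the identity `hess_swap`: the derivative of `T(V, W) f` produces
both a Hessian and `∇T`. -/
theorem covHess_comm_snd (f : A) (U V W : 𝔛) : C.covHess f U W V =
    C.covHess f U V W - C.hess f U (C.tor V W) - C.act (C.covTor U V W) f := by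
  simp only [covHess_apply, C.hess_swap f V W, C.hess_swap f (C.nab U V) W,
    C.hess_swap f V (C.nab U W), covTor, map_sub, Derivation.sub_apply, C.hess_apply f U]
  ring

/-- The exchange behind the whole theorem: first the two outer entries `U` and `V` are swapped, then
the two entries of the Hessian. -/
theorem covHess_comm (f : A) (U V : 𝔛) : C.covHess f U V V =
    C.covHess f V U V - C.hess f V (C.tor U V) - C.hess f (C.tor U V) V
      - C.act (C.curv U V V) f + C.act (C.covTor V V U) f := by
  rw [covHess_comm_fst, covHess_comm_snd, C.covTor_swap V V U, map_neg, Derivation.neg_apply]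
  ring

/-- The double brackets left in the cyclic sum cancel by Jacobi. The torsion is kept in terms of
`∇_U (T(V, W))` and `T(U, [V, W])`, each of which will be seen to be vertical. -/
theorem bianchi (U V W : 𝔛) : C.curv U V W + C.curv V W U + C.curv W U V =
    (C.nab U (C.tor V W) + C.nab V (C.tor W U) + C.nab W (C.tor U V)) +
    (C.tor U (C.br V W) + C.tor V (C.br W U) + C.tor W (C.br U V)) := by
  have hj := C.jacobi U V W
  rw [C.br_swap (C.br U V) W, C.br_swap U W, br_neg] at hj
  have hj' : C.br U (C.br V W) + C.br V (C.br W U) + C.br W (C.br U V) = 0 := by rw [hj]; abel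
  have : C.curv U V W + C.curv V W U + C.curv W U V =
    (C.nab U (C.tor V W) + C.nab V (C.tor W U) + C.nab W (C.tor U V)) +
    (C.tor U (C.br V W) + C.tor V (C.br W U) + C.tor W (C.br U V)) +
    (C.br U (C.br V W) + C.br V (C.br W U) + C.br W (C.br U V)) := by
    simp only [curv, tor_apply, map_sub]
    abel
  rw [this, hj', add_zero]

end ConnAlg

/-! ### Connections adapted to a horizontal and a vertical frame -/

/-- A connection that is adapted to orthonormal families `X` (horizontal) and `Z` (vertical). -/
structure AdaptedConn (A 𝔛 ι κ : Type*) [CommRing A] [Algebra ℝ A] [AddCommGroup 𝔛] [Module A 𝔛]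
    [Fintype ι] [Fintype κ] [DecidableEq ι] [DecidableEq κ] extends ConnAlg A 𝔛 where
  /-- the metric -/
  G : 𝔛 →ₗ[A] 𝔛 →ₗ[A] A
  /-- the horizontal frame -/
  X : ι → 𝔛
  /-- the vertical frame -/
  Z : κ → 𝔛
  G_symm : ∀ U V, G U V = G V U
  G_X_X : ∀ i j, G (X i) (X j) = if i = j then 1 else 0
  G_X_Z : ∀ i m, G (X i) (Z m) = 0
  expand : ∀ V, V = ∑ i, G V (X i) • X i + ∑ m, G V (Z m) • Z m
  metric : ∀ U V W, act U (G V W) = G (nab U V) W + G V (nab U W)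
  nab_Z : ∀ U m, nab U (Z m) = 0
  tor_X_X : ∀ i j k, G (nab (X i) (X j) - nab (X j) (X i) - br (X i) (X j)) (X k) = 0
  tor_X_Z : ∀ i m, nab (X i) (Z m) - nab (Z m) (X i) - br (X i) (Z m) = 0
  br_Z_Z : ∀ m m' k, G (br (Z m) (Z m')) (X k) = 0

namespace AdaptedConn

variable {A 𝔛 ι κ : Type*} [CommRing A] [Algebra ℝ A] [AddCommGroup 𝔛] [Module A 𝔛]
    [Fintype ι] [Fintype κ] [DecidableEq ι] [DecidableEq κ] (C : AdaptedConn A 𝔛 ι κ)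

theorem map_expand {N : Type*} [AddCommGroup N] [Module A N] (Φ : 𝔛 →ₗ[A] N) (V : 𝔛) :
    Φ V = ∑ i, C.G V (C.X i) • Φ (C.X i) + ∑ m, C.G V (C.Z m) • Φ (C.Z m) := by
  conv_lhs => rw [C.expand V]
  simp

theorem eq_of_frame {N : Type*} [AddCommGroup N] [Module A N] {Φ Ψ : 𝔛 →ₗ[A] N}
    (hX : ∀ i, Φ (C.X i) = Ψ (C.X i)) (hZ : ∀ m, Φ (C.Z m) = Ψ (C.Z m)) : Φ = Ψ := by
  ext V
  rw [C.map_expand Φ, C.map_expand Ψ]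
  simp [hX, hZ]

theorem tor_X_Z' (i : ι) (m : κ) : C.tor (C.X i) (C.Z m) = 0 := C.tor_X_Z i m

theorem tor_Z_X (i : ι) (m : κ) : C.tor (C.Z m) (C.X i) = 0 := by
  rw [C.tor_swap, tor_X_Z', neg_zero]

/-- Tensoriality reduces the claim to frame fields. Mixed torsions vanish, and for two vertical
fields `∇Z = 0` leaves `-[Z, Z']`, which is vertical since the symmetries form a Lie algebra. -/
theorem G_tor (U V : 𝔛) (k : ι) : C.G (C.tor U V) (C.X k) = 0 := by
  have h : ∀ U, (C.G.flip (C.X k)).comp (C.tor U) = 0 := by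
    intro U
    apply C.eq_of_frame
    · intro j
      have h' : (C.G.flip (C.X k)).comp (C.tor.flip (C.X j)) = 0 := by
        apply C.eq_of_frame
        · intro i
          exact C.tor_X_X i j k
        · intro m
          simp [C.tor_Z_X]
      exact congr($h' U)
    · intro m
      have h' : (C.G.flip (C.X k)).comp (C.tor.flip (C.Z m)) = 0 := by
        apply C.eq_of_frame
        · intro i
          simp [C.tor_X_Z']
        · intro m'
          simp [C.tor_apply, C.nab_Z, C.br_Z_Z]
      exact congr($h' U)
  exact congr($(h U) V)

/-- Obtained by differentiating `G(X_i, Z_m) = 0` with `∇Z_m = 0`. -/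
theorem G_nab_X_Z (U : 𝔛) (i : ι) (m : κ) : C.G (C.nab U (C.X i)) (C.Z m) = 0 := by
  have h := C.metric U (C.X i) (C.Z m)
  simpa [C.G_X_Z, C.nab_Z] using h.symm

theorem G_nab_X_X (U : 𝔛) (i j : ι) :
    C.G (C.nab U (C.X i)) (C.X j) = - C.G (C.nab U (C.X j)) (C.X i) := by
  have h := C.metric U (C.X i) (C.X j)
  rw [C.G_X_X, C.G_symm (C.X i)] at h
  have h0 : C.act U (if i = j then 1 else 0) = 0 := by split_ifs <;> simp
  rw [h0] at h
  exact eq_neg_of_add_eq_zero_left h.symm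

theorem nab_X (U : 𝔛) (i : ι) :
    C.nab U (C.X i) = ∑ j, C.G (C.nab U (C.X i)) (C.X j) • C.X j := by
  conv_lhs => rw [C.expand (C.nab U (C.X i))]
  simp [C.G_nab_X_Z]

theorem tor_eq (U V : 𝔛) : C.tor U V = ∑ m, C.G (C.tor U V) (C.Z m) • C.Z m := by
  conv_lhs => rw [C.expand (C.tor U V)]
  simp [C.G_tor]

theorem G_nab_tor (U V W : 𝔛) (k : ι) : C.G (C.nab U (C.tor V W)) (C.X k) = 0 := by
  have h := C.metric U (C.tor V W) (C.X k)
  have h' : C.G (C.tor V W) (C.nab U (C.X k)) = 0 := by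
    rw [C.nab_X]
    simp [C.G_tor]
  rw [C.G_tor, h', map_zero, add_zero] at h
  exact h.symm

/-- Torsion is vertical and remains vertical under `∇`, so the horizontal part of the Bianchi
identity looks as if the connection were torsion-free. -/
theorem G_bianchi (U V W : 𝔛) (k : ι) : C.G (C.curv U V W) (C.X k) + C.G (C.curv V W U) (C.X k) +
    C.G (C.curv W U V) (C.X k) = 0 := by
  have h := congr(C.G $(C.bianchi U V W) (C.X k))
  simpa [C.G_nab_tor, C.G_tor] using h

/-- The metric is parallel: let `[U, V] = U V - V U` act on `G(W, Y)` and expand each side. -/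
theorem G_curv_swap (U V W Y : 𝔛) : C.G (C.curv U V W) Y = - C.G (C.curv U V Y) W := by
  have h1 := C.act_br U V (C.G W Y)
  simp only [C.metric, map_add] at h1
  rw [C.G_symm (C.curv U V Y)]
  simp only [ConnAlg.curv, map_sub, LinearMap.sub_apply]
  linear_combination -h1

theorem curv_Z (U V : 𝔛) (m : κ) : C.curv U V (C.Z m) = 0 := by
  simp [ConnAlg.curv, C.nab_Z]

theorem G_curv_Z (U V W : 𝔛) (m : κ) : C.G (C.curv U V W) (C.Z m) = 0 := by
  rw [C.G_curv_swap, C.curv_Z]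
  simp

/-- Bianchi, with `R(·, ·)Z = 0`, makes the expression symmetric in `i, j`, and metricity makes it
skew in `j, k`. Nothing but zero has both symmetries. -/
theorem G_curv_Z_X (m : κ) (i j k : ι) : C.G (C.curv (C.Z m) (C.X i) (C.X j)) (C.X k) = 0 := by
  have hs : ∀ i j k, C.G (C.curv (C.Z m) (C.X i) (C.X j)) (C.X k) =
      C.G (C.curv (C.Z m) (C.X j) (C.X i)) (C.X k) := by
    intro i j k
    have h := C.G_bianchi (C.Z m) (C.X i) (C.X j) k
    rw [C.curv_Z, C.curv_swap (C.X j)] at h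
    simp only [map_zero, map_neg, LinearMap.zero_apply, LinearMap.neg_apply] at h
    linear_combination h
  have ha := fun i j k => C.G_curv_swap (C.Z m) (C.X i) (C.X j) (C.X k)
  -- Alternating the two symmetries six times returns to the original order of the indices with the
  -- opposite sign. Scalars are real, so 2 can be cancelled.
  have h2 : (2 : ℝ) • C.G (C.curv (C.Z m) (C.X i) (C.X j)) (C.X k) = 0 := by
    rw [two_smul]
    linear_combination hs i j k + ha j i k - hs j k i - ha k j i + hs k i j + ha i k j
  exact (smul_eq_zero_iff_right (by norm_num)).1 h2

/-! ### Differentiating the trace of the Hessian -/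

/-- The horizontal Laplacian of a function. -/
def lap (f : A) : A := ∑ i, C.hess f (C.X i) (C.X i)

/-- The trace of the Hessian may be differentiated under `∇`: the terms containing `∇_U X_i` pair a
matrix skew in `i, j` with a sum symmetric in `i, j`. -/
theorem act_lap (U : 𝔛) (f : A) : C.act U (C.lap f) = ∑ i, C.covHess f U (C.X i) (C.X i) := by
  have h : ∀ i, C.covHess f U (C.X i) (C.X i) = C.act U (C.hess f (C.X i) (C.X i)) -
      ((∑ j, C.G (C.nab U (C.X i)) (C.X j) * C.hess f (C.X j) (C.X i)) +
      ∑ j, C.G (C.nab U (C.X i)) (C.X j) * C.hess f (C.X i) (C.X j)) := by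
    intro i
    rw [ConnAlg.covHess_apply]
    conv_lhs => rw [C.nab_X U i]
    simp only [map_sum, LinearMap.sum_apply, map_smul, LinearMap.smul_apply, smul_eq_mul]
    ring
  simp only [h, Finset.sum_sub_distrib, Finset.sum_add_distrib, lap, map_sum]
  have h0 : ∑ i, ∑ j, C.G (C.nab U (C.X i)) (C.X j) * C.hess f (C.X j) (C.X i) =
      - ∑ i, ∑ j, C.G (C.nab U (C.X i)) (C.X j) * C.hess f (C.X i) (C.X j) := by
    rw [Finset.sum_comm, ← Finset.sum_neg_distrib]
    refine Finset.sum_congr rfl fun i _ => ?_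
    rw [← Finset.sum_neg_distrib]
    refine Finset.sum_congr rfl fun j _ => ?_
    rw [C.G_nab_X_X U j i]
    ring
  rw [h0]
  ring

/-- The vertical case: the curvature, torsion and `∇T` corrections in `covHess_comm` are each zero,
term by term, without any Yang–Mills condition. -/
theorem act_Z_lap (m : κ) (f : A) :
    C.act (C.Z m) (C.lap f) = ∑ i, C.covHess f (C.X i) (C.Z m) (C.X i) := by
  rw [act_lap]
  refine Finset.sum_congr rfl fun i _ => ?_
  have hc : C.curv (C.Z m) (C.X i) (C.X i) = 0 := by
    rw [C.expand (C.curv (C.Z m) (C.X i) (C.X i))]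
    simp [C.G_curv_Z, C.G_curv_Z_X]
  have ht : C.covTor (C.X i) (C.X i) (C.Z m) = 0 := by
    rw [ConnAlg.covTor, C.tor_X_Z', C.nab_Z, C.nab_X]
    simp [C.tor_X_Z']
  rw [C.covHess_comm, C.tor_Z_X, hc, ht]
  simp

/-- The asymmetry of the Hessian here is `T(T(U, V), X_i)`, and torsion of a vertical field with a
horizontal one is zero. -/
theorem hess_tor (f : A) (U V : 𝔛) (i : ι) : C.hess f (C.tor U V) (C.X i) =
    C.hess f (C.X i) (C.tor U V) := by
  have h : C.tor (C.tor U V) (C.X i) = 0 := by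
    rw [C.tor_eq U V]
    simp [C.tor_Z_X]
  rw [C.hess_swap, h]
  simp

theorem hess_X_tor (f : A) (U V : 𝔛) (i : ι) : C.hess f (C.X i) (C.tor U V) =
    ∑ m, C.G (C.tor U V) (C.Z m) * C.act (C.X i) (C.act (C.Z m) f) := by
  conv_lhs => rw [C.tor_eq U V]
  rw [map_sum]
  refine Finset.sum_congr rfl fun m _ => ?_
  rw [map_smul, C.hess_apply, C.nab_Z]
  simp

theorem G_curv_self (U V W : 𝔛) : C.G (C.curv U V W) W = 0 := by
  have h2 : (2 : ℝ) • C.G (C.curv U V W) W = 0 := by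
    rw [two_smul]
    linear_combination C.G_curv_swap U V W W
  exact (smul_eq_zero_iff_right (by norm_num)).1 h2

/-- In the horizontal Bianchi identity paired with `X_i`, the term `⟨R(X_k, X_j) X_i, X_i⟩` vanishes
by skewness. The symmetry holds for each `i`, before the trace is taken. -/
theorem G_ricci_symm (i j k : ι) : C.G (C.curv (C.X i) (C.X k) (C.X j)) (C.X i) =
    C.G (C.curv (C.X i) (C.X j) (C.X k)) (C.X i) := by
  have h := C.G_bianchi (C.X i) (C.X k) (C.X j) i
  rw [C.G_curv_self, C.curv_swap (C.X j)] at h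
  simp only [map_neg, LinearMap.neg_apply] at h
  linear_combination h

/-- This brings the curvature term to the order of arguments used in `Ricci(∇_H f, X_k)`. -/
theorem act_curv (f : A) (k i : ι) : C.act (C.curv (C.X k) (C.X i) (C.X i)) f =
    ∑ j, C.act (C.X j) f * C.G (C.curv (C.X i) (C.X j) (C.X k)) (C.X i) := by
  conv_lhs => rw [C.expand (C.curv (C.X k) (C.X i) (C.X i))]
  simp only [C.G_curv_Z, zero_smul, Finset.sum_const_zero, add_zero, C.act_sum, map_smul]
  refine Finset.sum_congr rfl fun j _ => ?_
  rw [C.G_curv_swap, C.curv_swap, ← C.G_ricci_symm i j k]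
  simp [mul_comm]

/-- The horizontal case. The four sums are `L df`, `2 𝔍 df`, `Ric_H df` and the divergence of the
torsion, which the Yang–Mills condition kills. The factor 2 comes from the equality of the two
Hessians containing `T(X_k, X_i)`. -/
theorem act_X_lap (k : ι) (f : A) : C.act (C.X k) (C.lap f) =
    ∑ i, C.covHess f (C.X i) (C.X k) (C.X i)
    + 2 * ∑ i, ∑ m, C.G (C.tor (C.X i) (C.X k)) (C.Z m) * C.act (C.X i) (C.act (C.Z m) f)
    - ∑ i, ∑ j, C.act (C.X j) f * C.G (C.curv (C.X i) (C.X j) (C.X k)) (C.X i)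
    + ∑ i, C.act (C.covTor (C.X i) (C.X i) (C.X k)) f := by
  rw [act_lap]
  simp only [C.covHess_comm f (C.X k), Finset.sum_add_distrib, Finset.sum_sub_distrib, C.act_curv,
    C.hess_tor, C.tor_swap (C.X k), map_neg, LinearMap.neg_apply, Finset.sum_neg_distrib,
    C.hess_X_tor]
  ring

/-- The left side is the divergence of the horizontal gradient. In `[U, Y] = ∇_U Y - ∇_Y U - T(U,
Y)` only `∇_U Y` contributes: the torsion has no component along the frame field in question, and
`⟨∇_Y X_i, X_i⟩ = 0`. The vertical terms vanish because `∇` keeps the gradient horizontal. -/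
theorem sum_G_br_eq_lap (f : A) :
    ∑ i, C.G (C.br (C.X i) (∑ j, C.act (C.X j) f • C.X j)) (C.X i) +
      ∑ m, C.G (C.br (C.Z m) (∑ j, C.act (C.X j) f • C.X j)) (C.Z m) = C.lap f := by
  set Y := ∑ j, C.act (C.X j) f • C.X j with hY
  have hbr : ∀ U, C.br U Y = C.nab U Y - C.nab Y U - C.tor U Y := by
    intro U
    rw [C.tor_apply]
    abel
  have hnab : ∀ U, C.nab U Y = ∑ j, (C.act (C.X j) f • C.nab U (C.X j) +
      C.act U (C.act (C.X j) f) • C.X j) := by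
    intro U
    simp [hY, C.nab_smul]
  have hZ : ∀ m, C.G (C.br (C.Z m) Y) (C.Z m) = 0 := by
    intro m
    have ht : C.tor (C.Z m) Y = 0 := by simp [hY, C.tor_Z_X]
    rw [hbr, ht, C.nab_Z, hnab]
    simp [C.G_nab_X_Z, C.G_X_Z]
  have hX : ∀ i, C.G (C.br (C.X i) Y) (C.X i) = C.hess f (C.X i) (C.X i) := by
    intro i
    have h0 : C.G (C.nab Y (C.X i)) (C.X i) = 0 := by
      have h2 : (2 : ℝ) • C.G (C.nab Y (C.X i)) (C.X i) = 0 := by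
        rw [two_smul]
        linear_combination C.G_nab_X_X Y i i
      exact (smul_eq_zero_iff_right (by norm_num)).1 h2
    have h1 : C.act (C.nab (C.X i) (C.X i)) f =
        - ∑ j, C.act (C.X j) f * C.G (C.nab (C.X i) (C.X j)) (C.X i) := by
      conv_lhs => rw [C.nab_X (C.X i) i, C.act_sum]
      rw [← Finset.sum_neg_distrib]
      refine Finset.sum_congr rfl fun j _ => ?_
      rw [C.G_nab_X_X _ i j]
      simp [mul_comm]
    rw [hbr, map_sub, map_sub, LinearMap.sub_apply, LinearMap.sub_apply, h0, C.G_tor, hnab,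
      C.hess_apply, h1]
    simp [C.G_X_X, Finset.sum_add_distrib]
    ring
  simp [hZ, hX, lap]

end AdaptedConn

open Topology VectorField TopologicalSpace

/-! ### Smooth functions and fields on open sets -/


section Analysis

variable {n : ℕ} {M : Type*} [TopologicalSpace M] [ChartedSpace (Model n) M]
  [IsManifold (𝓡 n) ∞ M]

/-- The function `f` is of class `C^∞` on the set `U`. -/
abbrev SmoothFun (n : ℕ) {M : Type*} [TopologicalSpace M] [ChartedSpace (Model n) M]
    (U : Set M) (f : M → ℝ) : Prop :=
  ContMDiffOn (𝓡 n) 𝓘(ℝ, ℝ) ∞ f U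

/-- The vector field `X` is differentiable at `x`. -/
abbrev FieldDiffAt (X : ∀ x : M, Tan n x) (x : M) : Prop :=
  MDifferentiableAt (𝓡 n) (𝓡 n).tangent
    (fun y => (TotalSpace.mk' (Model n) y (X y) : TangentBundle (𝓡 n) M)) x

instance isManifold_infty_add_one : IsManifold (𝓡 n) (((⊤ : ℕ∞) : WithTop ℕ∞) + 1) M :=
  ‹IsManifold (𝓡 n) ∞ M›

instance isManifold_minSmoothness_two : IsManifold (𝓡 n) (minSmoothness ℝ 2) M := by
  rw [minSmoothness_of_isRCLikeNormedField]
  infer_instance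

instance isManifold_minSmoothness_three : IsManifold (𝓡 n) (minSmoothness ℝ 3) M := by
  rw [minSmoothness_of_isRCLikeNormedField]
  infer_instance

theorem SmoothOn.fieldDiffAt {U : Set M} {X : ∀ x : M, Tan n x} (hX : SmoothOn U X)
    (hU : IsOpen U) {x : M} (hx : x ∈ U) : FieldDiffAt X x :=
  (hX.contMDiffAt (hU.mem_nhds hx)).mdifferentiableAt (by simp)

theorem SmoothFun.diffAt {U : Set M} {f : M → ℝ} (hf : SmoothFun n U f)
    (hU : IsOpen U) {x : M} (hx : x ∈ U) : MDifferentiableAt (𝓡 n) 𝓘(ℝ, ℝ) f x :=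
  (hf.contMDiffAt (hU.mem_nhds hx)).mdifferentiableAt (by simp)

theorem diff_congr {f g : M → ℝ} {U : Set M} (hU : IsOpen U) {x : M} (hx : x ∈ U)
    (h : Set.EqOn f g U) : diff (n := n) f x = diff g x := by
  have h' : f =ᶠ[𝓝 x] g := Filter.eventuallyEq_of_mem (hU.mem_nhds hx) h
  simp only [diff, mvfderiv, h'.mfderiv_eq]
  rw [h hx]

/-- `df(X)` is the fibre part of the tangent map of `f` composed with the section `X`. -/
theorem SmoothOn.diff {U : Set M} (hU : IsOpen U) {f : M → ℝ} {X : ∀ x : M, Tan n x}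
    (hf : SmoothFun n U f) (hX : SmoothOn U X) :
    SmoothFun n U (fun y => SubRiem.diff f y (X y)) := by
  have h1 := hf.contMDiffOn_tangentMapWithin (m := ∞) (by simp) hU.uniqueMDiffOn
  have h2 := h1.comp hX (fun y hy => hy)
  have h3 := (contMDiff_snd_tangentBundle_modelSpace ℝ 𝓘(ℝ, ℝ) (n := ∞)).comp_contMDiffOn h2
  refine h3.congr fun y hy => ?_
  simp only [Function.comp, tangentMapWithin, SubRiem.diff, mvfderiv,
    mfderivWithin_of_isOpen hU hy]
  rfl

theorem SmoothOn.bracket {U : Set M} (hU : IsOpen U) {X Y : ∀ x : M, Tan n x}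
    (hX : SmoothOn U X) (hY : SmoothOn U Y) : SmoothOn U (bracket X Y) := fun y hy =>
  (ContMDiffAt.mlieBracket_vectorField (m := ⊤) (n := ⊤) (hX.contMDiffAt (hU.mem_nhds hy))
    (hY.contMDiffAt (hU.mem_nhds hy)) (by simp)).contMDiffWithinAt

theorem bracket_congr {X X' Y Y' : ∀ x : M, Tan n x} {U : Set M} (hU : IsOpen U) {x : M}
    (hx : x ∈ U) (hX : ∀ y ∈ U, X y = X' y) (hY : ∀ y ∈ U, Y y = Y' y) :
    SubRiem.bracket X Y x = SubRiem.bracket X' Y' x :=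
  Filter.EventuallyEq.mlieBracket_vectorField_eq
    (Filter.eventuallyEq_of_mem (hU.mem_nhds hx) hX)
    (Filter.eventuallyEq_of_mem (hU.mem_nhds hx) hY)

theorem Connection.congr (cov : Connection n M) {Y Y' : ∀ x : M, Tan n x} {U : Set M}
    (hU : IsOpen U) {x : M} (hx : x ∈ U) (hY : FieldDiffAt Y x)
    (h : ∀ y ∈ U, Y y = Y' y) : cov Y x = cov Y' x := by
  refine (cov.isCovariantDerivativeOn (s := U)).congr_of_eqOn hY ?_ (hU.mem_nhds hx) h
  refine hY.congr_of_eventuallyEq ?_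
  filter_upwards [hU.mem_nhds hx] with y hy
  rw [h y hy]

/-- Every field that is smooth near a point agrees near that point with a smooth field. -/
theorem SmoothOn.exists_global [T2Space M] {U : Set M} (hU : IsOpen U) {Y : ∀ x : M, Tan n x}
    (hY : SmoothOn U Y) {x : M} (hx : x ∈ U) :
    ∃ Y' : ∀ x : M, Tan n x, SmoothOn Set.univ Y' ∧ ∀ᶠ y in 𝓝 x, Y y = Y' y := by
  obtain ⟨ψ, -, hψ⟩ := (SmoothBumpFunction.nhds_basis_tsupport (I := 𝓡 n) x).mem_iff.1
    (hU.mem_nhds hx)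
  refine ⟨(ψ : M → ℝ) • Y, ?_, ?_⟩
  · rw [SmoothOn, contMDiffOn_univ]
    exact ContMDiffOn.smul_section_of_tsupport (u := U) ψ.contMDiff.contMDiffOn hU hψ hY
  · filter_upwards [ψ.eventuallyEq_one] with y hy
    simp [hy]

/-- Smoothness of a connection is stated for global sections. A bump function makes a local field
global without changing it near the point, and a connection is local. -/
theorem Connection.smoothOn [T2Space M] (cov : Connection n M)
    (hcov : CovariantDerivative.ContMDiffCovariantDerivative cov ∞) {U : Set M} (hU : IsOpen U)
    {X Y : ∀ x : M, Tan n x} (hX : SmoothOn U X) (hY : SmoothOn U Y) :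
    SmoothOn U (fun y => cov Y y (X y)) := by
  intro x hx
  obtain ⟨Y', hY', hYY'⟩ := hY.exists_global hU hx
  have h1 := hcov.contMDiff.contMDiff (σ := Y') (by simpa [SmoothOn] using hY')
  have h2 := ContMDiffAt.clm_bundle_apply (h1.contMDiffAt Filter.univ_mem)
    (hX.contMDiffAt (hU.mem_nhds hx))
  refine (h2.congr_of_eventuallyEq ?_).contMDiffWithinAt
  obtain ⟨V, hV, hVo, hxV⟩ := eventually_nhds_iff.1 hYY'
  filter_upwards [hU.mem_nhds hx, hVo.mem_nhds hxV] with y hyU hyV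
  rw [cov.congr hVo hyV (hY.fieldDiffAt hU hyU) hV]

/-! ### Coordinates -/

theorem mpullbackWithin_eq_chartField (Y : ∀ x : M, Tan n x) (x₀ : M) {p : Model n}
    (hp : p ∈ (extChartAt (𝓡 n) x₀).target) :
    mpullbackWithin 𝓘(ℝ, Model n) (𝓡 n) (extChartAt (𝓡 n) x₀).symm Y (Set.range (𝓡 n)) p =
      chartField Y x₀ p := by
  rw [mpullbackWithin_apply, chartField]
  have h1 := mfderivWithin_extChartAt_symm_comp_mfderiv_extChartAt (I := 𝓡 n) hp
  have h2 := mfderiv_extChartAt_comp_mfderivWithin_extChartAt_symm (I := 𝓡 n) hp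
  rw [ContinuousLinearMap.inverse_eq h1 h2]
  rfl

theorem extChartAt_target_mem_nhds' (x₀ : M) {p : Model n}
    (hp : p ∈ (extChartAt (𝓡 n) x₀).target) : (extChartAt (𝓡 n) x₀).target ∈ 𝓝 p :=
  (isOpen_extChartAt_target x₀).mem_nhds hp

/-- The manifold bracket is the bracket of the coordinate fields, pulled back by the chart. -/
theorem bracket_eq_lieBracket (V W : ∀ x : M, Tan n x) (x₀ : M) :
    SubRiem.bracket V W x₀ =
      lieBracket ℝ (chartField V x₀) (chartField W x₀) (extChartAt (𝓡 n) x₀ x₀) := by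
  have ht := extChartAt_target_mem_nhds' x₀ (mem_extChartAt_target (I := 𝓡 n) x₀)
  have key : ∀ Y : ∀ x : M, Tan n x,
      (mpullbackWithin 𝓘(ℝ, Model n) (𝓡 n) (extChartAt (𝓡 n) x₀).symm Y (Set.range (𝓡 n)) :
        Model n → Model n) =ᶠ[𝓝 (extChartAt (𝓡 n) x₀ x₀)] chartField Y x₀ := by
    intro Y
    filter_upwards [ht] with p hp
    exact mpullbackWithin_eq_chartField Y x₀ hp
  -- The derivative of the preferred chart at its own centre is the identity, so the final pullback
  -- does nothing at `x₀`.
  have hid : ∀ L : Model n →L[ℝ] Model n, L = ContinuousLinearMap.id ℝ (Model n) →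
      ∀ v, L.inverse v = v := by
    rintro L rfl v
    rw [ContinuousLinearMap.inverse_id]
    rfl
  have hs : (extChartAt (𝓡 n) x₀).symm ⁻¹' Set.univ ∩ Set.range (𝓡 n) = Set.univ := by simp
  refine (hid _ mfderiv_extChartAt_self _).trans ?_
  rw [hs]
  refine (congrFun lieBracketWithin_univ _).trans ?_
  exact (key V).lieBracket_vectorField_eq (key W)

theorem FieldDiffAt.chartField {V : ∀ x : M, Tan n x} {x₀ : M} (hV : FieldDiffAt V x₀) :
    DifferentiableAt ℝ (chartField V x₀) (extChartAt (𝓡 n) x₀ x₀) := by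
  have hs : (extChartAt (𝓡 n) x₀).symm ⁻¹' Set.univ ∩ Set.range (𝓡 n) = Set.univ := by simp
  have h := (mdifferentiableWithinAt_univ.2 hV).differentiableWithinAt_mpullbackWithin_vectorField
  rw [hs] at h
  refine (differentiableWithinAt_univ.1 h).congr_of_eventuallyEq ?_
  filter_upwards [extChartAt_target_mem_nhds' x₀ (mem_extChartAt_target (I := 𝓡 n) x₀)] with p hp
  exact (mpullbackWithin_eq_chartField V x₀ hp).symm

theorem diff_eq_fderiv {f : M → ℝ} (x₀ : M) {y : M} (hy : y ∈ (extChartAt (𝓡 n) x₀).source)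
    (hf : MDifferentiableAt (𝓡 n) 𝓘(ℝ, ℝ) f y) (v : Tan n y) :
    SubRiem.diff f y v = fderiv ℝ (f ∘ (extChartAt (𝓡 n) x₀).symm) (extChartAt (𝓡 n) x₀ y)
      (mfderiv (𝓡 n) 𝓘(ℝ, Model n) (extChartAt (𝓡 n) x₀) y v) := by
  have hy' : y ∈ (chartAt (Model n) x₀).source := by simpa using hy
  have hs : MDifferentiableAt 𝓘(ℝ, Model n) (𝓡 n) (extChartAt (𝓡 n) x₀).symm
      (extChartAt (𝓡 n) x₀ y) :=
    ((contMDiffOn_extChartAt_symm (n := ∞) x₀).contMDiffAt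
      (extChartAt_target_mem_nhds' x₀ ((extChartAt (𝓡 n) x₀).map_source hy))).mdifferentiableAt
      (by simp)
  have hinv : (extChartAt (𝓡 n) x₀).symm (extChartAt (𝓡 n) x₀ y) = y :=
    (extChartAt (𝓡 n) x₀).left_inv hy
  have hg : MDifferentiableAt 𝓘(ℝ, Model n) 𝓘(ℝ, ℝ) (f ∘ (extChartAt (𝓡 n) x₀).symm)
      (extChartAt (𝓡 n) x₀ y) :=
    MDifferentiableAt.comp_of_eq _ hf hs hinv
  have h := mvfderiv_comp_apply (I := 𝓡 n) y hg (mdifferentiableAt_extChartAt hy') v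
  rw [← mfderiv_eq_fderiv]
  refine Eq.trans ?_ h
  have he : f =ᶠ[𝓝 y] (f ∘ (extChartAt (𝓡 n) x₀).symm) ∘ extChartAt (𝓡 n) x₀ := by
    filter_upwards [extChartAt_source_mem_nhds' (I := 𝓡 n) hy] with z hz
    rw [Function.comp_apply, Function.comp_apply, (extChartAt (𝓡 n) x₀).left_inv hz]
  simp only [SubRiem.diff, mvfderiv, he.mfderiv_eq]
  rfl

/-- In the chart centred at `x` the two iterated derivatives are Fréchet derivatives of the
coordinate expression of `f`. Symmetry of its second derivative leaves the bracket of the coordinate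
fields. -/
theorem diff_bracket {U : Set M} (hU : IsOpen U) {f : M → ℝ} {X Y : ∀ x : M, Tan n x}
    (hf : SmoothFun n U f) (hX : SmoothOn U X) (hY : SmoothOn U Y) {x : M} (hx : x ∈ U) :
    SubRiem.diff f x (SubRiem.bracket X Y x) =
      SubRiem.diff (fun y => SubRiem.diff f y (Y y)) x (X x) -
      SubRiem.diff (fun y => SubRiem.diff f y (X y)) x (Y x) := by
  have hxs := mem_extChartAt_source (I := 𝓡 n) x
  have hxt := mem_extChartAt_target (I := 𝓡 n) x
  have key : ∀ {Z W : ∀ x : M, Tan n x}, SmoothOn U Z →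
      SubRiem.diff (fun y => SubRiem.diff f y (Z y)) x (W x) =
      fderiv ℝ (fun p => fderiv ℝ (f ∘ (extChartAt (𝓡 n) x).symm) p (chartField Z x p))
        (extChartAt (𝓡 n) x x) (chartField W x (extChartAt (𝓡 n) x x)) := by
    intro Z W hZ
    rw [diff_eq_fderiv x hxs ((SmoothOn.diff hU hf hZ).diffAt hU hx)]
    have h1 : chartField W x (extChartAt (𝓡 n) x x) =
        mfderiv (𝓡 n) 𝓘(ℝ, Model n) (extChartAt (𝓡 n) x) x (W x) := by
      rw [chartField, extChartAt_to_inv]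
    rw [h1]
    congr 1
    apply Filter.EventuallyEq.fderiv_eq
    have hc : ContinuousAt (extChartAt (𝓡 n) x).symm (extChartAt (𝓡 n) x x) :=
      continuousAt_extChartAt_symm x
    have hUp : (extChartAt (𝓡 n) x).symm ⁻¹' U ∈ 𝓝 (extChartAt (𝓡 n) x x) :=
      hc (by rw [extChartAt_to_inv]; exact hU.mem_nhds hx)
    filter_upwards [extChartAt_target_mem_nhds' x hxt, hUp] with p hp hpU
    have hps := (extChartAt (𝓡 n) x).map_target hp
    simp only [Function.comp]
    rw [diff_eq_fderiv x hps (hf.diffAt hU hpU), (extChartAt (𝓡 n) x).right_inv hp]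
    rfl
  have hb : SubRiem.diff f x (SubRiem.bracket X Y x) =
      fderiv ℝ (f ∘ (extChartAt (𝓡 n) x).symm) (extChartAt (𝓡 n) x x)
        (lieBracket ℝ (chartField X x) (chartField Y x) (extChartAt (𝓡 n) x x)) := by
    rw [diff_eq_fderiv x hxs (hf.diffAt hU hx), mfderiv_extChartAt_self, ← bracket_eq_lieBracket]
    rfl
  rw [key hX, key hY, hb]
  refine fderiv_apply_lieBracket (n := 2) ?_ (by simp) (hY.fieldDiffAt hU hx).chartField
    (hX.fieldDiffAt hU hx).chartField
  rw [← contMDiffAt_iff_contDiffAt]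
  refine ContMDiffAt.comp_of_eq (y := x) (I' := 𝓡 n) ?_ ?_ (extChartAt_to_inv x)
  · exact (hf.contMDiffAt (hU.mem_nhds hx)).of_le (by norm_cast)
  · exact (contMDiffOn_extChartAt_symm (n := 2) x).contMDiffAt (extChartAt_target_mem_nhds' x hxt)

/-! ### Coefficients with respect to a frame -/

/-- Read in a trivialization, a frame is a smooth family of invertible maps from coefficients to
vectors. Inversion is smooth, so taking coefficients preserves both smoothness and differentiability
of fields. -/
theorem exists_coeff_clm {ι : Type*} [Fintype ι] {U : Set M} (hU : IsOpen U)
    {E : ι → ∀ x : M, Tan n x} (hE : IsLocalFrameOn (𝓡 n) (Model n) ∞ E U) {x : M} (hx : x ∈ U) :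
    ∃ L : M → Model n →L[ℝ] (ι → ℝ),
      ContMDiffAt (𝓡 n) 𝓘(ℝ, Model n →L[ℝ] (ι → ℝ)) ∞ L x ∧
      ∀ᶠ y in 𝓝 x, ∀ (v : Tan n y) (a : ι), hE.coeff a y v =
        L y ((trivializationAt (Model n) (TangentSpace (𝓡 n) : M → Type _) x) ⟨y, v⟩).2 a := by
  classical
  set e := trivializationAt (Model n) (TangentSpace (𝓡 n) : M → Type _) x with he
  let Φ : M → (ι → ℝ) →L[ℝ] Model n := fun y =>
    ∑ a, (ContinuousLinearMap.proj a : (ι → ℝ) →L[ℝ] ℝ).smulRight (e ⟨y, E a y⟩).2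
  have hΦ : ContMDiffAt (𝓡 n) 𝓘(ℝ, (ι → ℝ) →L[ℝ] Model n) ∞ Φ x := by
    refine ContMDiffAt.sum fun a _ => ?_
    have h1 : ContMDiffAt (𝓡 n) 𝓘(ℝ, Model n) ∞ (fun y => (e ⟨y, E a y⟩).2) x :=
      contMDiffAt_section x |>.1 ((hE.contMDiffOn a).contMDiffAt (hU.mem_nhds hx))
    exact ((ContinuousLinearMap.smulRightL ℝ (ι → ℝ) (Model n)
      (ContinuousLinearMap.proj a)).contMDiff.contMDiffAt).comp x h1
  have hΦe : ∀ y ∈ U ∩ e.baseSet, ∃ T : (ι → ℝ) ≃L[ℝ] Model n,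
      (T : (ι → ℝ) →L[ℝ] Model n) = Φ y ∧ ∀ (v : Tan n y) a, hE.coeff a y v =
        T.symm (e ⟨y, v⟩).2 a := by
    rintro y ⟨hyU, hye⟩
    let T := ((hE.toBasisAt hyU).equivFun.symm.trans (e.linearEquivAt ℝ y hye)).toContinuousLinearEquiv
    refine ⟨T, ?_, ?_⟩
    · ext c
      simp [T, Φ, Basis.equivFun_symm_apply]
    · intro v a
      have h1 : T.symm (e ⟨y, v⟩).2 = (hE.toBasisAt hyU).equivFun v := by
        change (hE.toBasisAt hyU).equivFun
          ((e.linearEquivAt ℝ y hye).symm (e.linearEquivAt ℝ y hye v)) = _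
        rw [LinearEquiv.symm_apply_apply]
      rw [h1]
      simp [IsLocalFrameOn.coeff, hyU]
  refine ⟨fun y => (Φ y).inverse, ?_, ?_⟩
  · obtain ⟨T, hT, -⟩ := hΦe x ⟨hx, FiberBundle.mem_baseSet_trivializationAt' x⟩
    have h := contDiffAt_map_inverse (n := ∞) T
    rw [hT] at h
    exact h.contMDiffAt.comp x hΦ
  · filter_upwards [hU.mem_nhds hx, e.open_baseSet.mem_nhds
      (FiberBundle.mem_baseSet_trivializationAt' x)] with y hyU hye v a
    obtain ⟨T, hT, h⟩ := hΦe y ⟨hyU, hye⟩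
    rw [h v a, ← hT, ContinuousLinearMap.inverse_equiv]
    rfl

theorem contMDiffAt_coeff {ι : Type*} [Fintype ι] {U : Set M} (hU : IsOpen U)
    {E : ι → ∀ x : M, Tan n x} (hE : IsLocalFrameOn (𝓡 n) (Model n) ∞ E U) {x : M} (hx : x ∈ U)
    {Y : ∀ x : M, Tan n x} (hY : ContMDiffAt (𝓡 n) (𝓡 n).tangent ∞
      (fun y => (TotalSpace.mk' (Model n) y (Y y) : TangentBundle (𝓡 n) M)) x) (a : ι) :
    ContMDiffAt (𝓡 n) 𝓘(ℝ, ℝ) ∞ (fun y => hE.coeff a y (Y y)) x := by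
  obtain ⟨L, hL, h⟩ := exists_coeff_clm hU hE hx
  have h1 := hL.clm_apply (contMDiffAt_section x |>.1 hY)
  have h2 := (ContinuousLinearMap.proj (R := ℝ) (φ := fun _ : ι => ℝ)
    a).contMDiff.contMDiffAt.comp x h1
  refine h2.congr_of_eventuallyEq ?_
  filter_upwards [h] with y hy
  exact hy (Y y) a

theorem mdifferentiableAt_coeff {ι : Type*} [Fintype ι] {U : Set M} (hU : IsOpen U)
    {E : ι → ∀ x : M, Tan n x} (hE : IsLocalFrameOn (𝓡 n) (Model n) ∞ E U) {x : M} (hx : x ∈ U)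
    {Y : ∀ x : M, Tan n x} (hY : FieldDiffAt Y x) (a : ι) :
    MDifferentiableAt (𝓡 n) 𝓘(ℝ, ℝ) (fun y => hE.coeff a y (Y y)) x := by
  obtain ⟨L, hL, h⟩ := exists_coeff_clm hU hE hx
  have h1 := (hL.mdifferentiableAt (by simp)).clm_apply ((mdifferentiableAt_section _ _).1 hY)
  have h2 := (ContinuousLinearMap.proj (R := ℝ) (φ := fun _ : ι => ℝ)
    a).mdifferentiableAt.comp x h1
  refine h2.congr_of_eventuallyEq ?_
  filter_upwards [h] with y hy
  exact hy (Y y) a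

end Analysis

/-! ### The algebra of smooth functions and the module of smooth fields on an open set -/

section Sections

variable (n : ℕ) {M : Type*} [TopologicalSpace M] [ChartedSpace (Model n) M]
  [IsManifold (𝓡 n) ∞ M]

/-- The algebra of smooth functions on an open set. -/
def funSubalgebra (U : Opens M) : Subalgebra ℝ (U → ℝ) where
  carrier := {f | ∃ g : M → ℝ, SmoothFun n U g ∧ ∀ x : U, g x = f x}
  mul_mem' := by
    rintro _ _ ⟨g, hg, h⟩ ⟨g', hg', h'⟩
    exact ⟨g * g', hg.mul hg', fun x => by simp [h, h']⟩
  add_mem' := by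
    rintro _ _ ⟨g, hg, h⟩ ⟨g', hg', h'⟩
    exact ⟨g + g', hg.add hg', fun x => by simp [h, h']⟩
  algebraMap_mem' c := ⟨fun _ => c, contMDiffOn_const, fun _ => rfl⟩

/-- The module of smooth vector fields on an open set. -/
def fieldSubmodule (U : Opens M) : Submodule (funSubalgebra n U) (∀ x : U, Tan n (x : M)) where
  carrier := {X | ∃ Y : ∀ x : M, Tan n x, SmoothOn (U : Set M) Y ∧ ∀ x : U, Y x = X x}
  add_mem' := by
    rintro _ _ ⟨g, hg, h⟩ ⟨g', hg', h'⟩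
    exact ⟨g + g', ContMDiffOn.add_section hg hg', fun x => by simp [h, h']⟩
  zero_mem' := ⟨0, contMDiffOn_zeroSection ℝ (TangentSpace (𝓡 n)), fun _ => rfl⟩
  smul_mem' := by
    rintro ⟨_, f, hf, h⟩ _ ⟨g', hg', h'⟩
    refine ⟨f • g', ContMDiffOn.smul_section hf hg', fun x => ?_⟩
    change f x • g' x = _
    rw [h, h']
    rfl

/-- The type of smooth functions on an open set. -/
def FunOn (U : Opens M) : Type _ := funSubalgebra n U

/-- The type of smooth vector fields on an open set. -/
def FieldOn (U : Opens M) : Type _ := fieldSubmodule n U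

instance (U : Opens M) : CommRing (FunOn n U) := inferInstanceAs (CommRing (funSubalgebra n U))

instance (U : Opens M) : Algebra ℝ (FunOn n U) := inferInstanceAs (Algebra ℝ (funSubalgebra n U))

instance (U : Opens M) : AddCommGroup (FieldOn n U) :=
  inferInstanceAs (AddCommGroup (fieldSubmodule n U))

instance (U : Opens M) : Module (FunOn n U) (FieldOn n U) :=
  inferInstanceAs (Module (funSubalgebra n U) (fieldSubmodule n U))

variable {n}

/-- The restriction of a function to an open set where it is smooth. -/
def FunOn.of {U : Opens M} (f : M → ℝ) (hf : SmoothFun n U f) : FunOn n U :=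
  ⟨fun x => f x, f, hf, fun _ => rfl⟩

/-- The restriction of a field to an open set where it is smooth. -/
def FieldOn.of {U : Opens M} (X : ∀ x : M, Tan n x) (hX : SmoothOn (U : Set M) X) : FieldOn n U :=
  ⟨fun x => X x, X, hX, fun _ => rfl⟩

variable {U : Opens M}

/-- A function on `M` that extends a smooth function on an open set. -/
def FunOn.ext (f : FunOn n U) : M → ℝ := f.2.choose

theorem FunOn.smooth (f : FunOn n U) : SmoothFun n U f.ext := f.2.choose_spec.1

theorem FunOn.ext_apply (f : FunOn n U) (x : U) : f.ext x = f.1 x := f.2.choose_spec.2 x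

/-- A field on `M` that extends a smooth field on an open set. -/
def FieldOn.ext (X : FieldOn n U) : ∀ x : M, Tan n x := X.2.choose

theorem FieldOn.smooth (X : FieldOn n U) : SmoothOn (U : Set M) X.ext := X.2.choose_spec.1

theorem FieldOn.ext_apply (X : FieldOn n U) (x : U) : X.ext x = X.1 x := X.2.choose_spec.2 x

theorem FunOn.ext_of {f : M → ℝ} (hf : SmoothFun n U f) : Set.EqOn (FunOn.of f hf).ext f U :=
  fun x hx => (FunOn.of f hf).ext_apply ⟨x, hx⟩

theorem FieldOn.ext_of {X : ∀ x : M, Tan n x} (hX : SmoothOn (U : Set M) X) :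
    ∀ x ∈ U, (FieldOn.of X hX).ext x = X x :=
  fun x hx => (FieldOn.of X hX).ext_apply ⟨x, hx⟩

theorem FunOn.eq_of (f : FunOn n U) : f = FunOn.of f.ext f.smooth :=
  Subtype.ext (funext fun x => (f.ext_apply x).symm)

theorem FieldOn.eq_of (X : FieldOn n U) : X = FieldOn.of X.ext X.smooth :=
  Subtype.ext (funext fun x => (X.ext_apply x).symm)

theorem FunOn.of_eq_of {f g : M → ℝ} {hf : SmoothFun n U f} {hg : SmoothFun n U g} :
    FunOn.of f hf = FunOn.of g hg ↔ ∀ x ∈ U, f x = g x :=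
  ⟨fun h x hx => congrFun (congrArg Subtype.val h) ⟨x, hx⟩,
    fun h => Subtype.ext (funext fun x => h x x.2)⟩

theorem FieldOn.of_eq_of {f g : ∀ x : M, Tan n x} {hf : SmoothOn (U : Set M) f}
    {hg : SmoothOn (U : Set M) g} : FieldOn.of f hf = FieldOn.of g hg ↔ ∀ x ∈ U, f x = g x :=
  ⟨fun h x hx => congrFun (congrArg Subtype.val h) ⟨x, hx⟩,
    fun h => Subtype.ext (funext fun x => h x x.2)⟩

-- Elements are families on `U`, so equality ignores points outside `U`, whereas brackets and
-- connections act on fields defined on all of `M`. The induction principles reduce every algebraic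
-- identity to restrictions of such functions and fields.
@[elab_as_elim]
theorem FunOn.ind {P : FunOn n U → Prop} (h : ∀ f hf, P (FunOn.of f hf)) (f : FunOn n U) : P f := by
  rw [f.eq_of]
  exact h _ _

@[elab_as_elim]
theorem FieldOn.ind {P : FieldOn n U → Prop} (h : ∀ X hX, P (FieldOn.of X hX)) (X : FieldOn n U) :
    P X := by
  rw [X.eq_of]
  exact h _ _

theorem SmoothOn.add {U : Set M} {X Y : ∀ x : M, Tan n x} (hX : SmoothOn U X)
    (hY : SmoothOn U Y) : SmoothOn U (X + Y) := ContMDiffOn.add_section hX hY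

theorem SmoothOn.smul {U : Set M} {f : M → ℝ} {Y : ∀ x : M, Tan n x} (hf : SmoothFun n U f)
    (hY : SmoothOn U Y) : SmoothOn U (f • Y) := ContMDiffOn.smul_section hf hY

theorem FieldOn.of_add {X Y : ∀ x : M, Tan n x} (hX : SmoothOn (U : Set M) X)
    (hY : SmoothOn (U : Set M) Y) :
    FieldOn.of X hX + FieldOn.of Y hY = FieldOn.of (X + Y) (hX.add hY) := rfl

theorem FieldOn.of_smul {f : M → ℝ} {Y : ∀ x : M, Tan n x} (hf : SmoothFun n (U : Set M) f)
    (hY : SmoothOn (U : Set M) Y) :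
    FunOn.of f hf • FieldOn.of Y hY = FieldOn.of (f • Y) (hY.smul hf) := rfl

/-! ### The derivative along a field -/

/-- The derivative of a function along a field. -/
def actFun (X : FieldOn n U) (f : FunOn n U) : FunOn n U :=
  FunOn.of _ (SmoothOn.diff U.isOpen f.smooth X.smooth)

/-- The derivative is local, so the chosen extension to `M` is irrelevant. The analogous statements
for the bracket and the connection rest on the same fact. -/
theorem actFun_of {X : ∀ x : M, Tan n x} (hX : SmoothOn (U : Set M) X) {f : M → ℝ}
    (hf : SmoothFun n U f) : actFun (FieldOn.of X hX) (FunOn.of f hf) =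
      FunOn.of _ (SmoothOn.diff U.isOpen hf hX) := by
  refine FunOn.of_eq_of.2 fun x hx => ?_
  rw [diff_congr U.isOpen hx (FunOn.ext_of hf), FieldOn.ext_of hX x hx]

/-- The derivation of the algebra of smooth functions given by a field. -/
def actDer (X : FieldOn n U) : Derivation ℝ (FunOn n U) (FunOn n U) :=
  Derivation.mk'
    { toFun := actFun X
      map_add' := fun f g => by
        induction X using FieldOn.ind with | _ X hX
        induction f using FunOn.ind with | _ f hf
        induction g using FunOn.ind with | _ g hg
        have : FunOn.of f hf + FunOn.of g hg = FunOn.of (f + g) (hf.add hg) := rfl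
        rw [this, actFun_of, actFun_of, actFun_of]
        refine Subtype.ext (funext fun x => ?_)
        change diff (f + g) x (X x) = diff f x (X x) + diff g x (X x)
        rw [diff, mvfderiv_add (hf.diffAt U.isOpen x.2) (hg.diffAt U.isOpen x.2)]
        rfl
      map_smul' := fun c g => by
        induction X using FieldOn.ind with | _ X hX
        induction g using FunOn.ind with | _ g hg
        have : c • FunOn.of g hg = FunOn.of ((fun _ : M => c) * g) (contMDiffOn_const.mul hg) := rfl
        rw [this, actFun_of, actFun_of]
        refine Subtype.ext (funext fun x => ?_)
        change diff ((fun _ : M => c) * g) x (X x) = c * diff g x (X x)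
        rw [diff, mvfderiv_mul mdifferentiableAt_const (hg.diffAt U.isOpen x.2), mvfderiv_const]
        simp }
    (fun f g => by
      induction X using FieldOn.ind with | _ X hX
      induction f using FunOn.ind with | _ f hf
      induction g using FunOn.ind with | _ g hg
      have : FunOn.of f hf * FunOn.of g hg = FunOn.of (f * g) (hf.mul hg) := rfl
      rw [this]
      simp only [LinearMap.coe_mk, AddHom.coe_mk, actFun_of]
      refine Subtype.ext (funext fun x => ?_)
      change diff (f * g) x (X x) = f x * diff g x (X x) + g x * diff f x (X x)
      rw [diff, mvfderiv_mul (hf.diffAt U.isOpen x.2) (hg.diffAt U.isOpen x.2)]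
      simp)

theorem actDer_of {X : ∀ x : M, Tan n x} (hX : SmoothOn (U : Set M) X) {f : M → ℝ}
    (hf : SmoothFun n U f) : actDer (FieldOn.of X hX) (FunOn.of f hf) =
      FunOn.of _ (SmoothOn.diff U.isOpen hf hX) := actFun_of hX hf

/-- The derivative of functions along fields, as a linear map. -/
def actMap : FieldOn n U →ₗ[FunOn n U] Derivation ℝ (FunOn n U) (FunOn n U) where
  toFun := actDer
  map_add' X Y := by
    induction X using FieldOn.ind with | _ X hX
    induction Y using FieldOn.ind with | _ Y hY
    refine Derivation.ext fun f => ?_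
    induction f using FunOn.ind with | _ f hf
    rw [Derivation.add_apply, FieldOn.of_add, actDer_of, actDer_of, actDer_of]
    refine Subtype.ext (funext fun x => ?_)
    change diff f x (X x + Y x) = diff f x (X x) + diff f x (Y x)
    rw [map_add]
  map_smul' g Y := by
    induction g using FunOn.ind with | _ g hg
    induction Y using FieldOn.ind with | _ Y hY
    refine Derivation.ext fun f => ?_
    induction f using FunOn.ind with | _ f hf
    rw [RingHom.id_apply, Derivation.smul_apply, FieldOn.of_smul, actDer_of, actDer_of]
    refine Subtype.ext (funext fun x => ?_)
    change diff f x (g x • Y x) = g x * diff f x (Y x)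
    rw [map_smul, smul_eq_mul]

theorem actMap_of {X : ∀ x : M, Tan n x} (hX : SmoothOn (U : Set M) X) {f : M → ℝ}
    (hf : SmoothFun n U f) : actMap (FieldOn.of X hX) (FunOn.of f hf) =
      FunOn.of _ (SmoothOn.diff U.isOpen hf hX) := actFun_of hX hf

/-! ### The bracket -/

/-- The bracket of fields on an open set. -/
def brField (X Y : FieldOn n U) : FieldOn n U :=
  FieldOn.of _ (X.smooth.bracket U.isOpen Y.smooth)

theorem brField_of {X Y : ∀ x : M, Tan n x} (hX : SmoothOn (U : Set M) X)
    (hY : SmoothOn (U : Set M) Y) : brField (FieldOn.of X hX) (FieldOn.of Y hY) =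
      FieldOn.of _ (hX.bracket U.isOpen hY) :=
  FieldOn.of_eq_of.2 fun _ hx =>
    bracket_congr U.isOpen hx (FieldOn.ext_of hX) (FieldOn.ext_of hY)

/-! ### The connection -/

variable [T2Space M] (cov : Connection n M)
  (hcov : CovariantDerivative.ContMDiffCovariantDerivative cov ∞)

/-- The covariant derivative of fields on an open set. -/
def nabField (X Y : FieldOn n U) : FieldOn n U :=
  FieldOn.of _ (cov.smoothOn hcov U.isOpen X.smooth Y.smooth)

theorem nabField_of {X Y : ∀ x : M, Tan n x} (hX : SmoothOn (U : Set M) X)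
    (hY : SmoothOn (U : Set M) Y) : nabField cov hcov (FieldOn.of X hX) (FieldOn.of Y hY) =
      FieldOn.of _ (cov.smoothOn hcov U.isOpen hX hY) :=
  FieldOn.of_eq_of.2 fun x hx => by
    rw [cov.congr U.isOpen hx ((FieldOn.smooth _).fieldDiffAt U.isOpen hx) (FieldOn.ext_of hY),
      FieldOn.ext_of hX x hx]

/-- The covariant derivative of fields, as a linear map. -/
def nabMap : FieldOn n U →ₗ[FunOn n U] (FieldOn n U →+ FieldOn n U) where
  toFun X := AddMonoidHom.mk' (nabField cov hcov X) fun Y Y' => by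
    induction X using FieldOn.ind with | _ X hX
    induction Y using FieldOn.ind with | _ Y hY
    induction Y' using FieldOn.ind with | _ Y' hY'
    rw [FieldOn.of_add, nabField_of, nabField_of, nabField_of]
    refine Subtype.ext (funext fun x => ?_)
    change cov (Y + Y') x (X x) = cov Y x (X x) + cov Y' x (X x)
    rw [cov.isCovariantDerivativeOn.add (hY.fieldDiffAt U.isOpen x.2)
      (hY'.fieldDiffAt U.isOpen x.2) (Set.mem_univ (x : M))]
    rfl
  map_add' X X' := by
    refine AddMonoidHom.ext fun Y => ?_
    induction X using FieldOn.ind with | _ X hX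
    induction X' using FieldOn.ind with | _ X' hX'
    induction Y using FieldOn.ind with | _ Y hY
    simp only [AddMonoidHom.add_apply, AddMonoidHom.mk'_apply]
    rw [FieldOn.of_add, nabField_of, nabField_of, nabField_of]
    refine Subtype.ext (funext fun x => ?_)
    change cov Y x (X x + X' x) = cov Y x (X x) + cov Y x (X' x)
    rw [map_add]
  map_smul' f X := by
    refine AddMonoidHom.ext fun Y => ?_
    induction f using FunOn.ind with | _ f hf
    induction X using FieldOn.ind with | _ X hX
    induction Y using FieldOn.ind with | _ Y hY
    simp only [AddMonoidHom.smul_apply, AddMonoidHom.mk'_apply, RingHom.id_apply]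
    rw [FieldOn.of_smul, nabField_of, nabField_of]
    refine Subtype.ext (funext fun x => ?_)
    change cov Y x (f x • X x) = f x • cov Y x (X x)
    rw [map_smul]

theorem nabMap_of {X Y : ∀ x : M, Tan n x} (hX : SmoothOn (U : Set M) X)
    (hY : SmoothOn (U : Set M) Y) : nabMap cov hcov (FieldOn.of X hX) (FieldOn.of Y hY) =
      FieldOn.of _ (cov.smoothOn hcov U.isOpen hX hY) := nabField_of cov hcov hX hY

/-- The algebra of smooth functions and fields on an open set, with a connection. -/
def connAlg (U : Opens M) : ConnAlg (FunOn n U) (FieldOn n U) where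
  act := actMap
  br := brField
  nab := nabMap cov hcov
  nab_smul X f Y := by
    induction f using FunOn.ind with | _ f hf
    induction X using FieldOn.ind with | _ X hX
    induction Y using FieldOn.ind with | _ Y hY
    rw [FieldOn.of_smul, nabMap_of, nabMap_of, actMap_of, FieldOn.of_smul, FieldOn.of_smul,
      FieldOn.of_add]
    refine FieldOn.of_eq_of.2 fun x hx => ?_
    rw [cov.isCovariantDerivativeOn.leibniz (hY.fieldDiffAt U.isOpen hx)
      (hf.diffAt U.isOpen hx) (Set.mem_univ (x : M))]
    simp
  act_br X Y f := by
    induction f using FunOn.ind with | _ f hf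
    induction X using FieldOn.ind with | _ X hX
    induction Y using FieldOn.ind with | _ Y hY
    rw [brField_of, actMap_of, actMap_of, actMap_of, actMap_of, actMap_of]
    refine Subtype.ext (funext fun x => ?_)
    exact diff_bracket U.isOpen hf hX hY x.2
  br_add X Y Y' := by
    induction X using FieldOn.ind with | _ X hX
    induction Y using FieldOn.ind with | _ Y hY
    induction Y' using FieldOn.ind with | _ Y' hY'
    rw [FieldOn.of_add, brField_of, brField_of, brField_of]
    refine Subtype.ext (funext fun x => ?_)
    exact mlieBracket_add_right (hY.fieldDiffAt U.isOpen x.2) (hY'.fieldDiffAt U.isOpen x.2)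
  br_smul X f Y := by
    induction f using FunOn.ind with | _ f hf
    induction X using FieldOn.ind with | _ X hX
    induction Y using FieldOn.ind with | _ Y hY
    rw [FieldOn.of_smul, brField_of, brField_of, actMap_of]
    refine Subtype.ext (funext fun x => ?_)
    exact mlieBracket_smul_right (hf.diffAt U.isOpen x.2) (hY.fieldDiffAt U.isOpen x.2)
  br_swap X Y := by
    induction X using FieldOn.ind with | _ X hX
    induction Y using FieldOn.ind with | _ Y hY
    rw [brField_of, brField_of]
    refine Subtype.ext (funext fun x => ?_)
    exact mlieBracket_swap_apply
  jacobi X Y Z := by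
    induction X using FieldOn.ind with | _ X hX
    induction Y using FieldOn.ind with | _ Y hY
    induction Z using FieldOn.ind with | _ Z hZ
    simp only [brField_of]
    refine Subtype.ext (funext fun x => ?_)
    have h2 : minSmoothness ℝ 2 ≤ (∞ : WithTop ℕ∞) := by
      rw [minSmoothness_of_isRCLikeNormedField]
      norm_cast
    exact leibniz_identity_mlieBracket_apply
      ((hX.contMDiffAt (U.isOpen.mem_nhds x.2)).of_le h2)
      ((hY.contMDiffAt (U.isOpen.mem_nhds x.2)).of_le h2)
      ((hZ.contMDiffAt (U.isOpen.mem_nhds x.2)).of_le h2)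

end Sections

/-! ### The divergence in an orthonormal frame -/

/-- Jacobi's formula for the derivative of a determinant. -/
theorem hasFDerivAt_det {F : Type*} [NormedAddCommGroup F] [NormedSpace ℝ F] {n : ℕ}
    {A : F → Matrix (Fin n) (Fin n) ℝ} {A' : Fin n → Fin n → F →L[ℝ] ℝ} {p : F}
    (hA : ∀ i j, HasFDerivAt (fun q => A q i j) (A' i j) p) {B : Matrix (Fin n) (Fin n) ℝ}
    (hB : B * A p = 1) :
    HasFDerivAt (fun q => (A q).det) ((A p).det • ∑ i, ∑ k, B i k • A' k i) p := by
  have h1 : HasFDerivAt (fun q => ∑ σ : Equiv.Perm (Fin n),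
      ((Equiv.Perm.sign σ : ℤ) : ℝ) * ∏ i, A q (σ i) i)
      (∑ σ : Equiv.Perm (Fin n), ((Equiv.Perm.sign σ : ℤ) : ℝ) •
        ∑ i, (∏ j ∈ Finset.univ.erase i, A p (σ j) j) • A' (σ i) i) p := by
    refine HasFDerivAt.fun_sum fun σ _ => ?_
    exact (HasFDerivAt.finsetProd fun i _ => hA (σ i) i).const_mul _
  have h2 : (fun q => (A q).det) = fun q => ∑ σ : Equiv.Perm (Fin n),
      ((Equiv.Perm.sign σ : ℤ) : ℝ) * ∏ i, A q (σ i) i := by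
    funext q
    rw [Matrix.det_apply']
  have hadj : (A p).adjugate = (A p).det • B := by
    have hB' : A p * B = 1 := mul_eq_one_comm.1 hB
    calc (A p).adjugate = (A p).adjugate * (A p * B) := by rw [hB', mul_one]
      _ = (A p).det • B := by rw [← mul_assoc, Matrix.adjugate_mul, smul_mul_assoc, one_mul]
  rw [h2]
  refine h1.congr_fderiv ?_
  ext v
  -- For fixed `i` the sum over permutations is the determinant with column `i` replaced by its
  -- derivative; Cramer's rule expresses it through the adjugate, hence through the inverse `B`.
  have h3 : ∀ i, ∑ σ : Equiv.Perm (Fin n), ((Equiv.Perm.sign σ : ℤ) : ℝ) *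
      ((∏ j ∈ Finset.univ.erase i, A p (σ j) j) * A' (σ i) i v) =
      (A p).det * ∑ k, B i k * A' k i v := by
    intro i
    have h4 : ((A p).updateCol i fun k => A' k i v).det = (A p).det * ∑ k, B i k * A' k i v := by
      rw [← Matrix.cramer_apply, Matrix.cramer_eq_adjugate_mulVec, hadj]
      simp [Matrix.mulVec, dotProduct, Finset.mul_sum, mul_assoc]
    rw [← h4, Matrix.det_apply']
    refine Finset.sum_congr rfl fun σ _ => ?_
    rw [← Finset.mul_prod_erase Finset.univ _ (Finset.mem_univ i), Matrix.updateCol_self, mul_comm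
      (∏ j ∈ _, _)]
    congr 2
    refine Finset.prod_congr rfl fun j hj => ?_
    rw [Matrix.updateCol_ne (Finset.ne_of_mem_erase hj)]
  simp only [_root_.sum_apply, _root_.smul_apply, smul_eq_mul,
    Finset.mul_sum] at h3 ⊢
  rw [Finset.sum_comm]
  exact Finset.sum_congr rfl fun i _ => h3 i

section

variable {n : ℕ} {M : Type*} [TopologicalSpace M] [ChartedSpace (Model n) M]
  [IsManifold (𝓡 n) ∞ M]

/-- The absolute value is needed because the frame carries no orientation. -/
theorem hasDerivAt_abs_inv {t : ℝ} (h : t ≠ 0) :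
    HasDerivAt (fun s : ℝ => |s|⁻¹) (-(|t|⁻¹ * t⁻¹)) t := by
  refine ((hasDerivAt_abs h).inv (abs_ne_zero.2 h)).congr_deriv ?_
  rcases lt_or_gt_of_ne h with h | h
  · simp only [abs_of_neg h, sign_neg h]
    have := h.ne
    simp
    field_simp
  · simp only [abs_of_pos h, sign_pos h]
    have := h.ne'
    simp
    field_simp

/-- If `e` is the matrix of the frame in coordinates, the coordinate fields have matrix `B = e⁻¹` in
the frame. Since the frame is orthonormal, the Gram matrix of the coordinate fields is `Bᵀ B`. -/
theorem chartDensity_eq {U : Set M} {E : Fin n → ∀ x : M, Tan n x}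
    (hE : IsLocalFrameOn (𝓡 n) (Model n) ∞ E U) {g : ∀ x : M, LinearMap.BilinForm ℝ (Tan n x)}
    (hg : ∀ x ∈ U, ∀ a b, g x (E a x) (E b x) = if a = b then 1 else 0) (x₀ : M) {p : Model n}
    (hp : p ∈ (extChartAt (𝓡 n) x₀).target) (hpU : (extChartAt (𝓡 n) x₀).symm p ∈ U) :
    (Matrix.of fun k a => chartField (E a) x₀ p k).det ≠ 0 ∧
    chartDensity g x₀ p = |(Matrix.of fun k a => chartField (E a) x₀ p k).det|⁻¹ := by
  set y := (extChartAt (𝓡 n) x₀).symm p with hy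
  set e : Matrix (Fin n) (Fin n) ℝ := Matrix.of fun k a => chartField (E a) x₀ p k with he
  let D : Fin n → Tan n y := fun k =>
    mfderiv (𝓡 n) (𝓡 n) (extChartAt (𝓡 n) x₀).symm p (EuclideanSpace.single k (1 : ℝ))
  let B : Matrix (Fin n) (Fin n) ℝ := Matrix.of fun a k => (hE.toBasisAt hpU).repr (D k) a
  have hD : ∀ k, D k = ∑ a, B a k • E a y := by
    intro k
    conv_lhs => rw [← (hE.toBasisAt hpU).sum_repr (D k)]
    simp [B]
  have hsingle : ∀ k, (mfderiv (𝓡 n) (𝓡 n) (extChartAt (𝓡 n) x₀) y (D k) : Model n) =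
      EuclideanSpace.single k (1 : ℝ) := by
    intro k
    have h := mfderiv_extChartAt_comp_mfderivWithin_extChartAt_symm (I := 𝓡 n) hp
    rw [ModelWithCorners.range_eq_univ, mfderivWithin_univ] at h
    exact congrArg (fun L : Model n →L[ℝ] Model n => L (EuclideanSpace.single k (1 : ℝ))) h
  have heB : e * B = 1 := by
    ext l k
    have h1 := hsingle k
    rw [hD k, map_sum] at h1
    have h2 := congrArg (fun v : Model n => v l) h1
    rw [Matrix.mul_apply, Matrix.one_apply]
    have h3 : (EuclideanSpace.single k (1 : ℝ) : Model n) l = if l = k then 1 else 0 := by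
      simp
    rw [← h3, ← h2]
    have h4 : ∀ a, (mfderiv (𝓡 n) (𝓡 n) (extChartAt (𝓡 n) x₀) y (B a k • E a y) : Model n) =
        B a k • chartField (E a) x₀ p := fun a => map_smul _ _ _
    refine Eq.trans ?_ (congrArg (fun v : Model n => v l)
      (Finset.sum_congr rfl fun a _ => h4 a)).symm
    simp [he, mul_comm]
  have hdet : e.det * B.det = 1 := by rw [← Matrix.det_mul, heB, Matrix.det_one]
  refine ⟨left_ne_zero_of_mul_eq_one hdet, ?_⟩
  have hgram : (Matrix.of fun k l : Fin n => g y (D k) (D l)) = B.transpose * B := by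
    ext k l
    rw [Matrix.of_apply, hD k, hD l, Matrix.mul_apply]
    simp [hg y hpU, mul_comm]
  change Real.sqrt (Matrix.det (Matrix.of fun k l : Fin n => g y (D k) (D l))) = _
  rw [hgram, Matrix.det_mul, Matrix.det_transpose, Real.sqrt_mul_self_eq_abs]
  refine eq_inv_of_mul_eq_one_left ?_
  rw [← abs_mul, mul_comm, hdet, abs_one]

/-- With `ρ = |det e|⁻¹`, Jacobi's formula gives `dρ(Y) / ρ = -tr(e⁻¹ de(Y))`, which is the
contribution of the terms `-dE_a(Y)` of the brackets `[E_a, Y]`. The terms `dY(E_a)` add up to the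
trace of `dY`. -/
theorem divergence_eq {U : Set M} (hU : IsOpen U) {E : Fin n → ∀ x : M, Tan n x}
    (hE : IsLocalFrameOn (𝓡 n) (Model n) ∞ E U) {g : ∀ x : M, LinearMap.BilinForm ℝ (Tan n x)}
    (hg : ∀ x ∈ U, ∀ a b, g x (E a x) (E b x) = if a = b then 1 else 0)
    {Y : ∀ x : M, Tan n x} {x : M} (hx : x ∈ U) (hY : FieldDiffAt Y x) :
    divergence g Y x = ∑ a, hE.coeff a x (bracket (E a) Y x) := by
  set p := extChartAt (𝓡 n) x x with hp
  have hxt : p ∈ (extChartAt (𝓡 n) x).target := mem_extChartAt_target (I := 𝓡 n) x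
  have hxp : (extChartAt (𝓡 n) x).symm p = x := extChartAt_to_inv x
  have hUp : (extChartAt (𝓡 n) x).symm ⁻¹' U ∈ 𝓝 p :=
    (continuousAt_extChartAt_symm x) (by rw [extChartAt_to_inv]; exact hU.mem_nhds hx)
  let A : Model n → Matrix (Fin n) (Fin n) ℝ := fun q =>
    Matrix.of fun k a => chartField (E a) x q k
  let A' : Fin n → Fin n → Model n →L[ℝ] ℝ := fun k a =>
    (EuclideanSpace.proj k).comp (fderiv ℝ (chartField (E a) x) p)
  have hEd : ∀ a, DifferentiableAt ℝ (chartField (E a) x) p := fun a =>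
    FieldDiffAt.chartField (SmoothOn.fieldDiffAt (hE.contMDiffOn a) hU hx)
  have hA : ∀ k a, HasFDerivAt (fun q => A q k a) (A' k a) p := fun k a =>
    (EuclideanSpace.proj (𝕜 := ℝ) k).hasFDerivAt.comp p (hEd a).hasFDerivAt
  let b : Basis (Fin n) ℝ (Model n) := hE.toBasisAt hx
  have hcf : ∀ Z : ∀ x : M, Tan n x, chartField Z x p = Z x := by
    intro Z
    rw [chartField, hxp, mfderiv_extChartAt_self]
    rfl
  have hb : ∀ a, b a = chartField (E a) x p := fun a => by
    rw [hcf]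
    exact hE.toBasisAt_coe hx a
  let B : Matrix (Fin n) (Fin n) ℝ := Matrix.of fun a k =>
    b.coord a (EuclideanSpace.single k (1 : ℝ))
  have hsum : ∀ a (v : Model n), ∑ k, B a k * v k = b.coord a v := by
    intro a v
    conv_rhs => rw [← (EuclideanSpace.basisFun (Fin n) ℝ).sum_repr v]
    simp [B, mul_comm]
  have hB : B * A p = 1 := by
    ext a c
    rw [Matrix.mul_apply, Matrix.one_apply]
    change ∑ k, B a k * (chartField (E c) x p) k = _
    rw [hsum, ← hb]
    simp [Finsupp.single_apply, eq_comm]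
  have hdet := hasFDerivAt_det hA hB
  obtain ⟨h0, -⟩ := chartDensity_eq hE hg x hxt (by rw [hxp]; exact hx)
  have hrho : (fun q => chartDensity g x q • chartField Y x q) =ᶠ[𝓝 p]
      fun q => |(A q).det|⁻¹ • chartField Y x q := by
    filter_upwards [extChartAt_target_mem_nhds' x hxt, hUp] with q hq hqU
    rw [(chartDensity_eq hE hg x hq hqU).2]
  have hinv : HasFDerivAt (fun q => |(A q).det|⁻¹)
      (-(|(A p).det|⁻¹) • ∑ i, ∑ k, B i k • A' k i) p := by
    have h1 := hasDerivAt_abs_inv h0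
    have h3 := h1.comp_hasFDerivAt p hdet
    refine h3.congr_fderiv ?_
    rw [smul_smul, neg_mul, mul_assoc, inv_mul_cancel₀ h0, mul_one]
  have hYd := hY.chartField.hasFDerivAt
  have hprod := hinv.smul hYd
  rw [divergence, ← hp, hrho.fderiv_eq, (chartDensity_eq hE hg x hxt (by rw [hxp]; exact hx)).2]
  change (|(A p).det|⁻¹)⁻¹ * _ = _
  have hfd : fderiv ℝ (fun q => |(A q).det|⁻¹ • chartField Y x q) p = _ := hprod.fderiv
  rw [hfd]
  set ρ := |(A p).det|⁻¹ with hρ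
  have hρ0 : ρ ≠ 0 := inv_ne_zero (abs_ne_zero.2 h0)
  have htr : ∀ T : Model n →L[ℝ] Model n, LinearMap.trace ℝ (Model n) T.toLinearMap =
      ∑ a, b.coord a (T (b a)) := fun T => by
    rw [LinearMap.trace_eq_matrix_trace ℝ b, Matrix.trace]
    simp [LinearMap.toMatrix_apply]
  have hbr : ∀ a, hE.coeff a x (bracket (E a) Y x) =
      b.coord a (fderiv ℝ (chartField Y x) p (b a)) -
        b.coord a (fderiv ℝ (chartField (E a) x) p (chartField Y x p)) := fun a => by
    rw [← map_sub, hb, bracket_eq_lieBracket]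
    simp only [IsLocalFrameOn.coeff, hx, dite_true]
    rfl
  simp only [hbr]
  rw [htr, Finset.sum_sub_distrib, inv_mul_eq_iff_eq_mul₀ hρ0]
  have hval : ∀ a, b.coord a ((ρ • fderiv ℝ (chartField Y x) p +
      (-ρ • ∑ i, ∑ k, B i k • A' k i).smulRight (chartField Y x p)) (b a)) =
      ρ * b.coord a (fderiv ℝ (chartField Y x) p (b a)) +
        (-ρ • ∑ i, ∑ k, B i k • A' k i) (b.coord a (chartField Y x p) • b a) := fun a => by
    simp only [_root_.add_apply, _root_.smul_apply, map_add, map_smul,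
      ContinuousLinearMap.smulRight_apply, smul_eq_mul]
    ring
  refine (Finset.sum_congr rfl fun a _ => hval a).trans ?_
  rw [Finset.sum_add_distrib, ← map_sum, mul_sub, Finset.mul_sum, sub_eq_add_neg]
  congr 1
  -- The rank-one term `dρ ⊗ Y` of the product rule has trace `dρ(Y)`.
  have hY0 : ∑ a, b.coord a (chartField Y x p) • b a = chartField Y x p := b.sum_repr _
  rw [hY0]
  simp only [_root_.smul_apply, _root_.sum_apply, smul_eq_mul, neg_mul]
  congr 2
  refine Finset.sum_congr rfl fun a _ => ?_
  rw [← hsum]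
  rfl

end

/-! ### Horizontal orthonormal frames -/

namespace SubRiemannian

variable {n d : ℕ} {M : Type*} [TopologicalSpace M] [ChartedSpace (Model n) M]
  [IsManifold (𝓡 n) ∞ M] (S : SubRiemannian n d M)

/-- The Gram–Schmidt process for horizontal fields. -/
theorem exists_partial_frame (x₀ : M) (e : Basis (Fin d) ℝ (S.hor x₀))
    (he : IsOrthonormal (S.metric x₀) e) (k : ℕ) (hk : k ≤ d) :
    ∃ U : Set M, IsOpen U ∧ x₀ ∈ U ∧ ∃ X : Fin d → ∀ x : M, S.hor x,
      (∀ i, SmoothOn U (fun x => (X i x : Tan n x))) ∧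
      (∀ x ∈ U, ∀ i j : Fin d, (i : ℕ) < k → (j : ℕ) < k →
        S.metric x (X i x) (X j x) = if i = j then 1 else 0) ∧ ∀ i, X i x₀ = e i := by
  induction k with
  | zero =>
    obtain ⟨U, hU, hx, W, hW, hb⟩ := S.exists_frame x₀
    -- A change of frame with constant coefficients arranges the prescribed values at `x₀`.
    let b := Basis.mk (hb x₀ hx).1 (hb x₀ hx).2
    refine ⟨U, hU, hx, fun i x => ∑ j, b.repr (e i) j • W j x, fun i => ?_,
      fun x _ i j hi => absurd hi (Nat.not_lt_zero _), fun i => ?_⟩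
    · have h1 : SmoothOn U (fun x => ∑ j, b.repr (e i) j • (W j x : Tan n x)) :=
        ContMDiffOn.sum_section fun j _ => ContMDiffOn.const_smul_section (hW j)
      refine h1.congr fun x _ => ?_
      simp
    · conv_rhs => rw [← b.sum_repr (e i)]
      simp [b]
  | succ k ih =>
    obtain ⟨U, hU, hx, Y, hY, hY1, hY2⟩ := ih (Nat.le_of_succ_le hk)
    let k' : Fin d := ⟨k, hk⟩
    -- Only the fields already orthonormalized are subtracted. As `e` is orthonormal, these
    -- coefficients vanish at `x₀` and the norm there is 1, so the value at `x₀` is not changed by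
    -- the step.
    let c : Fin d → M → ℝ := fun i x => if (i : ℕ) < k then S.metric x (Y k' x) (Y i x) else 0
    let V : ∀ x : M, S.hor x := fun x => Y k' x - ∑ i, c i x • Y i x
    have hc : ∀ i, SmoothFun n U (c i) := fun i => by
      by_cases hi : (i : ℕ) < k
      · simpa only [c, hi, if_true] using S.metric_smooth U (Y k') (Y i) hU (hY k') (hY i)
      · simp only [c, hi, if_false]
        exact contMDiffOn_const
    have hV : SmoothOn U (fun x => (V x : Tan n x)) := by
      have h1 : SmoothOn U (fun x => (Y k' x : Tan n x) - ∑ i, c i x • (Y i x : Tan n x)) :=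
        ContMDiffOn.sub_section (hY k')
          (ContMDiffOn.sum_section fun j _ => ContMDiffOn.smul_section (hc j) (hY j))
      refine h1.congr fun x _ => ?_
      simp [V]
    have hVY : ∀ x ∈ U, ∀ j : Fin d, (j : ℕ) < k → S.metric x (V x) (Y j x) = 0 := by
      intro x hx j hj
      have h1 : ∀ i, S.metric x (c i x • Y i x) (Y j x) = if i = j then c i x else 0 := fun i => by
        by_cases hi : (i : ℕ) < k
        · simp [hY1 x hx i j hi hj]
        · have : i ≠ j := by
            rintro rfl
            exact hi hj
          simp [c, hi, this]
      simp only [V, map_sub, map_sum, LinearMap.sub_apply, LinearMap.sum_apply, h1]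
      simp [c, hj]
    have hV0 : V x₀ = e k' := by
      have h1 : ∀ i, c i x₀ = 0 := fun i => by
        by_cases hi : (i : ℕ) < k
        · have : k' ≠ i := by
            rintro rfl
            exact lt_irrefl _ hi
          simp [c, hY2, he k' i, this]
        · simp [c, hi]
      simp [V, h1, hY2]
    let N : M → ℝ := fun x => S.metric x (V x) (V x)
    have hN : SmoothFun n U N := S.metric_smooth U V V hU hV hV
    have hN0 : N x₀ = 1 := by simp [N, hV0, he k' k']
    -- The domain shrinks to where the projected field is nonzero and can be normalized smoothly.
    have hU' : IsOpen (U ∩ N ⁻¹' Set.Ioi 0) := hN.continuousOn.isOpen_inter_preimage hU isOpen_Ioi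
    have hs : SmoothFun n (U ∩ N ⁻¹' Set.Ioi 0) (fun x => (Real.sqrt (N x))⁻¹) := by
      intro x hx
      have h1 : ContDiffAt ℝ ∞ (fun t : ℝ => (Real.sqrt t)⁻¹) (N x) :=
        (Real.contDiffAt_sqrt hx.2.ne').inv (Real.sqrt_pos.2 hx.2).ne'
      exact (h1.contMDiffAt.comp x (hN.contMDiffAt (hU.mem_nhds hx.1))).contMDiffWithinAt
    refine ⟨U ∩ N ⁻¹' Set.Ioi 0, hU', ⟨hx, by simp [hN0]⟩,
      Function.update Y k' (fun x => (Real.sqrt (N x))⁻¹ • V x), fun i => ?_, ?_, fun i => ?_⟩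
    · by_cases hi : i = k'
      · subst hi
        simp only [Function.update_self]
        exact ContMDiffOn.smul_section hs (hV.mono Set.inter_subset_left)
      · simp only [Function.update_of_ne hi]
        exact (hY i).mono Set.inter_subset_left
    · intro x hx i j hi hj
      have hlt : ∀ {i : Fin d}, (i : ℕ) < k + 1 → i ≠ k' → (i : ℕ) < k := by
        intro i hi hne
        refine lt_of_le_of_ne (Nat.lt_succ_iff.1 hi) fun h => hne (Fin.ext h)
      have h2 := (Real.sqrt_pos.2 hx.2).ne'
      have h3 : Real.sqrt (N x) * Real.sqrt (N x) = S.metric x (V x) (V x) :=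
        Real.mul_self_sqrt hx.2.le
      by_cases hi' : i = k' <;> by_cases hj' : j = k'
      · subst hi'
        simp only [hj', Function.update_self, map_smul, LinearMap.smul_apply, smul_eq_mul, if_true,
          ← h3]
        field_simp
      · subst hi'
        simp only [Function.update_self, Function.update_of_ne hj', map_smul,
          LinearMap.smul_apply, smul_eq_mul, hVY x hx.1 j (hlt hj hj')]
        simp [Ne.symm hj']
      · subst hj'
        simp only [Function.update_self, Function.update_of_ne hi', map_smul,
          (S.metric_inner x).symm (Y i x) (V x), hVY x hx.1 i (hlt hi hi')]
        simp [hi']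
      · simp only [Function.update_of_ne hi', Function.update_of_ne hj']
        exact hY1 x hx.1 i j (hlt hi hi') (hlt hj hj')
    · by_cases hi : i = k'
      · subst hi
        simp [hN0, hV0]
      · simp [Function.update_of_ne hi, hY2]

end SubRiemannian

/-! ### Adapted frames of the tangent bundle -/

namespace TransverseSymmetric

variable {d h : ℕ} {M : Type*} [TopologicalSpace M] [ChartedSpace (Model (d + h)) M]
  [IsManifold (𝓡 (d + h)) ∞ M] (S : TransverseSymmetric d h M)

theorem split_apply (x : M) (u : S.hor x) (Z : S.sym) :
    S.split x (u, Z) = (u : Tan (d + h) x) + (Z : ∀ y, Tan (d + h) y) x := rfl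

theorem split_symm_coe (x : M) (u : S.hor x) : (S.split x).symm (u : Tan (d + h) x) = (u, 0) := by
  rw [LinearEquiv.symm_apply_eq, split_apply]
  simp

theorem split_symm_sym (x : M) (Z : S.sym) :
    (S.split x).symm ((Z : ∀ y, Tan (d + h) y) x) = (0, Z) := by
  rw [LinearEquiv.symm_apply_eq, split_apply]
  simp

@[simp]
theorem horPart_coe (x : M) (u : S.hor x) : S.horPart x (u : Tan (d + h) x) = u :=
  congrArg Prod.fst (S.split_symm_coe x u)

@[simp]
theorem symPart_coe (x : M) (u : S.hor x) : S.symPart x (u : Tan (d + h) x) = 0 :=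
  congrArg Prod.snd (S.split_symm_coe x u)

@[simp]
theorem horPart_sym (x : M) (Z : S.sym) : S.horPart x ((Z : ∀ y, Tan (d + h) y) x) = 0 :=
  congrArg Prod.fst (S.split_symm_sym x Z)

@[simp]
theorem symPart_sym (x : M) (Z : S.sym) : S.symPart x ((Z : ∀ y, Tan (d + h) y) x) = Z :=
  congrArg Prod.snd (S.split_symm_sym x Z)

theorem gEps_apply (ε : ℝ) (x : M) (v w : Tan (d + h) x) :
    S.gEps ε x v w = S.metric x (S.horPart x v) (S.horPart x w) +
      ε⁻¹ * S.symMetric (S.symPart x v) (S.symPart x w) := rfl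

theorem gEps_symm (ε : ℝ) (x : M) (v w : Tan (d + h) x) : S.gEps ε x v w = S.gEps ε x w v := by
  rw [gEps_apply, gEps_apply, (S.metric_inner x).symm, S.symMetric_inner.symm]

theorem horBasis_orthonormal (x : M) : IsOrthonormal (S.metric x) (S.horBasis x) :=
  ((S.metric_inner x).exists_orthonormal (S.finrank_hor x)).choose_spec

theorem symBasis_orthonormal : IsOrthonormal S.symMetric S.symBasis :=
  (S.symMetric_inner.exists_orthonormal S.finrank_sym).choose_spec

/-- A basis of the Lie algebra of transverse symmetries, as vector fields. -/
def symField (m : Fin h) : ∀ x : M, Tan (d + h) x := (S.symBasis m : ∀ x : M, Tan (d + h) x)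

theorem smoothOn_symField (U : Set M) (m : Fin h) : SmoothOn U (S.symField m) :=
  (S.sym_killing _ (S.symBasis m).2).smooth.mono (Set.subset_univ _)

/-- An orthonormal frame of horizontal fields on an open set. -/
structure Frame (U : Opens M) where
  /-- the fields -/
  X : Fin d → ∀ x : M, S.hor x
  smooth : ∀ i, SmoothOn (U : Set M) (fun x => (X i x : Tan (d + h) x))
  orthonormal : ∀ x ∈ U, ∀ i j, S.metric x (X i x) (X j x) = if i = j then 1 else 0

/-- The prescribed values matter because the operators on forms are defined with a basis chosen
separately at each point, with no smoothness in the point. -/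
theorem exists_frame_eq (x₀ : M) (e : Basis (Fin d) ℝ (S.hor x₀))
    (he : IsOrthonormal (S.metric x₀) e) : ∃ U : Opens M, x₀ ∈ U ∧ ∃ F : S.Frame U,
      ∀ i, F.X i x₀ = e i := by
  obtain ⟨U, hU, hx, X, h1, h2, h3⟩ := S.exists_partial_frame x₀ e he d le_rfl
  exact ⟨⟨U, hU⟩, hx, ⟨X, h1, fun x hx i j => h2 x hx i j i.2 j.2⟩, h3⟩

namespace Frame

variable {S} {U : Opens M} (F : S.Frame U)

/-- Restriction of a frame to a smaller set. -/
def restrict {V : Opens M} (hVU : V ≤ U) : S.Frame V where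
  X := F.X
  smooth i := (F.smooth i).mono hVU
  orthonormal x hx := F.orthonormal x (hVU hx)

/-- The adapted frame of the tangent bundle. -/
def field : Fin d ⊕ Fin h → ∀ x : M, Tan (d + h) x :=
  Sum.elim (fun i x => (F.X i x : Tan (d + h) x)) S.symField

theorem smooth_field (a : Fin d ⊕ Fin h) : SmoothOn (U : Set M) (F.field a) :=
  match a with
  | .inl i => F.smooth i
  | .inr m => S.smoothOn_symField _ m

theorem linearIndependent {x : M} (hx : x ∈ U) : LinearIndependent ℝ (fun i => F.X i x) := by
  rw [Fintype.linearIndependent_iff]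
  intro c hc i
  have h1 := congrArg (fun v => S.metric x v (F.X i x)) hc
  simpa [F.orthonormal x hx] using h1

/-- The basis of the horizontal space given by a frame. -/
def horBasisAt {x : M} (hx : x ∈ U) : Basis (Fin d) ℝ (S.hor x) :=
  basisOfLinearIndependentOfCardEqFinrank' _ (F.linearIndependent hx)
    (by rw [S.finrank_hor, Fintype.card_fin])

@[simp]
theorem horBasisAt_apply {x : M} (hx : x ∈ U) (i : Fin d) : F.horBasisAt hx i = F.X i x := by
  simp [horBasisAt]

/-- The basis of the tangent space given by a frame. -/
def basis {x : M} (hx : x ∈ U) : Basis (Fin d ⊕ Fin h) ℝ (Tan (d + h) x) :=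
  ((F.horBasisAt hx).prod S.symBasis).map (S.split x)

theorem basis_apply {x : M} (hx : x ∈ U) (a : Fin d ⊕ Fin h) : F.basis hx a = F.field a x := by
  rcases a with i | m
  · simp [basis, field, split_apply]
  · simp [basis, field, split_apply, symField]

theorem isLocalFrameOn : IsLocalFrameOn (𝓡 (d + h)) (Model (d + h)) ∞ F.field (U : Set M) where
  linearIndependent {x} hx := by
    have h1 := (F.basis hx).linearIndependent
    rwa [show (F.basis hx : _ → Tan (d + h) x) = fun a => F.field a x from
      funext (F.basis_apply hx)] at h1
  generating {x} hx := by
    have h1 := (F.basis hx).span_eq.ge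
    rwa [show (F.basis hx : _ → Tan (d + h) x) = fun a => F.field a x from
      funext (F.basis_apply hx)] at h1
  contMDiffOn := F.smooth_field

theorem gEps_field (ε : ℝ) {x : M} (hx : x ∈ U) (a b : Fin d ⊕ Fin h) :
    S.gEps ε x (F.field a x) (F.field b x) =
      if a = b then Sum.elim (fun _ => 1) (fun _ => ε⁻¹) a else 0 := by
  rw [gEps_apply]
  rcases a with i | m <;> rcases b with j | k
  · simp [field, F.orthonormal x hx]
  · simp [field, symField]
  · simp [field, symField]
  · simp [field, symField, S.symBasis_orthonormal m k]

theorem gEps_one_field {x : M} (hx : x ∈ U) (a b : Fin d ⊕ Fin h) :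
    S.gEps 1 x (F.field a x) (F.field b x) = if a = b then 1 else 0 := by
  rw [F.gEps_field 1 hx]
  rcases a with i | m <;> simp

theorem coeff_field {x : M} (hx : x ∈ U) (a b : Fin d ⊕ Fin h) :
    F.isLocalFrameOn.coeff a x (F.field b x) = if a = b then 1 else 0 := by
  rw [F.isLocalFrameOn.coeff_apply_of_mem hx, ← F.isLocalFrameOn.toBasisAt_coe hx, Basis.repr_self,
    Finsupp.single_apply]
  simp [eq_comm]

theorem eq_sum {x : M} (hx : x ∈ U) (v : Tan (d + h) x) :
    v = ∑ a, F.isLocalFrameOn.coeff a x v • F.field a x := by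
  have h1 := ((F.isLocalFrameOn.toBasisAt hx).sum_repr v).symm
  simpa [IsLocalFrameOn.coeff, hx] using h1

theorem coeff_eq {x : M} (hx : x ∈ U) (v : Tan (d + h) x) (a : Fin d ⊕ Fin h) :
    F.isLocalFrameOn.coeff a x v = S.gEps 1 x v (F.field a x) := by
  conv_rhs => rw [F.eq_sum hx v]
  rw [map_sum, LinearMap.sum_apply]
  simp only [map_smul, LinearMap.smul_apply, F.gEps_one_field hx]
  simp

/-- One frame diagonalizes every `g_ε`; only the constant weights 1 and `ε⁻¹` differ. -/
theorem gEps_eq_sum (ε : ℝ) {x : M} (hx : x ∈ U) (v w : Tan (d + h) x) :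
    S.gEps ε x v w = ∑ a, Sum.elim (fun _ => 1) (fun _ => ε⁻¹) a *
      (F.isLocalFrameOn.coeff a x v * F.isLocalFrameOn.coeff a x w) := by
  conv_lhs => rw [F.eq_sum hx v, F.eq_sum hx w]
  simp only [map_sum, LinearMap.sum_apply, map_smul, LinearMap.smul_apply, F.gEps_field ε hx,
    smul_eq_mul]
  refine Finset.sum_congr rfl fun a _ => ?_
  rw [Finset.sum_eq_single a (fun b _ hb => by simp [hb]) (by simp)]
  rw [if_pos rfl]
  ring

theorem smoothFun_coeff {Y : ∀ x : M, Tan (d + h) x} (hY : SmoothOn (U : Set M) Y)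
    (a : Fin d ⊕ Fin h) :
    SmoothFun (d + h) (U : Set M) (fun x => F.isLocalFrameOn.coeff a x (Y x)) := fun _ hx =>
  (contMDiffAt_coeff U.isOpen F.isLocalFrameOn hx
    (hY.contMDiffAt (U.isOpen.mem_nhds hx)) a).contMDiffWithinAt

theorem smoothFun_gEps (F : S.Frame U) (ε : ℝ) {Y W : ∀ x : M, Tan (d + h) x} (hY : SmoothOn (U : Set M) Y)
    (hW : SmoothOn (U : Set M) W) :
    SmoothFun (d + h) (U : Set M) (fun x => S.gEps ε x (Y x) (W x)) := by
  have h1 : SmoothFun (d + h) (U : Set M) (fun x => ∑ a,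
      Sum.elim (fun _ => 1) (fun _ => ε⁻¹) a *
      (F.isLocalFrameOn.coeff a x (Y x) * F.isLocalFrameOn.coeff a x (W x))) :=
    contMDiffOn_finsetSum fun a _ => contMDiffOn_const.mul
      ((F.smoothFun_coeff hY a).mul (F.smoothFun_coeff hW a))
  exact h1.congr fun x hx => F.gEps_eq_sum ε hx _ _

theorem coeff_inl {x : M} (hx : x ∈ U) (v : Tan (d + h) x) (i : Fin d) :
    F.isLocalFrameOn.coeff (.inl i) x v = S.metric x (S.horPart x v) (F.X i x) := by
  rw [F.coeff_eq hx, gEps_apply]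
  simp [field]

theorem coeff_inr {x : M} (hx : x ∈ U) (v : Tan (d + h) x) (m : Fin h) :
    F.isLocalFrameOn.coeff (.inr m) x v = S.symMetric (S.symPart x v) (S.symBasis m) := by
  rw [F.coeff_eq hx, gEps_apply]
  simp [field, symField]

theorem mem_hor_iff {x : M} (hx : x ∈ U) (v : Tan (d + h) x) :
    v ∈ S.hor x ↔ ∀ m, F.isLocalFrameOn.coeff (.inr m) x v = 0 := by
  constructor
  · intro hv m
    rw [F.coeff_inr hx, S.symPart_coe x ⟨v, hv⟩]
    simp
  · intro hv
    rw [F.eq_sum hx v, Fintype.sum_sum_type]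
    simp only [hv, zero_smul, Finset.sum_const_zero, add_zero]
    exact Submodule.sum_mem _ fun i _ => Submodule.smul_mem _ _ (F.X i x).2

theorem coeff_inl_of_mem_ver {x : M} (hx : x ∈ U) {v : Tan (d + h) x} (hv : v ∈ S.ver x)
    (i : Fin d) : F.isLocalFrameOn.coeff (.inl i) x v = 0 := by
  obtain ⟨Z, hZ, rfl⟩ := hv
  rw [F.coeff_inl hx]
  have h1 := S.horPart_sym x ⟨Z, hZ⟩
  rw [show S.horPart x (LinearMap.proj x Z) = 0 from h1]
  simp

end Frame

end TransverseSymmetric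

/-! ### Evaluation at a point -/

section Eval

variable {n : ℕ} {M : Type*} [TopologicalSpace M] [ChartedSpace (Model n) M]
  [IsManifold (𝓡 n) ∞ M] {U : Opens M}

/-- The value of a function at a point. -/
def FunOn.eval (x : U) : FunOn n U →+* ℝ where
  toFun f := f.1 x
  map_one' := rfl
  map_mul' _ _ := rfl
  map_zero' := rfl
  map_add' _ _ := rfl

/-- The value of a field at a point. -/
def FieldOn.eval (x : U) : FieldOn n U →+ Tan n (x : M) where
  toFun X := X.1 x
  map_zero' := rfl
  map_add' _ _ := rfl

@[simp]
theorem FunOn.eval_of (x : U) (f : M → ℝ) (hf : SmoothFun n (U : Set M) f) :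
    FunOn.eval x (FunOn.of f hf) = f x := rfl

@[simp]
theorem FieldOn.eval_of (x : U) (X : ∀ x : M, Tan n x) (hX : SmoothOn (U : Set M) X) :
    FieldOn.eval x (FieldOn.of X hX) = X x := rfl

@[simp]
theorem FieldOn.eval_smul (x : U) (f : FunOn n U) (X : FieldOn n U) :
    FieldOn.eval x (f • X) = FunOn.eval x f • FieldOn.eval x X := rfl

theorem FunOn.eq_of_eval {f g : FunOn n U} (h : ∀ x, FunOn.eval x f = FunOn.eval x g) : f = g :=
  Subtype.ext (funext h)

theorem FieldOn.eq_of_eval {X Y : FieldOn n U} (h : ∀ x, FieldOn.eval x X = FieldOn.eval x Y) :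
    X = Y :=
  Subtype.ext (funext h)

theorem FunOn.eval_ext (x : U) (f : FunOn n U) : f.ext x = FunOn.eval x f := f.ext_apply x

theorem FieldOn.eval_ext (x : U) (X : FieldOn n U) : X.ext x = FieldOn.eval x X := X.ext_apply x

variable [T2Space M] (cov : Connection n M)
  (hcov : CovariantDerivative.ContMDiffCovariantDerivative cov ∞)

theorem eval_act (x : U) {X : ∀ x : M, Tan n x} (hX : SmoothOn (U : Set M) X) {f : M → ℝ}
    (hf : SmoothFun n (U : Set M) f) :
    FunOn.eval x ((connAlg cov hcov U).act (FieldOn.of X hX) (FunOn.of f hf)) =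
      diff f (x : M) (X x) := by
  change FunOn.eval x (actMap _ _) = _
  rw [actMap_of, FunOn.eval_of]

theorem eval_br (x : U) {X Y : ∀ x : M, Tan n x} (hX : SmoothOn (U : Set M) X)
    (hY : SmoothOn (U : Set M) Y) :
    FieldOn.eval x ((connAlg cov hcov U).br (FieldOn.of X hX) (FieldOn.of Y hY)) =
      bracket X Y x := by
  change FieldOn.eval x (brField _ _) = _
  rw [brField_of, FieldOn.eval_of]

theorem eval_nab (x : U) {X Y : ∀ x : M, Tan n x} (hX : SmoothOn (U : Set M) X)
    (hY : SmoothOn (U : Set M) Y) :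
    FieldOn.eval x ((connAlg cov hcov U).nab (FieldOn.of X hX) (FieldOn.of Y hY)) =
      cov Y (x : M) (X x) := by
  change FieldOn.eval x (nabMap cov hcov _ _) = _
  rw [nabMap_of, FieldOn.eval_of]

/-- Identifies the algebraic torsion with the torsion tensor, so that the pointwise axioms of the
canonical connection feed the adapted structure. -/
theorem eval_tor (x : U) {X Y : ∀ x : M, Tan n x} (hX : SmoothOn (U : Set M) X)
    (hY : SmoothOn (U : Set M) Y) :
    FieldOn.eval x ((connAlg cov hcov U).tor (FieldOn.of X hX) (FieldOn.of Y hY)) =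
      Connection.tor cov (x : M) (X x) (Y x) := by
  rw [ConnAlg.tor_apply, map_sub, map_sub, eval_nab, eval_nab, eval_br]
  exact (CovariantDerivative.torsion_apply cov (hX.fieldDiffAt U.isOpen x.2)
    (hY.fieldDiffAt U.isOpen x.2)).symm

end Eval

/-! ### The adapted connection in a frame -/

namespace TransverseSymmetric

variable {d h : ℕ} {M : Type*} [TopologicalSpace M] [ChartedSpace (Model (d + h)) M]
  [IsManifold (𝓡 (d + h)) ∞ M] {S : TransverseSymmetric d h M} {U : Opens M}

namespace Frame

/-- The metric `g_1` as a bilinear map on fields. -/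
def metricMap (F : S.Frame U) : FieldOn (d + h) U →ₗ[FunOn (d + h) U]
    FieldOn (d + h) U →ₗ[FunOn (d + h) U] FunOn (d + h) U :=
  LinearMap.mk₂ _ (fun X Y => FunOn.of _ (F.smoothFun_gEps 1 X.smooth Y.smooth))
    (fun X X' Y => FunOn.eq_of_eval fun x => by
      simp only [map_add, FunOn.eval_of, FieldOn.eval_ext, LinearMap.add_apply])
    (fun f X Y => FunOn.eq_of_eval fun x => by
      simp only [map_smul, FunOn.eval_of, FieldOn.eval_ext, LinearMap.smul_apply, smul_eq_mul,
        map_mul, FieldOn.eval_smul])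
    (fun X Y Y' => FunOn.eq_of_eval fun x => by
      simp only [map_add, FunOn.eval_of, FieldOn.eval_ext])
    (fun f X Y => FunOn.eq_of_eval fun x => by
      simp only [map_smul, FunOn.eval_of, FieldOn.eval_ext, smul_eq_mul,
        map_mul, FieldOn.eval_smul])

theorem eval_metricMap (F : S.Frame U) (x : U) (X Y : FieldOn (d + h) U) :
    FunOn.eval x (F.metricMap X Y) =
      S.gEps 1 (x : M) (FieldOn.eval x X) (FieldOn.eval x Y) := by
  change S.gEps 1 (x : M) (X.ext x) (Y.ext x) = _
  rw [FieldOn.eval_ext, FieldOn.eval_ext]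

/-- The adapted frame as fields on the open set. -/
def fieldOn (F : S.Frame U) (a : Fin d ⊕ Fin h) : FieldOn (d + h) U :=
  FieldOn.of (F.field a) (F.smooth_field a)

theorem eval_fieldOn (F : S.Frame U) (a : Fin d ⊕ Fin h) (x : U) :
    FieldOn.eval x (F.fieldOn a) = F.field a x := rfl

/-- The canonical connection on an open set with an adapted frame. -/
def adaptedConn [T2Space M] (F : S.Frame U) {cov : Connection (d + h) M} (hc : S.IsCanonical cov) :
    AdaptedConn (FunOn (d + h) U) (FieldOn (d + h) U) (Fin d) (Fin h) where
  toConnAlg := connAlg cov hc.smooth U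
  G := F.metricMap
  X i := F.fieldOn (.inl i)
  Z m := F.fieldOn (.inr m)
  G_symm X Y := FunOn.eq_of_eval fun x => by
    rw [eval_metricMap, eval_metricMap, gEps_symm]
  G_X_X i j := FunOn.eq_of_eval fun x => by
    rw [eval_metricMap, eval_fieldOn, eval_fieldOn, F.gEps_one_field x.2]
    by_cases hij : i = j <;> simp [hij]
  G_X_Z i m := FunOn.eq_of_eval fun x => by
    rw [eval_metricMap, eval_fieldOn, eval_fieldOn, F.gEps_one_field x.2]
    simp
  expand V := FieldOn.eq_of_eval fun x => by
    rw [map_add, map_sum, map_sum]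
    simp only [FieldOn.eval_smul, eval_metricMap, eval_fieldOn, ← F.coeff_eq x.2]
    conv_lhs => rw [F.eq_sum x.2 (FieldOn.eval x V), Fintype.sum_sum_type]
  metric X Y W := FunOn.eq_of_eval fun x => by
    induction X using FieldOn.ind with | _ X hX
    induction Y using FieldOn.ind with | _ Y hY
    induction W using FieldOn.ind with | _ W hW
    have h1 : F.metricMap (FieldOn.of Y hY) (FieldOn.of W hW) =
        FunOn.of _ (F.smoothFun_gEps 1 hY hW) := FunOn.eq_of_eval fun x => by
      rw [eval_metricMap]
      rfl
    rw [h1, eval_act, map_add, eval_metricMap, eval_metricMap, eval_nab, eval_nab]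
    exact hc.metric 1 one_pos U Y W U.isOpen hY hW x x.2 (X x)
  nab_Z X m := FieldOn.eq_of_eval fun x => by
    induction X using FieldOn.ind with | _ X hX
    rw [fieldOn, eval_nab]
    have h1 := hc.vertical _ (S.symBasis m).2 (x : M)
    exact congrArg (fun L : Tan (d + h) (x : M) →L[ℝ] Tan (d + h) (x : M) => L (X x)) h1
  tor_X_X i j k := FunOn.eq_of_eval fun x => by
    rw [← ConnAlg.tor_apply, fieldOn, fieldOn, eval_metricMap, eval_tor, eval_fieldOn,
      ← F.coeff_eq x.2]
    exact F.coeff_inl_of_mem_ver x.2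
      (hc.torsion_vertical x _ (F.X i x).2 _ (F.X j x).2) k
  tor_X_Z i m := FieldOn.eq_of_eval fun x => by
    rw [← ConnAlg.tor_apply, fieldOn, fieldOn, eval_tor]
    exact hc.torsion_zero x _ (F.X i x).2 _ (S.symBasis m).2
  br_Z_Z m m' k := FunOn.eq_of_eval fun x => by
    rw [fieldOn, fieldOn, eval_metricMap, eval_br, eval_fieldOn, ← F.coeff_eq x.2]
    refine F.coeff_inl_of_mem_ver x.2 ?_ k
    exact ⟨_, S.sym_bracket _ (S.symBasis m).2 _ (S.symBasis m').2, rfl⟩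

end Frame

end TransverseSymmetric

/-! ### Connections defined by their coefficients in a frame -/

section FrameCov

variable {n : ℕ} {M : Type*} [TopologicalSpace M] [ChartedSpace (Model n) M]
  [IsManifold (𝓡 n) ∞ M]

/-- A section of the bundle of endomorphisms is smooth if its values on smooth fields are. -/
theorem contMDiffOn_hom_of_apply {U : Set M} (hU : IsOpen U) {L : ∀ x : M, Tan n x →L[ℝ] Tan n x}
    (hL : ∀ (V : Set M) (X : ∀ x : M, Tan n x), IsOpen V → V ⊆ U → SmoothOn V X →
      SmoothOn V (fun x => L x (X x))) :
    ContMDiffOn (𝓡 n) ((𝓡 n).prod 𝓘(ℝ, Model n →L[ℝ] Model n)) ∞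
      (fun x => (⟨x, L x⟩ : TotalSpace (Model n →L[ℝ] Model n)
        fun x : M => Tan n x →L[ℝ] Tan n x)) U := by
  intro x₀ hx₀
  refine ContMDiffAt.contMDiffWithinAt ?_
  rw [contMDiffAt_hom_bundle]
  refine ⟨contMDiffAt_id, ?_⟩
  set e := trivializationAt (Model n) (TangentSpace (𝓡 n) : M → Type _) x₀ with he
  have hxe : x₀ ∈ e.baseSet := FiberBundle.mem_baseSet_trivializationAt' x₀
  have hsm : ∀ v : Model n, SmoothOn e.baseSet (fun y : M => (e.symmL ℝ y v : Tan n y)) := by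
    intro v y hy
    refine ContMDiffAt.contMDiffWithinAt ?_
    have h1 := e.contMDiffAt_symmL (IB := 𝓡 n) (n := ∞) hy
    exact ContMDiffAt.clm_bundle_apply (F₁ := Model n) (E₁ := fun _ : M => Model n)
      (E₂ := (TangentSpace (𝓡 n) : M → Type _)) (b := fun m : M => m)
      (v := fun _ => v) h1
      ((Bundle.contMDiffAt_section _).2 contMDiffAt_const)
  -- The test fields are those constant in the trivialization at `x₀`; they give the columns of the
  -- local matrix of `L`.
  have hLv : ∀ v : Model n, ContMDiffAt (𝓡 n) 𝓘(ℝ, Model n) ∞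
      (fun y => ContinuousLinearMap.inCoordinates (Model n) (TangentSpace (𝓡 n) : M → Type _)
        (Model n) (TangentSpace (𝓡 n) : M → Type _) x₀ y x₀ y (L y) v) x₀ := by
    intro v
    have h1 := hL (U ∩ e.baseSet) _ (hU.inter e.open_baseSet) Set.inter_subset_left
      ((hsm v).mono Set.inter_subset_right)
    have h2 := (contMDiffAt_section x₀).1 (h1.contMDiffAt
      ((hU.inter e.open_baseSet).mem_nhds ⟨hx₀, hxe⟩))
    refine h2.congr_of_eventuallyEq ?_
    filter_upwards [e.open_baseSet.mem_nhds hxe] with y hy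
    simp only [ContinuousLinearMap.inCoordinates, ContinuousLinearMap.comp_apply]
    exact congrFun (Trivialization.coe_linearMapAt_of_mem e (R := ℝ) hy) _
  have hdec : ∀ T : Model n →L[ℝ] Model n, T = ∑ k,
      (EuclideanSpace.proj k : Model n →L[ℝ] ℝ).smulRight (T (EuclideanSpace.single k 1)) := by
    intro T
    ext1 v
    conv_lhs => rw [← (EuclideanSpace.basisFun (Fin n) ℝ).sum_repr v]
    simp
  have h3 : ContMDiffAt (𝓡 n) 𝓘(ℝ, Model n →L[ℝ] Model n) ∞ (fun y => ∑ k,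
      (EuclideanSpace.proj k : Model n →L[ℝ] ℝ).smulRight
        (ContinuousLinearMap.inCoordinates (Model n) (TangentSpace (𝓡 n) : M → Type _)
        (Model n) (TangentSpace (𝓡 n) : M → Type _) x₀ y x₀ y (L y)
          (EuclideanSpace.single k 1))) x₀ := by
    refine ContMDiffAt.sum fun k _ => ?_
    exact ((ContinuousLinearMap.smulRightL ℝ (Model n) (Model n)
      (EuclideanSpace.proj k)).contMDiff.contMDiffAt).comp x₀ (hLv _)
  refine h3.congr_of_eventuallyEq (Filter.Eventually.of_forall fun y => ?_)
  exact hdec _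

variable {ι : Type*} [Fintype ι] {U : Set M} {E : ι → ∀ x : M, Tan n x}
  (hE : IsLocalFrameOn (𝓡 n) (Model n) ∞ E U)

theorem coeff_self [DecidableEq ι] {x : M} (hx : x ∈ U) (a b : ι) :
    hE.coeff a x (E b x) = if a = b then 1 else 0 := by
  rw [hE.coeff_apply_of_mem hx, ← hE.toBasisAt_coe hx, Basis.repr_self, Finsupp.single_apply]
  simp [eq_comm]

theorem eq_of_coeff {x : M} (hx : x ∈ U) {v w : Tan n x}
    (h : ∀ a, hE.coeff a x v = hE.coeff a x w) : v = w := by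
  refine (hE.toBasisAt hx).ext_elem fun a => ?_
  simpa [IsLocalFrameOn.coeff, hx] using h a

/-- The derivative of the `a`-th frame field for the connection with coefficients `Γ`. -/
def frameForm (Γ : ι → ι → ι → M → ℝ) (a : ι) (x : M) : Tan n x →ₗ[ℝ] Tan n x :=
  ∑ b, (hE.coeff b x).smulRight (∑ c, Γ b a c x • E c x)

/-- The connection with coefficients `Γ` in a frame. -/
def frameCov (Γ : ι → ι → ι → M → ℝ) (Y : ∀ x : M, Tan n x) (x : M) : Tan n x →L[ℝ] Tan n x :=
  ∑ a, ((diff (fun z => hE.coeff a z (Y z)) x).smulRight (E a x) +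
    hE.coeff a x (Y x) • LinearMap.toContinuousLinearMap (frameForm hE Γ a x))

theorem frameCov_apply (Γ : ι → ι → ι → M → ℝ) (Y : ∀ x : M, Tan n x) (x : M) (u : Tan n x) :
    frameCov hE Γ Y x u = ∑ a, (diff (fun z => hE.coeff a z (Y z)) x u • E a x +
      hE.coeff a x (Y x) • ∑ b, hE.coeff b x u • ∑ c, Γ b a c x • E c x) := by
  rw [frameCov, _root_.sum_apply]
  refine Finset.sum_congr rfl fun a _ => ?_
  rw [_root_.add_apply, ContinuousLinearMap.smulRight_apply, _root_.smul_apply]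
  congr 2
  simp [frameForm]

/-- In components, `(∇_u Y)^c = u(Y^c) + ∑ Y^a u^b Γ b a c`: the first index of `Γ` is the
direction, the second the field differentiated. -/
theorem coeff_frameCov (Γ : ι → ι → ι → M → ℝ) (Y : ∀ x : M, Tan n x) {x : M} (hx : x ∈ U)
    (u : Tan n x) (c : ι) : hE.coeff c x (frameCov hE Γ Y x u) =
      diff (fun z => hE.coeff c z (Y z)) x u +
        ∑ a, ∑ b, hE.coeff a x (Y x) * (hE.coeff b x u * Γ b a c x) := by
  classical
  rw [frameCov_apply]
  simp only [map_sum, map_add, map_smul, coeff_self hE hx, Finset.sum_add_distrib, smul_eq_mul,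
    mul_ite, mul_one, mul_zero, Finset.sum_ite_eq, Finset.mem_univ, if_true, Finset.mul_sum]

theorem frameCov_add (hU : IsOpen U) (Γ : ι → ι → ι → M → ℝ) {Y Y' : ∀ x : M, Tan n x} {x : M}
    (hx : x ∈ U) (hY : FieldDiffAt Y x) (hY' : FieldDiffAt Y' x) :
    frameCov hE Γ (Y + Y') x = frameCov hE Γ Y x + frameCov hE Γ Y' x := by
  ext1 u
  refine eq_of_coeff hE hx fun c => ?_
  have h1 : diff (fun z => hE.coeff c z ((Y + Y') z)) x u =
      diff (fun z => hE.coeff c z (Y z)) x u + diff (fun z => hE.coeff c z (Y' z)) x u := by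
    simp only [Pi.add_apply, map_add]
    rw [diff, mvfderiv_fun_add (mdifferentiableAt_coeff hU hE hx hY c)
      (mdifferentiableAt_coeff hU hE hx hY' c)]
    rfl
  rw [_root_.add_apply, map_add, coeff_frameCov hE Γ _ hx, coeff_frameCov hE Γ _ hx,
    coeff_frameCov hE Γ _ hx, h1]
  simp only [Pi.add_apply, map_add, add_mul, Finset.sum_add_distrib]
  ring

theorem frameCov_smul (hU : IsOpen U) (Γ : ι → ι → ι → M → ℝ) {Y : ∀ x : M, Tan n x} {g : M → ℝ}
    {x : M} (hx : x ∈ U) (hY : FieldDiffAt Y x) (hg : MDifferentiableAt (𝓡 n) 𝓘(ℝ, ℝ) g x) :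
    frameCov hE Γ (g • Y) x = g x • frameCov hE Γ Y x + (diff g x).smulRight (Y x) := by
  ext1 u
  refine eq_of_coeff hE hx fun c => ?_
  have h1 : diff (fun z => hE.coeff c z ((g • Y) z)) x u =
      g x * diff (fun z => hE.coeff c z (Y z)) x u + hE.coeff c x (Y x) * diff g x u := by
    simp only [Pi.smul_apply', map_smul, smul_eq_mul]
    rw [diff, mvfderiv_fun_mul hg (mdifferentiableAt_coeff hU hE hx hY c)]
    rfl
  rw [_root_.add_apply, map_add, coeff_frameCov hE Γ _ hx, _root_.smul_apply, map_smul,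
    coeff_frameCov hE Γ _ hx, h1, ContinuousLinearMap.smulRight_apply, map_smul]
  simp only [Pi.smul_apply', map_smul, smul_eq_mul, mul_add, Finset.mul_sum, mul_assoc]
  ring

theorem frameCov_smoothOn (hU : IsOpen U) {Γ : ι → ι → ι → M → ℝ}
    (hΓ : ∀ b a c, SmoothFun n U (Γ b a c)) {V : Set M} (hV : IsOpen V) (hVU : V ⊆ U)
    {X Y : ∀ x : M, Tan n x} (hX : SmoothOn V X) (hY : SmoothOn V Y) :
    SmoothOn V (fun x => frameCov hE Γ Y x (X x)) := by
  have hc : ∀ {W : ∀ x : M, Tan n x}, SmoothOn V W → ∀ a,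
      SmoothFun n V (fun x => hE.coeff a x (W x)) := fun hW a x hx =>
    (contMDiffAt_coeff hU hE (hVU hx) (hW.contMDiffAt (hV.mem_nhds hx)) a).contMDiffWithinAt
  have h1 : SmoothOn V (fun x => ∑ a, (diff (fun z => hE.coeff a z (Y z)) x (X x) • E a x +
      hE.coeff a x (Y x) • ∑ b, hE.coeff b x (X x) • ∑ c, Γ b a c x • E c x)) := by
    have hEV : ∀ a, SmoothOn V (E a) := fun a => (hE.contMDiffOn a).mono hVU
    refine ContMDiffOn.sum_section fun a _ => ContMDiffOn.add_section
      (ContMDiffOn.smul_section (SmoothOn.diff hV (hc hY a) hX) (hEV a))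
      (ContMDiffOn.smul_section (hc hY a) (ContMDiffOn.sum_section fun b _ =>
        ContMDiffOn.smul_section (hc hX b) (ContMDiffOn.sum_section fun c _ =>
          ContMDiffOn.smul_section ((hΓ b a c).mono hVU) (hEV c))))
  exact h1.congr fun x _ => congrArg (TotalSpace.mk' (Model n) x) (frameCov_apply hE Γ Y x (X x))

end FrameCov

/-! ### The canonical connection -/

section

variable {n : ℕ} {M : Type*} [TopologicalSpace M] [ChartedSpace (Model n) M]
  [IsManifold (𝓡 n) ∞ M]

theorem diff_sum_mul {ι : Type*} (s : Finset ι) (w : ι → ℝ) {f g : ι → M → ℝ} {x : M}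
    (hf : ∀ a, MDifferentiableAt (𝓡 n) 𝓘(ℝ, ℝ) (f a) x)
    (hg : ∀ a, MDifferentiableAt (𝓡 n) 𝓘(ℝ, ℝ) (g a) x) (u : Tan n x) :
    MDifferentiableAt (𝓡 n) 𝓘(ℝ, ℝ) (fun y => ∑ a ∈ s, w a * (f a y * g a y)) x ∧
    diff (fun y => ∑ a ∈ s, w a * (f a y * g a y)) x u =
      ∑ a ∈ s, w a * (diff (f a) x u * g a x + f a x * diff (g a) x u) := by
  classical
  induction s using Finset.induction_on with
  | empty =>
    simp only [Finset.sum_empty]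
    refine ⟨mdifferentiableAt_const, ?_⟩
    rw [diff, mvfderiv_const]
    rfl
  | insert a s ha ih =>
    simp only [Finset.sum_insert ha]
    have h1 : MDifferentiableAt (𝓡 n) 𝓘(ℝ, ℝ) (fun y => f a y * g a y) x := (hf a).mul (hg a)
    have h2 : MDifferentiableAt (𝓡 n) 𝓘(ℝ, ℝ) (fun y => w a * (f a y * g a y)) x :=
      mdifferentiableAt_const.mul h1
    refine ⟨h2.add ih.1, ?_⟩
    rw [diff, mvfderiv_fun_add h2 ih.1, _root_.add_apply]
    congr 1
    · rw [mvfderiv_fun_mul mdifferentiableAt_const h1, mvfderiv_fun_mul (hf a) (hg a),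
        mvfderiv_const]
      simp
      ring
    · exact ih.2

theorem Connection.sum_smul {ι : Type*} (cov : Connection n M) (s : Finset ι) {f : ι → M → ℝ}
    {E : ι → ∀ x : M, Tan n x} {x : M} (hf : ∀ a, MDifferentiableAt (𝓡 n) 𝓘(ℝ, ℝ) (f a) x)
    (hE : ∀ a, FieldDiffAt (E a) x) (u : Tan n x) :
    FieldDiffAt (∑ a ∈ s, f a • E a) x ∧ cov (∑ a ∈ s, f a • E a) x u =
      ∑ a ∈ s, (f a x • cov (E a) x u + diff (f a) x u • E a x) := by
  classical
  induction s using Finset.induction_on with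
  | empty =>
    simp only [Finset.sum_empty]
    refine ⟨mdifferentiableAt_zeroSection .., ?_⟩
    rw [CovariantDerivative.zero]
    rfl
  | insert a s ha ih =>
    simp only [Finset.sum_insert ha]
    have h1 : FieldDiffAt (f a • E a) x := MDifferentiableAt.smul_section (hf a) (hE a)
    refine ⟨mdifferentiableAt_add_section h1 ih.1, ?_⟩
    rw [cov.isCovariantDerivativeOn.add h1 ih.1 (Set.mem_univ x), _root_.add_apply, ih.2,
      cov.isCovariantDerivativeOn.leibniz (hE a) (hf a) (Set.mem_univ x)]
    rfl

end

namespace TransverseSymmetric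

variable {d h : ℕ} {M : Type*} [TopologicalSpace M] [ChartedSpace (Model (d + h)) M]
  [IsManifold (𝓡 (d + h)) ∞ M] (S : TransverseSymmetric d h M)

/-- The properties of the canonical connection, except smoothness. -/
structure IsPreCanonical (cov : Connection (d + h) M) : Prop where
  metric : ∀ ε : ℝ, 0 < ε → ∀ (U : Set M) (X Y : ∀ x : M, Tan (d + h) x), IsOpen U →
    SmoothOn U X → SmoothOn U Y → ∀ x ∈ U, ∀ u : Tan (d + h) x,
    diff (fun y => S.gEps ε y (X y) (Y y)) x u =
      S.gEps ε x (cov X x u) (Y x) + S.gEps ε x (X x) (cov Y x u)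
  horizontal : ∀ (U : Set M) (Y : ∀ x : M, S.hor x), IsOpen U →
    SmoothOn U (fun x => (Y x : Tan (d + h) x)) →
    ∀ x ∈ U, ∀ u : Tan (d + h) x, cov (fun y => (Y y : Tan (d + h) y)) x u ∈ S.hor x
  vertical : ∀ Z ∈ S.sym, ∀ x, cov Z x = 0
  torsion_vertical : ∀ x, ∀ u ∈ S.hor x, ∀ v ∈ S.hor x, Connection.tor cov x u v ∈ S.ver x
  torsion_zero : ∀ x, ∀ u ∈ S.hor x, ∀ Z ∈ S.sym, Connection.tor cov x u (Z x) = 0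

namespace Frame

variable {S} {U : Opens M} (F : S.Frame U)

/-- The coefficients of the bracket of two frame fields. -/
def structureFun (a b c : Fin d ⊕ Fin h) (x : M) : ℝ :=
  F.isLocalFrameOn.coeff c x (bracket (F.field a) (F.field b) x)

theorem structureFun_swap (a b c : Fin d ⊕ Fin h) (x : M) :
    F.structureFun a b c x = - F.structureFun b a c x := by
  rw [structureFun, structureFun, ← map_neg]
  congr 1
  exact mlieBracket_swap_apply

theorem smoothFun_structureFun (a b c : Fin d ⊕ Fin h) :
    SmoothFun (d + h) (U : Set M) (F.structureFun a b c) :=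
  F.smoothFun_coeff (SmoothOn.bracket U.isOpen (F.smooth_field a) (F.smooth_field b)) c

/-- The coefficients of the canonical connection in an adapted frame. -/
def christoffel : Fin d ⊕ Fin h → Fin d ⊕ Fin h → Fin d ⊕ Fin h → M → ℝ
  | .inl k, .inl i, .inl j => fun x =>
      (2 : ℝ)⁻¹ * (F.structureFun (.inl k) (.inl i) (.inl j) x -
        F.structureFun (.inl i) (.inl j) (.inl k) x + F.structureFun (.inl j) (.inl k) (.inl i) x)
  | .inr m, .inl i, .inl j => F.structureFun (.inr m) (.inl i) (.inl j)
  | _, _, _ => fun _ => 0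

theorem smoothFun_christoffel (a b c : Fin d ⊕ Fin h) :
    SmoothFun (d + h) (U : Set M) (F.christoffel a b c) := by
  rcases a with k | m <;> rcases b with i | m' <;> rcases c with j | m'' <;>
    simp only [christoffel] <;> try exact contMDiffOn_const
  · exact contMDiffOn_const.mul (((F.smoothFun_structureFun _ _ _).sub
      (F.smoothFun_structureFun _ _ _)).add (F.smoothFun_structureFun _ _ _))
  · exact F.smoothFun_structureFun _ _ _

theorem christoffel_inr_snd (b c : Fin d ⊕ Fin h) (m : Fin h) (x : M) :
    F.christoffel b (.inr m) c x = 0 := by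
  rcases b with k | m' <;> rcases c with j | m'' <;> rfl

theorem christoffel_inr_thd (a b : Fin d ⊕ Fin h) (m : Fin h) (x : M) :
    F.christoffel a b (.inr m) x = 0 := by
  rcases a with k | m' <;> rcases b with j | m'' <;> rfl

theorem bracket_symField_mem {Z : ∀ x : M, Tan (d + h) x} (hZ : Z ∈ S.sym) (i : Fin d) {x : M}
    (hx : x ∈ U) : bracket Z (F.field (.inl i)) x ∈ S.hor x :=
  (S.sym_killing _ hZ).bracket_mem U (F.X i) U.isOpen (F.smooth i) x hx

/-- The Killing equation for frame fields, whose inner products are constant. It makes `∇_{Z_m} X_i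
= [Z_m, X_i]` compatible with the metric. -/
theorem structureFun_killing (m : Fin h) (i j : Fin d) {x : M} (hx : x ∈ U) :
    F.structureFun (.inr m) (.inl i) (.inl j) x + F.structureFun (.inr m) (.inl j) (.inl i) x = 0 := by
  have h1 := (S.sym_killing _ (S.symBasis m).2).lie_metric U (F.X i) (F.X j) U.isOpen (F.smooth i)
    (F.smooth j) x hx
  have h2 : diff (n := d + h) (fun y => S.metric y (F.X i y) (F.X j y)) x = 0 := by
    rw [diff_congr (g := fun _ => if i = j then 1 else 0) U.isOpen hx
      (fun y hy => F.orthonormal y hy i j), diff, mvfderiv_const]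
  rw [h2] at h1
  have h3 : ∀ i j, F.structureFun (.inr m) (.inl i) (.inl j) x =
      S.metric x ⟨_, F.bracket_symField_mem (S.symBasis m).2 i hx⟩ (F.X j x) := fun i j => by
    rw [structureFun, F.coeff_inl hx, ← S.horPart_coe x ⟨_, F.bracket_symField_mem
      (S.symBasis m).2 i hx⟩]
    rfl
  rw [h3, h3, (S.metric_inner x).symm _ (F.X i x)]
  exact h1.symm

theorem christoffel_swap (a b c : Fin d ⊕ Fin h) {x : M} (hx : x ∈ U) :
    F.christoffel a c b x = - F.christoffel a b c x := by
  rcases b with i | m'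
  · rcases c with j | m''
    · rcases a with k | m
      · simp only [christoffel]
        rw [F.structureFun_swap (.inl k) (.inl j), F.structureFun_swap (.inl j) (.inl i),
          F.structureFun_swap (.inl i) (.inl k)]
        ring
      · simp only [christoffel]
        linarith [F.structureFun_killing m i j hx]
    · rw [christoffel_inr_snd, christoffel_inr_thd, neg_zero]
  · rw [christoffel_inr_snd, christoffel_inr_thd, neg_zero]

theorem coeff_of_mem_sym {Z : ∀ x : M, Tan (d + h) x} (hZ : Z ∈ S.sym) {x : M} (hx : x ∈ U)
    (a : Fin d ⊕ Fin h) : F.isLocalFrameOn.coeff a x (Z x) =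
      Sum.elim (fun _ => 0) (fun m => S.symMetric ⟨Z, hZ⟩ (S.symBasis m)) a := by
  rcases a with i | m
  · exact F.coeff_inl_of_mem_ver hx ⟨Z, hZ, rfl⟩ i
  · rw [F.coeff_inr hx]
    have h1 := S.symPart_sym x ⟨Z, hZ⟩
    rw [show S.symPart x (Z x) = ⟨Z, hZ⟩ from h1]
    rfl

/-- The canonical connection in an adapted frame. -/
abbrev canonical (Y : ∀ x : M, Tan (d + h) x) (x : M) : Tan (d + h) x →L[ℝ] Tan (d + h) x :=
  frameCov F.isLocalFrameOn F.christoffel Y x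

theorem canonical_metric (ε : ℝ) {X Y : ∀ x : M, Tan (d + h) x} {x : M} (hx : x ∈ U)
    (hX : FieldDiffAt X x) (hY : FieldDiffAt Y x) (u : Tan (d + h) x) :
    diff (fun y => S.gEps ε y (X y) (Y y)) x u =
      S.gEps ε x (F.canonical X x u) (Y x) + S.gEps ε x (X x) (F.canonical Y x u) := by
  rw [diff_congr U.isOpen hx (fun y hy => F.gEps_eq_sum ε hy (X y) (Y y)),
    (diff_sum_mul _ _ (fun a => mdifferentiableAt_coeff U.isOpen F.isLocalFrameOn hx hX a)
      (fun a => mdifferentiableAt_coeff U.isOpen F.isLocalFrameOn hx hY a) u).2,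
    F.gEps_eq_sum ε hx, F.gEps_eq_sum ε hx]
  simp only [coeff_frameCov F.isLocalFrameOn _ _ hx]
  set w : Fin d ⊕ Fin h → ℝ := Sum.elim (fun _ => 1) (fun _ => ε⁻¹) with hw
  -- The coefficients never mix horizontal and vertical indices, so their skewness survives the
  -- weights, whatever `ε` is.
  have hskew : ∀ a b c, w c * F.christoffel b a c x = - (w a * F.christoffel b c a x) := by
    intro a b c
    rcases a with i | m
    · rcases c with j | m''
      · rw [F.christoffel_swap b (.inl i) (.inl j) hx]
        simp [hw]
      · rw [christoffel_inr_snd, christoffel_inr_thd, mul_zero, mul_zero, neg_zero]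
    · rw [christoffel_inr_snd, christoffel_inr_thd, mul_zero, mul_zero, neg_zero]
  have key : ∑ c, ∑ a, ∑ b, w c * (F.isLocalFrameOn.coeff a x (X x) *
      (F.isLocalFrameOn.coeff b x u * F.christoffel b a c x) * F.isLocalFrameOn.coeff c x (Y x)) +
      ∑ c, ∑ a, ∑ b, w c * (F.isLocalFrameOn.coeff c x (X x) * (F.isLocalFrameOn.coeff a x (Y x) *
      (F.isLocalFrameOn.coeff b x u * F.christoffel b a c x))) = 0 := by
    rw [Finset.sum_comm, ← Finset.sum_add_distrib]
    refine Finset.sum_eq_zero fun a _ => ?_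
    rw [← Finset.sum_add_distrib]
    refine Finset.sum_eq_zero fun c _ => ?_
    rw [← Finset.sum_add_distrib]
    refine Finset.sum_eq_zero fun b _ => ?_
    linear_combination (F.isLocalFrameOn.coeff a x (X x) * F.isLocalFrameOn.coeff b x u *
      F.isLocalFrameOn.coeff c x (Y x)) * hskew a b c
  have e1 : ∀ c, w c * ((diff (fun z => F.isLocalFrameOn.coeff c z (X z)) x u +
      ∑ a, ∑ b, F.isLocalFrameOn.coeff a x (X x) *
        (F.isLocalFrameOn.coeff b x u * F.christoffel b a c x)) *
        F.isLocalFrameOn.coeff c x (Y x)) =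
      w c * (diff (fun z => F.isLocalFrameOn.coeff c z (X z)) x u *
        F.isLocalFrameOn.coeff c x (Y x)) +
      ∑ a, ∑ b, w c * (F.isLocalFrameOn.coeff a x (X x) *
        (F.isLocalFrameOn.coeff b x u * F.christoffel b a c x) *
        F.isLocalFrameOn.coeff c x (Y x)) := fun c => by
    simp only [add_mul, mul_add, Finset.sum_mul, Finset.mul_sum]
  have e2 : ∀ c, w c * (F.isLocalFrameOn.coeff c x (X x) *
      (diff (fun z => F.isLocalFrameOn.coeff c z (Y z)) x u +
      ∑ a, ∑ b, F.isLocalFrameOn.coeff a x (Y x) *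
        (F.isLocalFrameOn.coeff b x u * F.christoffel b a c x))) =
      w c * (F.isLocalFrameOn.coeff c x (X x) *
        diff (fun z => F.isLocalFrameOn.coeff c z (Y z)) x u) +
      ∑ a, ∑ b, w c * (F.isLocalFrameOn.coeff c x (X x) * (F.isLocalFrameOn.coeff a x (Y x) *
        (F.isLocalFrameOn.coeff b x u * F.christoffel b a c x))) := fun c => by
    simp only [mul_add, Finset.mul_sum]
  rw [Finset.sum_congr rfl fun c _ => e1 c, Finset.sum_congr rfl fun c _ => e2 c]
  simp only [mul_add, Finset.sum_add_distrib]
  linarith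

theorem canonical_horizontal (Y : ∀ x : M, S.hor x) {x : M}
    (hx : x ∈ U) (u : Tan (d + h) x) :
    F.canonical (fun y => (Y y : Tan (d + h) y)) x u ∈ S.hor x := by
  rw [F.mem_hor_iff hx]
  intro m
  have h1 : diff (n := d + h) (fun y => F.isLocalFrameOn.coeff (.inr m) y (Y y : Tan (d + h) y)) x =
      0 := by
    rw [diff_congr (g := fun _ => 0) U.isOpen hx
      (fun y hy => (F.mem_hor_iff hy _).1 (Y y).2 m), diff, mvfderiv_const]
  rw [coeff_frameCov F.isLocalFrameOn _ _ hx, h1]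
  simp [christoffel_inr_thd]

theorem canonical_vertical {Z : ∀ x : M, Tan (d + h) x} (hZ : Z ∈ S.sym) {x : M} (hx : x ∈ U) :
    F.canonical Z x = 0 := by
  ext1 u
  refine eq_of_coeff F.isLocalFrameOn hx fun c => ?_
  have h1 : diff (n := d + h) (fun y => F.isLocalFrameOn.coeff c y (Z y)) x = 0 := by
    rw [diff_congr U.isOpen hx (fun y hy => F.coeff_of_mem_sym hZ hy c), diff, mvfderiv_const]
  rw [coeff_frameCov F.isLocalFrameOn _ _ hx, h1, Fintype.sum_sum_type]
  simp [F.coeff_of_mem_sym hZ hx, christoffel_inr_snd]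

theorem coeff_canonical_field (a b c : Fin d ⊕ Fin h) {x : M} (hx : x ∈ U) :
    F.isLocalFrameOn.coeff c x (F.canonical (F.field a) x (F.field b x)) =
      F.christoffel b a c x := by
  have h1 : diff (n := d + h) (fun y => F.isLocalFrameOn.coeff c y (F.field a y)) x = 0 := by
    rw [diff_congr U.isOpen hx (fun y hy => F.coeff_field hy c a), diff, mvfderiv_const]
  rw [coeff_frameCov F.isLocalFrameOn _ _ hx, h1]
  simp [F.coeff_field hx]

end Frame

end TransverseSymmetric

/-! ### Gluing: existence, uniqueness and smoothness of the canonical connection -/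

namespace TransverseSymmetric

variable {d h : ℕ} {M : Type*} [TopologicalSpace M] [ChartedSpace (Model (d + h)) M]
  [IsManifold (𝓡 (d + h)) ∞ M] (S : TransverseSymmetric d h M)

/-- A domain of an adapted frame at a point. -/
def frameDomain (x : M) : Opens M := (S.exists_frame_eq x _ (S.horBasis_orthonormal x)).choose

theorem mem_frameDomain (x : M) : x ∈ S.frameDomain x :=
  (S.exists_frame_eq x _ (S.horBasis_orthonormal x)).choose_spec.1

/-- An adapted frame at a point. -/
def frameAt (x : M) : S.Frame (S.frameDomain x) :=
  (S.exists_frame_eq x _ (S.horBasis_orthonormal x)).choose_spec.2.choose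

theorem frameAt_X (x : M) (i : Fin d) : (S.frameAt x).X i x = S.horBasis x i :=
  (S.exists_frame_eq x _ (S.horBasis_orthonormal x)).choose_spec.2.choose_spec i

/-- The canonical connection. -/
def canonicalConnection : Connection (d + h) M where
  -- The frame changes with the point in an uncontrolled way; smoothness comes only after
  -- independence of the frame has been proved.
  toFun Y x := (S.frameAt x).canonical Y x
  isCovariantDerivativeOnUniv :=
    { add := fun hY hY' _ => frameCov_add _ (S.frameDomain _).isOpen _ (S.mem_frameDomain _) hY hY'
      leibniz := fun hY hg _ =>
        frameCov_smul _ (S.frameDomain _).isOpen _ (S.mem_frameDomain _) hY hg }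

theorem canonicalConnection_apply (Y : ∀ x : M, Tan (d + h) x) (x : M) :
    S.canonicalConnection Y x = (S.frameAt x).canonical Y x := rfl

theorem tor_field (cov : Connection (d + h) M) {U : Opens M} (F : S.Frame U) {x : M} (hx : x ∈ U)
    (a b : Fin d ⊕ Fin h) : Connection.tor cov x (F.field a x) (F.field b x) =
      cov (F.field b) x (F.field a x) - cov (F.field a) x (F.field b x) -
        bracket (F.field a) (F.field b) x :=
  CovariantDerivative.torsion_apply cov ((F.smooth_field a).fieldDiffAt U.isOpen hx)
    ((F.smooth_field b).fieldDiffAt U.isOpen hx)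

theorem canonicalConnection_isPreCanonical : S.IsPreCanonical S.canonicalConnection where
  metric ε _ U X Y hU hX hY x hx u :=
    (S.frameAt x).canonical_metric ε (S.mem_frameDomain x) (hX.fieldDiffAt hU hx)
      (hY.fieldDiffAt hU hx) u
  horizontal U Y hU hY x hx u := (S.frameAt x).canonical_horizontal Y (S.mem_frameDomain x) u
  vertical Z hZ x := (S.frameAt x).canonical_vertical hZ (S.mem_frameDomain x)
  torsion_vertical x u hu v hv := by
    have hx := S.mem_frameDomain x
    set F := S.frameAt x with hF
    have h1 : ∀ i j, Connection.tor S.canonicalConnection x (F.X i x : Tan (d + h) x)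
        (F.X j x : Tan (d + h) x) ∈ S.ver x := by
      intro i j
      have h2 := S.tor_field S.canonicalConnection F hx (.inl i) (.inl j)
      rw [canonicalConnection_apply, canonicalConnection_apply, ← hF] at h2
      have h3 : ∀ k, F.isLocalFrameOn.coeff (.inl k) x (Connection.tor S.canonicalConnection x
          (F.field (.inl i) x) (F.field (.inl j) x)) = 0 := by
        intro k
        rw [h2, map_sub, map_sub, F.coeff_canonical_field _ _ _ hx,
          F.coeff_canonical_field _ _ _ hx]
        change _ - _ - F.structureFun (.inl i) (.inl j) (.inl k) x = 0
        simp only [Frame.christoffel]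
        rw [F.structureFun_swap (.inl j) (.inl i), F.structureFun_swap (.inl i) (.inl k),
          F.structureFun_swap (.inl k) (.inl j)]
        ring
      change Connection.tor S.canonicalConnection x (F.field (.inl i) x) (F.field (.inl j) x) ∈ _
      rw [F.eq_sum hx (Connection.tor _ _ _ _), Fintype.sum_sum_type]
      simp only [h3, zero_smul, Finset.sum_const_zero, zero_add]
      exact Submodule.sum_mem _ fun m _ => Submodule.smul_mem _ _ ⟨_, (S.symBasis m).2, rfl⟩
    have h4 : ∀ w : S.hor x, (w : Tan (d + h) x) =
        ∑ i, (F.horBasisAt hx).repr w i • (F.X i x : Tan (d + h) x) := by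
      intro w
      conv_lhs => rw [← (F.horBasisAt hx).sum_repr w]
      simp
    have h5 := h4 ⟨u, hu⟩
    have h6 := h4 ⟨v, hv⟩
    simp only at h5 h6
    rw [h5, h6, Connection.tor, map_sum]
    refine Submodule.sum_mem _ fun j _ => ?_
    rw [map_smul, map_sum, _root_.sum_apply]
    refine Submodule.smul_mem _ _ (Submodule.sum_mem _ fun i _ => ?_)
    rw [map_smul, _root_.smul_apply]
    exact Submodule.smul_mem _ _ (h1 i j)
  torsion_zero x u hu Z hZ := by
    have hx := S.mem_frameDomain x
    set F := S.frameAt x with hF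
    have h1 : ∀ i m, Connection.tor S.canonicalConnection x (F.X i x : Tan (d + h) x)
        (S.symField m x) = 0 := by
      intro i m
      have h2 := S.tor_field S.canonicalConnection F hx (.inl i) (.inr m)
      rw [canonicalConnection_apply, canonicalConnection_apply, ← hF] at h2
      refine h2.trans (eq_of_coeff F.isLocalFrameOn hx fun c => ?_)
      rw [map_sub, map_sub, F.coeff_canonical_field _ _ _ hx, F.coeff_canonical_field _ _ _ hx,
        map_zero]
      change _ - _ - F.structureFun (.inl i) (.inr m) c x = 0
      rw [F.structureFun_swap, F.christoffel_inr_snd]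
      rcases c with k | m'
      · simp [Frame.christoffel]
      -- The vertical component vanishes because a Killing field maps horizontal fields to
      -- horizontal ones under the bracket.
      · have h3 := (F.mem_hor_iff hx _).1 (F.bracket_symField_mem (S.symBasis m).2 i hx) m'
        change F.structureFun (.inr m) (.inl i) (.inr m') x = 0 at h3
        rw [h3, F.christoffel_inr_thd]
        simp
    have h4 : u = ∑ i, (F.horBasisAt hx).repr ⟨u, hu⟩ i • (F.X i x : Tan (d + h) x) := by
      have h5 := congrArg (Subtype.val) ((F.horBasisAt hx).sum_repr ⟨u, hu⟩)
      simpa using h5.symm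
    have h6 : Z x = ∑ m, S.symBasis.repr ⟨Z, hZ⟩ m • S.symField m x := by
      have h7 : ((∑ m, S.symBasis.repr ⟨Z, hZ⟩ m • S.symBasis m : S.sym) :
          ∀ y, Tan (d + h) y) x = Z x := by rw [S.symBasis.sum_repr]
      rw [← h7]
      simp only [Submodule.coe_sum, Finset.sum_apply, Submodule.coe_smul, Pi.smul_apply, symField]
    rw [h4, h6, Connection.tor, map_sum]
    refine Finset.sum_eq_zero fun m _ => ?_
    rw [map_smul, map_sum, _root_.sum_apply]
    refine smul_eq_zero_of_right _ (Finset.sum_eq_zero fun i _ => ?_)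
    rw [map_smul, _root_.smul_apply]
    exact smul_eq_zero_of_right _ (h1 i m)

variable {S}

/-- Koszul's formula: the connection is determined by the brackets of the frame fields. -/
theorem IsPreCanonical.coeff_cov {cov : Connection (d + h) M} (hc : S.IsPreCanonical cov)
    {U : Opens M} (F : S.Frame U) {x : M} (hx : x ∈ U) (a b c : Fin d ⊕ Fin h) :
    F.isLocalFrameOn.coeff c x (cov (F.field a) x (F.field b x)) = F.christoffel b a c x := by
  rcases a with i | m
  · rcases c with j | m'
    · rcases b with k | m
      · let A : Fin d → Fin d → Fin d → ℝ := fun k i j =>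
          F.isLocalFrameOn.coeff (.inl j) x (cov (F.field (.inl i)) x (F.field (.inl k) x))
        have hskew : ∀ k i j, A k i j + A k j i = 0 := by
          intro k i j
          have h1 := hc.metric 1 one_pos U (F.field (.inl i)) (F.field (.inl j)) U.isOpen
            (F.smooth_field _) (F.smooth_field _) x hx (F.field (.inl k) x)
          rw [diff_congr U.isOpen hx (fun y hy => F.gEps_one_field hy (.inl i) (.inl j)), diff,
            mvfderiv_const, S.gEps_symm 1 x (F.field (.inl i) x), ← F.coeff_eq hx,
            ← F.coeff_eq hx] at h1
          exact h1.symm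
        have htor : ∀ k i j, A k i j - A i k j =
            F.structureFun (.inl k) (.inl i) (.inl j) x := by
          intro k i j
          have h1 := F.coeff_inl_of_mem_ver hx
            (hc.torsion_vertical x _ (F.X k x).2 _ (F.X i x).2) j
          have h2 := S.tor_field cov F hx (.inl k) (.inl i)
          have h3 := (congrArg (F.isLocalFrameOn.coeff (.inl j) x) h2).symm.trans h1
          rw [map_sub, map_sub] at h3
          exact sub_eq_zero.1 h3
        change A k i j = _
        simp only [Frame.christoffel]
        rw [← htor, ← htor, ← htor]
        linarith [hskew k i j, hskew i k j, hskew j i k]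
      -- As `∇Z_m = 0`, the vanishing of `T(X_i, Z_m)` says exactly that `∇_{Z_m} X_i = [Z_m, X_i]`.
      · have h1 := hc.torsion_zero x _ (F.X i x).2 _ (S.symBasis m).2
        have h2 := S.tor_field cov F hx (.inl i) (.inr m)
        have h3 := (congrArg (F.isLocalFrameOn.coeff (.inl j) x) h2).symm.trans
          (congrArg (F.isLocalFrameOn.coeff (.inl j) x) h1)
        have h4 : cov (F.field (.inr m)) x = 0 := hc.vertical _ (S.symBasis m).2 x
        rw [map_sub, map_sub, map_zero, h4] at h3
        have h5 : F.structureFun (.inl i) (.inr m) (.inl j) x =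
            - F.isLocalFrameOn.coeff (.inl j) x (cov (F.field (.inl i)) x (F.field (.inr m) x)) := by
          have h6 : F.isLocalFrameOn.coeff (.inl j) x
            ((0 : Tan (d + h) x →L[ℝ] Tan (d + h) x) (F.field (.inl i) x)) = 0 := by simp
          rw [h6] at h3
          rw [Frame.structureFun]
          linarith
        rw [F.structureFun_swap] at h5
        exact (neg_inj.1 h5).symm
    · rw [F.christoffel_inr_thd]
      exact (F.mem_hor_iff hx _).1 (hc.horizontal U (F.X i) U.isOpen (F.smooth i) x hx _) m'
  · have h4 : cov (F.field (.inr m)) x = 0 := hc.vertical _ (S.symBasis m).2 x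
    rw [h4, F.christoffel_inr_snd]
    simp

/-- Leibniz reduces `∇Y` to the derivatives of the frame fields, which are forced. Any adapted frame
around `x` may be used, and `Y` need only be differentiable at `x`. -/
theorem IsPreCanonical.eq_canonical {cov : Connection (d + h) M} (hc : S.IsPreCanonical cov)
    {U : Opens M} (F : S.Frame U) {x : M} (hx : x ∈ U) {Y : ∀ x : M, Tan (d + h) x}
    (hY : FieldDiffAt Y x) : cov Y x = F.canonical Y x := by
  have h1 := cov.sum_smul Finset.univ
    (fun a => mdifferentiableAt_coeff U.isOpen F.isLocalFrameOn hx hY a)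
    (fun a => (F.smooth_field a).fieldDiffAt U.isOpen hx)
  have h2 : cov Y x = cov (∑ a, (fun y => F.isLocalFrameOn.coeff a y (Y y)) • F.field a) x := by
    refine cov.congr U.isOpen hx hY fun y hy => ?_
    rw [Finset.sum_apply]
    exact F.eq_sum hy (Y y)
  ext1 u
  rw [h2, (h1 u).2, frameCov_apply]
  refine Finset.sum_congr rfl fun a _ => ?_
  refine (add_comm _ _).trans ?_
  congr 2
  conv_lhs => rw [F.eq_sum hx u, map_sum]
  refine Finset.sum_congr rfl fun b _ => ?_
  rw [map_smul]
  congr 1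
  rw [F.eq_sum hx (cov (F.field a) x (F.field b x))]
  exact Finset.sum_congr rfl fun c _ => by rw [hc.coeff_cov F hx]

variable (S)

/-- Near `x₀` uniqueness replaces the varying frames by the single frame of `x₀`, whose coefficients
are smooth. -/
theorem canonicalConnection_smooth :
    CovariantDerivative.ContMDiffCovariantDerivative S.canonicalConnection ∞ := by
  refine ⟨⟨fun {Y} hY => ?_⟩⟩
  have hY' : SmoothOn Set.univ Y := hY
  intro x₀ _
  refine ContMDiffAt.contMDiffWithinAt ?_
  refine (contMDiffOn_hom_of_apply (U := (S.frameDomain x₀ : Set M)) (S.frameDomain x₀).isOpen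
    (L := fun x => S.canonicalConnection Y x) ?_).contMDiffAt
    ((S.frameDomain x₀).isOpen.mem_nhds (S.mem_frameDomain x₀))
  intro V X hV hVU hX
  refine (frameCov_smoothOn (S.frameAt x₀).isLocalFrameOn (S.frameDomain x₀).isOpen
    (S.frameAt x₀).smoothFun_christoffel hV hVU hX (hY'.mono (Set.subset_univ V))).congr ?_
  intro x hx
  have h1 := S.canonicalConnection_isPreCanonical.eq_canonical (S.frameAt x₀) (hVU hx)
    (hY'.fieldDiffAt isOpen_univ (Set.mem_univ x))
  exact congrArg (fun L : Tan (d + h) x →L[ℝ] Tan (d + h) x =>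
    (TotalSpace.mk' (Model (d + h)) x (L (X x)) : TangentBundle (𝓡 (d + h)) M)) h1

theorem canonicalConnection_isCanonical : S.IsCanonical S.canonicalConnection where
  smooth := S.canonicalConnection_smooth
  metric := S.canonicalConnection_isPreCanonical.metric
  horizontal U Y hU hY x hx u _ :=
    S.canonicalConnection_isPreCanonical.horizontal U Y hU hY x hx u
  vertical := S.canonicalConnection_isPreCanonical.vertical
  torsion_vertical := S.canonicalConnection_isPreCanonical.torsion_vertical
  torsion_zero := S.canonicalConnection_isPreCanonical.torsion_zero

end TransverseSymmetric

/-! ### The sub-Laplacian on functions -/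

theorem IsInner.apply_riesz {V : Type*} [AddCommGroup V] [Module ℝ V] [FiniteDimensional ℝ V]
    {B : LinearMap.BilinForm ℝ V} (hB : IsInner B) (φ : Dual ℝ V) (v : V) :
    B (hB.riesz φ) v = φ v :=
  LinearMap.BilinForm.apply_toDual_symm_apply φ v

theorem coeff_eq_of_orthonormal {n : ℕ} {M : Type*} [TopologicalSpace M] [ChartedSpace (Model n) M]
    [IsManifold (𝓡 n) ∞ M] {ι : Type*} [Fintype ι] [DecidableEq ι] {U : Set M}
    {E : ι → ∀ x : M, Tan n x}
    (hE : IsLocalFrameOn (𝓡 n) (Model n) ∞ E U) {x : M} (hx : x ∈ U)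
    {g : LinearMap.BilinForm ℝ (Tan n x)} (hg : ∀ a b, g (E a x) (E b x) = if a = b then 1 else 0)
    (v : Tan n x) (a : ι) : hE.coeff a x v = g v (E a x) := by
  have h1 : v = ∑ b, hE.coeff b x v • E b x := by
    have h2 := ((hE.toBasisAt hx).sum_repr v).symm
    simpa [IsLocalFrameOn.coeff, hx] using h2
  conv_rhs => rw [h1]
  rw [map_sum, LinearMap.sum_apply]
  simp only [map_smul, LinearMap.smul_apply, hg]
  simp

namespace TransverseSymmetric

variable {d h : ℕ} {M : Type*} [TopologicalSpace M] [ChartedSpace (Model (d + h)) M]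
  [IsManifold (𝓡 (d + h)) ∞ M] {S : TransverseSymmetric d h M} {U : Opens M}

theorem metric_sharp (S : TransverseSymmetric d h M) (x : M) (η : Tan (d + h) x →L[ℝ] ℝ)
    (u : S.hor x) : S.metric x (S.sharp x η) u = η u :=
  (S.metric_inner x).apply_riesz _ u

namespace Frame

variable (F : S.Frame U)

theorem hor_eq_sum {x : M} (hx : x ∈ U) (u : S.hor x) :
    u = ∑ i, S.metric x u (F.X i x) • F.X i x := by
  have h1 := (F.horBasisAt hx).sum_repr u
  simp only [horBasisAt_apply] at h1
  have h2 : ∀ i, S.metric x u (F.X i x) = (F.horBasisAt hx).repr u i := fun i => by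
    conv_lhs => rw [← h1]
    simp [F.orthonormal x hx]
  simp only [h2, h1]

theorem sharp_eq_sum {x : M} (hx : x ∈ U) (η : Tan (d + h) x →L[ℝ] ℝ) :
    S.sharp x η = ∑ i, η (F.X i x) • F.X i x := by
  conv_lhs => rw [F.hor_eq_sum hx (S.sharp x η)]
  simp only [S.metric_sharp]

theorem horGrad_eq_sum (f : M → ℝ) {x : M} (hx : x ∈ U) :
    S.horGrad f x = ∑ i, diff f x (F.field (.inl i) x) • F.field (.inl i) x := by
  rw [horGrad, F.sharp_eq_sum hx]
  simp [field]

theorem smoothOn_horGrad (F : S.Frame U) {f : M → ℝ} (hf : SmoothFun (d + h) (U : Set M) f) :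
    SmoothOn (U : Set M) (S.horGrad f) := by
  have h1 : SmoothOn (U : Set M) (fun x =>
      ∑ i, diff f x (F.field (.inl i) x) • F.field (.inl i) x) :=
    ContMDiffOn.sum_section fun i _ => ContMDiffOn.smul_section
      (SmoothOn.diff U.isOpen hf (F.smooth_field _)) (F.smooth_field _)
  exact h1.congr fun x hx => congrArg (TotalSpace.mk' (Model (d + h)) x) (F.horGrad_eq_sum f hx)

variable [T2Space M] {cov : Connection (d + h) M} (hc : S.IsCanonical cov)

theorem of_horGrad {f : M → ℝ} (hf : SmoothFun (d + h) (U : Set M) f) :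
    FieldOn.of (S.horGrad f) (F.smoothOn_horGrad hf) = ∑ j, (F.adaptedConn hc).act
      ((F.adaptedConn hc).X j) (FunOn.of f hf) • (F.adaptedConn hc).X j := by
  refine FieldOn.eq_of_eval fun x => ?_
  rw [map_sum, FieldOn.eval_of, F.horGrad_eq_sum f x.2]
  refine Finset.sum_congr rfl fun j _ => ?_
  rw [FieldOn.eval_smul]
  congr 1
  exact (eval_act cov hc.smooth x (F.smooth_field (.inl j)) hf).symm

theorem subLaplacian_eq {f : M → ℝ} (hf : SmoothFun (d + h) (U : Set M) f) (x : U) :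
    S.subLaplacian f x = FunOn.eval x ((F.adaptedConn hc).lap (FunOn.of f hf)) := by
  -- The divergence formula takes a frame indexed by `Fin n`, so the two families are concatenated.
  let E : Fin (d + h) → ∀ x : M, Tan (d + h) x := fun a => F.field (finSumFinEquiv.symm a)
  have hE : IsLocalFrameOn (𝓡 (d + h)) (Model (d + h)) ∞ E (U : Set M) :=
    { linearIndependent := fun {y} hy =>
        (F.isLocalFrameOn.linearIndependent hy).comp _ finSumFinEquiv.symm.injective
      generating := fun {y} hy => by
        have h1 := F.isLocalFrameOn.generating hy
        have h2 : Set.range (fun a => E a y) = Set.range (fun a => F.field a y) :=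
          finSumFinEquiv.symm.surjective.range_comp (fun a => F.field a y)
        rwa [h2]
      contMDiffOn := fun a => F.smooth_field _ }
  have hg : ∀ y ∈ (U : Set M), ∀ a b, S.gEps 1 y (E a y) (E b y) = if a = b then 1 else 0 := by
    intro y hy a b
    rw [F.gEps_one_field hy]
    simp
  rw [subLaplacian, divergence_eq U.isOpen hE hg x.2
    ((F.smoothOn_horGrad hf).fieldDiffAt U.isOpen x.2), ← AdaptedConn.sum_G_br_eq_lap,
    ← F.of_horGrad hc hf, map_add, map_sum, map_sum]
  have h1 : ∀ a : Fin d ⊕ Fin h, FunOn.eval x (F.metricMap ((F.adaptedConn hc).br (F.fieldOn a)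
      (FieldOn.of (S.horGrad f) (F.smoothOn_horGrad hf))) (F.fieldOn a)) =
      S.gEps 1 (x : M) (bracket (F.field a) (S.horGrad f) x) (F.field a x) := fun a => by
    rw [eval_metricMap, eval_fieldOn]
    congr 2
    exact eval_br cov hc.smooth x (F.smooth_field a) (F.smoothOn_horGrad hf)
  have h2 : ∀ a, hE.coeff a x (bracket (E a) (S.horGrad f) x) =
      S.gEps 1 (x : M) (bracket (E a) (S.horGrad f) x) (E a x) := fun a =>
    coeff_eq_of_orthonormal hE x.2 (hg x x.2) _ a
  simp only [h2]
  rw [finSumFinEquiv.symm.sum_comp (fun a => S.gEps 1 (x : M)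
    (bracket (F.field a) (S.horGrad f) x) (F.field a x)), Fintype.sum_sum_type]
  congr 1
  · exact Finset.sum_congr rfl fun i _ => (h1 (.inl i)).symm
  · exact Finset.sum_congr rfl fun m _ => (h1 (.inr m)).symm

theorem smoothFun_subLaplacian (F : S.Frame U) (hc : S.IsCanonical cov) {f : M → ℝ} (hf : SmoothFun (d + h) (U : Set M) f) :
    SmoothFun (d + h) (U : Set M) (S.subLaplacian f) := by
  have h1 := ((F.adaptedConn hc).lap (FunOn.of f hf)).smooth
  refine h1.congr fun x hx => ?_
  rw [F.subLaplacian_eq hc hf ⟨x, hx⟩, ← FunOn.eval_ext]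

theorem of_subLaplacian {f : M → ℝ} (hf : SmoothFun (d + h) (U : Set M) f) :
    FunOn.of (S.subLaplacian f) (F.smoothFun_subLaplacian hc hf) =
      (F.adaptedConn hc).lap (FunOn.of f hf) :=
  FunOn.eq_of_eval fun x => F.subLaplacian_eq hc hf x

theorem diff_subLaplacian {f : M → ℝ} (hf : SmoothFun (d + h) (U : Set M) f) (x : U)
    (a : Fin d ⊕ Fin h) : diff (S.subLaplacian f) (x : M) (F.field a x) =
      FunOn.eval x ((F.adaptedConn hc).act (F.fieldOn a)
        ((F.adaptedConn hc).lap (FunOn.of f hf))) := by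
  rw [← F.of_subLaplacian hc hf]
  exact (eval_act cov hc.smooth x (F.smooth_field a) _).symm

end Frame

end TransverseSymmetric

/-! ### Tensors at a point in terms of fields -/

section

variable {n : ℕ} {M : Type*} [TopologicalSpace M] [ChartedSpace (Model n) M]
  [IsManifold (𝓡 n) ∞ M]

/-- The extension of a vector is constant in the trivialization at `x`, so one neighbourhood serves
all vectors at `x`. -/
theorem exists_smoothOn_ext (x : M) :
    ∃ V : Opens M, x ∈ V ∧ ∀ v : Tan n x, SmoothOn (V : Set M) (ext v) := by
  set t := trivializationAt (Model n) (TangentSpace (𝓡 n) : M → Type _) x with ht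
  refine ⟨⟨t.baseSet, t.open_baseSet⟩, FiberBundle.mem_baseSet_trivializationAt' x, fun v y hy => ?_⟩
  refine (t.contMDiffWithinAt_section _ hy).2 ?_
  have h1 : ContMDiffOn (𝓡 n) 𝓘(ℝ, Model n) ∞ (fun _ : M => (t ⟨x, v⟩).2) t.baseSet :=
    contMDiffOn_const
  refine (h1.congr fun z hz => ?_) y hy
  have hz' : z ∈ t.baseSet := hz
  simp [ext, FiberBundle.extend, ← ht, hz']

theorem Connection.covForm_apply (cov : Connection n M) {η : ∀ x : M, Tan n x →L[ℝ] ℝ} {x : M}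
    (hη : Connection.FormDiffAt η x) (u : Tan n x) {Y : ∀ x : M, Tan n x} (hY : FieldDiffAt Y x) :
    cov.covForm η x u (Y x) = diff (fun y => η y (Y y)) x u - η x (cov Y x u) := by
  rw [covForm, dif_pos hη, TensorialAt.mkHom_apply _ hY]
  rfl

theorem formDiffAt_of_frame {ι : Type*} [Fintype ι] {U : Set M} (hU : IsOpen U)
    {E : ι → ∀ x : M, Tan n x} (hE : IsLocalFrameOn (𝓡 n) (Model n) ∞ E U)
    {η : ∀ x : M, Tan n x →L[ℝ] ℝ} {x : M} (hx : x ∈ U)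
    (h : ∀ a, MDifferentiableAt (𝓡 n) 𝓘(ℝ, ℝ) (fun y => η y (E a y)) x) :
    Connection.FormDiffAt η x := by
  intro Y hY
  refine (diff_sum_mul Finset.univ (fun _ => 1)
    (fun a => mdifferentiableAt_coeff hU hE hx hY a) h 0).1.congr_of_eventuallyEq ?_
  filter_upwards [hU.mem_nhds hx] with y hy
  conv_lhs => rw [hE.coeff_sum_eq Y hy]
  simp

variable [T2Space M] (cov : Connection n M)
  (hcov : CovariantDerivative.ContMDiffCovariantDerivative cov ∞) {U : Opens M}

theorem nab_of {X Y : ∀ x : M, Tan n x} (hX : SmoothOn (U : Set M) X)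
    (hY : SmoothOn (U : Set M) Y) :
    (connAlg cov hcov U).nab (FieldOn.of X hX) (FieldOn.of Y hY) =
      FieldOn.of _ (cov.smoothOn hcov U.isOpen hX hY) :=
  nabMap_of cov hcov hX hY

theorem br_of {X Y : ∀ x : M, Tan n x} (hX : SmoothOn (U : Set M) X)
    (hY : SmoothOn (U : Set M) Y) :
    (connAlg cov hcov U).br (FieldOn.of X hX) (FieldOn.of Y hY) =
      FieldOn.of _ (hX.bracket U.isOpen hY) :=
  brField_of hX hY

theorem eval_curv (x : U) {A V W : ∀ x : M, Tan n x} (hA : SmoothOn (U : Set M) A)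
    (hV : SmoothOn (U : Set M) V) (hW : SmoothOn (U : Set M) W) :
    FieldOn.eval x ((connAlg cov hcov U).curv (FieldOn.of A hA) (FieldOn.of V hV)
      (FieldOn.of W hW)) = cov (fun y => cov W y (V y)) (x : M) (A x) -
        cov (fun y => cov W y (A y)) (x : M) (V x) - cov W (x : M) (bracket A V x) := by
  simp only [ConnAlg.curv, nab_of, br_of, map_sub, FieldOn.eval_of]

theorem eval_covTor (x : U) {A V W : ∀ x : M, Tan n x} (hA : SmoothOn (U : Set M) A)
    (hV : SmoothOn (U : Set M) V) (hW : SmoothOn (U : Set M) W) :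
    FieldOn.eval x ((connAlg cov hcov U).covTor (FieldOn.of A hA) (FieldOn.of V hV)
      (FieldOn.of W hW)) = cov (fun y => Connection.tor cov y (V y) (W y)) (x : M) (A x) -
        Connection.tor cov (x : M) (cov V x (A x)) (W x) -
        Connection.tor cov (x : M) (V x) (cov W x (A x)) := by
  set T := (connAlg cov hcov U).tor (FieldOn.of V hV) (FieldOn.of W hW) with hT
  have h1 : cov T.ext (x : M) = cov (fun y => Connection.tor cov y (V y) (W y)) (x : M) := by
    refine cov.congr U.isOpen x.2 (T.smooth.fieldDiffAt U.isOpen x.2) fun y hy => ?_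
    rw [FieldOn.eval_ext ⟨y, hy⟩ T, hT, eval_tor]
  rw [ConnAlg.covTor, ← hT, nab_of, nab_of, map_sub, map_sub, eval_tor, eval_tor, T.eq_of,
    eval_nab, h1]

theorem formDiffAt_diff {ι : Type*} [Fintype ι] {E : ι → ∀ x : M, Tan n x}
    (hE : IsLocalFrameOn (𝓡 n) (Model n) ∞ E (U : Set M)) {f : M → ℝ}
    (hf : SmoothFun n (U : Set M) f) {x : M} (hx : x ∈ U) :
    Connection.FormDiffAt (n := n) (diff f) x :=
  formDiffAt_of_frame U.isOpen hE hx fun a =>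
    (SmoothOn.diff U.isOpen hf (hE.contMDiffOn a)).diffAt U.isOpen hx

theorem covForm_diff {ι : Type*} [Fintype ι] {E : ι → ∀ x : M, Tan n x}
    (hE : IsLocalFrameOn (𝓡 n) (Model n) ∞ E (U : Set M)) {f : M → ℝ}
    (hf : SmoothFun n (U : Set M) f) (x : U) {V W : ∀ x : M, Tan n x}
    (hV : SmoothOn (U : Set M) V) (hW : SmoothOn (U : Set M) W) :
    cov.covForm (diff f) x (V x) (W x) = FunOn.eval x ((connAlg cov hcov U).hess (FunOn.of f hf)
      (FieldOn.of V hV) (FieldOn.of W hW)) := by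
  rw [cov.covForm_apply (formDiffAt_diff hE hf x.2) (V x) (hW.fieldDiffAt U.isOpen x.2),
    ConnAlg.hess_apply, map_sub, nab_of, eval_act]
  congr 1
  have h1 : (connAlg cov hcov U).act (FieldOn.of W hW) (FunOn.of f hf) =
      FunOn.of _ (SmoothOn.diff U.isOpen hf hW) := actMap_of hW hf
  rw [h1, eval_act]

/-- By `covForm_diff`, `(∇_V df)(W)` is `Hess f(V, W)`; one more derivative gives `∇Hess f`, with
the form argument `W` in the last slot. -/
theorem covForm₂_diff {ι : Type*} [Fintype ι] {E : ι → ∀ x : M, Tan n x}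
    (hE : IsLocalFrameOn (𝓡 n) (Model n) ∞ E (U : Set M)) {f : M → ℝ}
    (hf : SmoothFun n (U : Set M) f) (x : U) {A W : ∀ x : M, Tan n x} {v : Tan n (x : M)}
    (hA : SmoothOn (U : Set M) A) (hv : SmoothOn (U : Set M) (ext v))
    (hW : SmoothOn (U : Set M) W) :
    cov.covForm₂ (diff f) x (A x) v (W x) = FunOn.eval x ((connAlg cov hcov U).covHess
      (FunOn.of f hf) (FieldOn.of A hA) (FieldOn.of W hW) (FieldOn.of (ext v) hv)) := by
  have hs : ∀ {D : ∀ x : M, Tan n x} (hD : SmoothOn (U : Set M) D),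
      SmoothFun n (U : Set M) (fun y => cov.covForm (diff f) y (ext v y) (D y)) := by
    intro D hD
    refine ((connAlg cov hcov U).hess (FunOn.of f hf) (FieldOn.of _ hv)
      (FieldOn.of D hD)).smooth.congr fun y hy => ?_
    rw [covForm_diff cov hcov hE hf ⟨y, hy⟩ hv hD]
    exact (FunOn.eval_ext ⟨y, hy⟩ _).symm
  have hη : Connection.FormDiffAt (fun y => cov.covForm (diff f) y (ext v y)) (x : M) :=
    formDiffAt_of_frame U.isOpen hE x.2 fun a =>
      (hs (hE.contMDiffOn a)).diffAt U.isOpen x.2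
  have h1 : FunOn.of _ (hs hW) = (connAlg cov hcov U).hess (FunOn.of f hf) (FieldOn.of _ hv)
      (FieldOn.of W hW) := FunOn.eq_of_eval fun y => covForm_diff cov hcov hE hf y hv hW
  rw [Connection.covForm₂, _root_.sub_apply, cov.covForm_apply hη _ (hW.fieldDiffAt U.isOpen x.2),
    ConnAlg.covHess_apply, map_sub, map_sub, ← h1, nab_of, nab_of, eval_act,
    ← covForm_diff cov hcov hE hf x _ hW, ← covForm_diff cov hcov hE hf x hv]
  ring

end

namespace TransverseSymmetric

variable {d h : ℕ} {M : Type*} [TopologicalSpace M] [ChartedSpace (Model (d + h)) M]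
  [IsManifold (𝓡 (d + h)) ∞ M] {S : TransverseSymmetric d h M} {U : Opens M}

theorem exists_frame_ext (S : TransverseSymmetric d h M) (x : M) : ∃ U : Opens M, x ∈ U ∧
    (∀ v : Tan (d + h) x, SmoothOn (U : Set M) (ext v)) ∧
    ∃ F : S.Frame U, ∀ i, F.X i x = S.horBasis x i := by
  obtain ⟨V, hxV, hV⟩ := exists_smoothOn_ext (n := d + h) x
  refine ⟨S.frameDomain x ⊓ V, ⟨S.mem_frameDomain x, hxV⟩, fun v => (hV v).mono inf_le_right,
    (S.frameAt x).restrict inf_le_left, S.frameAt_X x⟩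

namespace Frame

variable [T2Space M] {cov : Connection (d + h) M} (hc : S.IsCanonical cov) (F : S.Frame U)

/-- A map linear over functions is a tensor: expanding its argument in the frame shows that its
value at `x` depends only on the value of the argument there. -/
theorem eval_map_fun (hc : S.IsCanonical cov) (F : S.Frame U)
    (Φ : FieldOn (d + h) U →ₗ[FunOn (d + h) U] FunOn (d + h) U) (x : U)
    {A B : FieldOn (d + h) U} (hAB : FieldOn.eval x A = FieldOn.eval x B) :
    FunOn.eval x (Φ A) = FunOn.eval x (Φ B) := by
  rw [(F.adaptedConn hc).map_expand Φ A, (F.adaptedConn hc).map_expand Φ B]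
  have h1 : ∀ C, FunOn.eval x ((F.adaptedConn hc).G A C) =
      FunOn.eval x ((F.adaptedConn hc).G B C) := fun C => by
    change FunOn.eval x (F.metricMap A C) = FunOn.eval x (F.metricMap B C)
    rw [eval_metricMap, eval_metricMap, hAB]
  simp only [map_add, map_sum, smul_eq_mul, map_mul, h1]

theorem eval_map_field (hc : S.IsCanonical cov) (F : S.Frame U)
    (Φ : FieldOn (d + h) U →ₗ[FunOn (d + h) U] FieldOn (d + h) U) (x : U)
    {A B : FieldOn (d + h) U} (hAB : FieldOn.eval x A = FieldOn.eval x B) :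
    FieldOn.eval x (Φ A) = FieldOn.eval x (Φ B) := by
  rw [(F.adaptedConn hc).map_expand Φ A, (F.adaptedConn hc).map_expand Φ B]
  have h1 : ∀ C, FunOn.eval x ((F.adaptedConn hc).G A C) =
      FunOn.eval x ((F.adaptedConn hc).G B C) := fun C => by
    change FunOn.eval x (F.metricMap A C) = FunOn.eval x (F.metricMap B C)
    rw [eval_metricMap, eval_metricMap, hAB]
  simp only [map_add, map_sum, FieldOn.eval_smul, h1]

variable {x : U} (hext : ∀ v : Tan (d + h) (x : M), SmoothOn (U : Set M) (ext v))

theorem eval_of_ext (v : Tan (d + h) (x : M)) : FieldOn.eval x (FieldOn.of (ext v) (hext v)) = v := by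
  rw [FieldOn.eval_of]
  exact FiberBundle.extend_apply_self _ v

theorem curv_eq (hext : ∀ v : Tan (d + h) (x : M), SmoothOn (U : Set M) (ext v))
    (A V W : FieldOn (d + h) U) :
    cov.curv (x : M) (FieldOn.eval x A) (FieldOn.eval x V) (FieldOn.eval x W) =
      FieldOn.eval x ((F.adaptedConn hc).curv A V W) := by
  set C := F.adaptedConn hc with hC
  -- The curvature at a point is defined through special extensions; tensoriality exchanges them for
  -- the given fields, one slot at a time.
  have h1 := F.eval_map_field hc (C.curvFst V W) x (eval_of_ext hext (FieldOn.eval x A))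
  have h2 := F.eval_map_field hc (C.curvSnd (FieldOn.of _ (hext (FieldOn.eval x A))) W) x
    (eval_of_ext hext (FieldOn.eval x V))
  have h3 := F.eval_map_field hc (C.curvThd (FieldOn.of _ (hext (FieldOn.eval x A)))
    (FieldOn.of _ (hext (FieldOn.eval x V)))) x (eval_of_ext hext (FieldOn.eval x W))
  refine Eq.trans ?_ (h3.trans (h2.trans h1))
  refine Eq.trans ?_ (eval_curv cov hc.smooth x (hext _) (hext _) (hext _)).symm
  rw [Connection.curv]
  congr 2
  · congr 1
    exact (FiberBundle.extend_apply_self _ _).symm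
  · congr 1
    exact (FiberBundle.extend_apply_self _ _).symm

theorem covTor_eq (hext : ∀ v : Tan (d + h) (x : M), SmoothOn (U : Set M) (ext v))
    {A : ∀ x : M, Tan (d + h) x} (hA : SmoothOn (U : Set M) A) (V W : FieldOn (d + h) U) :
    cov.covTor (x : M) (A x) (FieldOn.eval x V) (FieldOn.eval x W) =
      FieldOn.eval x ((F.adaptedConn hc).covTor (FieldOn.of A hA) V W) := by
  set C := F.adaptedConn hc with hC
  have h2 := F.eval_map_field hc (C.covTorFst (FieldOn.of A hA) W) x
    (eval_of_ext hext (FieldOn.eval x V))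
  have h3 := F.eval_map_field hc (C.covTorSnd (FieldOn.of A hA)
    (FieldOn.of _ (hext (FieldOn.eval x V)))) x (eval_of_ext hext (FieldOn.eval x W))
  refine Eq.trans ?_ (h3.trans h2)
  refine Eq.trans ?_ (eval_covTor cov hc.smooth x hA (hext _) (hext _)).symm
  rw [Connection.covTor]
  congr 2
  · congr 1
    exact (FiberBundle.extend_apply_self _ _).symm
  · exact (FiberBundle.extend_apply_self _ _).symm

theorem covForm₂_eq (hext : ∀ v : Tan (d + h) (x : M), SmoothOn (U : Set M) (ext v)) {f : M → ℝ}
    (hf : SmoothFun (d + h) (U : Set M) f) (a b c : Fin d ⊕ Fin h) :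
    cov.covForm₂ (diff f) (x : M) (F.field a x) (F.field b x) (F.field c x) =
      FunOn.eval x ((F.adaptedConn hc).covHess (FunOn.of f hf) (F.fieldOn a) (F.fieldOn c)
        (F.fieldOn b)) := by
  rw [covForm₂_diff cov hc.smooth F.isLocalFrameOn hf x (F.smooth_field a) (hext _)
    (F.smooth_field c)]
  exact F.eval_map_fun hc ((F.adaptedConn hc).covHess (FunOn.of f hf) (F.fieldOn a) (F.fieldOn c))
    x (eval_of_ext hext _)

end Frame

end TransverseSymmetric

/-! ### The operators on one-forms in a frame -/

theorem trace_eq_sum_coord {V ι : Type*} [AddCommGroup V] [Module ℝ V] [Fintype ι]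
    (b : Basis ι ℝ V) (T : V →ₗ[ℝ] V) : LinearMap.trace ℝ V T = ∑ a, b.coord a (T (b a)) := by
  classical
  rw [LinearMap.trace_eq_matrix_trace ℝ b, Matrix.trace]
  simp [LinearMap.toMatrix_apply]

namespace TransverseSymmetric

variable {d h : ℕ} {M : Type*} [TopologicalSpace M] [ChartedSpace (Model (d + h)) M]
  [IsManifold (𝓡 (d + h)) ∞ M] {S : TransverseSymmetric d h M} {U : Opens M}

theorem flat_apply (S : TransverseSymmetric d h M) (x : M) (u : S.hor x) (v : Tan (d + h) x) :
    S.flat x u v = S.metric x u (S.horPart x v) := by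
  change S.metric x (S.horPart x (u : Tan (d + h) x)) (S.horPart x v) = _
  rw [horPart_coe]

theorem metric_J (S : TransverseSymmetric d h M) (cov : Connection (d + h) M) (Z : S.sym) (x : M)
    (u v : S.hor x) : S.metric x (S.J cov Z x u) v =
      S.symMetric Z (S.symPart x (Connection.tor cov x u v)) :=
  (S.metric_inner x).apply_riesz _ v

namespace Frame

variable [T2Space M] {cov : Connection (d + h) M} (hc : S.IsCanonical cov) (F : S.Frame U) {x : U}

theorem eval_G (X Y : FieldOn (d + h) U) : FunOn.eval x ((F.adaptedConn hc).G X Y) =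
    S.gEps 1 (x : M) (FieldOn.eval x X) (FieldOn.eval x Y) := F.eval_metricMap x X Y

theorem eval_act_of (X : FieldOn (d + h) U) {f : M → ℝ} (hf : SmoothFun (d + h) (U : Set M) f) :
    FunOn.eval x ((F.adaptedConn hc).act X (FunOn.of f hf)) =
      diff f (x : M) (FieldOn.eval x X) := by
  induction X using FieldOn.ind with | _ X hX
  exact eval_act cov hc.smooth x hX hf

theorem ricci_eq (hext : ∀ v : Tan (d + h) (x : M), SmoothOn (U : Set M) (ext v))
    (V W : FieldOn (d + h) U) :
    cov.ricci (x : M) (FieldOn.eval x V) (FieldOn.eval x W) =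
      ∑ i, FunOn.eval x ((F.adaptedConn hc).G ((F.adaptedConn hc).curv ((F.adaptedConn hc).X i) V W)
        ((F.adaptedConn hc).X i)) := by
  set C := F.adaptedConn hc with hC
  -- The map `u ↦ R(u, V)W` written in the frame, where it is visibly linear. Its trace can then be
  -- moved from an arbitrary basis to the frame, whose vertical part contributes nothing.
  let T : Tan (d + h) (x : M) →ₗ[ℝ] Tan (d + h) (x : M) :=
    ∑ a, (F.isLocalFrameOn.coeff a x).smulRight (FieldOn.eval x (C.curv (F.fieldOn a) V W))
  have hT : ∀ u, T u = cov.curv (x : M) u (FieldOn.eval x V) (FieldOn.eval x W) := by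
    intro u
    have h1 := F.curv_eq hc hext (FieldOn.of (ext u) (hext u)) V W
    rw [eval_of_ext hext] at h1
    rw [h1]
    have h2 := congrArg (FieldOn.eval x) (C.map_expand (C.curvFst V W) (FieldOn.of (ext u) (hext u)))
    refine Eq.trans ?_ h2.symm
    rw [map_add, map_sum, map_sum]
    simp only [FieldOn.eval_smul, hC, eval_G, eval_of_ext hext]
    simp only [T, LinearMap.sum_apply, LinearMap.smulRight_apply, F.coeff_eq x.2]
    rw [Fintype.sum_sum_type]
    rfl
  have h1 : cov.ricci (x : M) (FieldOn.eval x V) (FieldOn.eval x W) =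
      LinearMap.trace ℝ (Tan (d + h) (x : M)) T := by
    rw [trace_eq_sum_coord (finBasis ℝ (Tan (d + h) (x : M)))]
    simp only [hT]
    rfl
  have h2 : ∀ a, (F.isLocalFrameOn.toBasisAt x.2).coord a (T (F.isLocalFrameOn.toBasisAt x.2 a)) =
      FunOn.eval x (C.G (C.curv (F.fieldOn a) V W) (F.fieldOn a)) := fun a => by
    rw [hT, F.isLocalFrameOn.toBasisAt_coe x.2]
    have h3 : (F.isLocalFrameOn.toBasisAt x.2).coord a = F.isLocalFrameOn.coeff a (x : M) := by
      have h4 : (x : M) ∈ (U : Set M) := x.2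
      simp only [IsLocalFrameOn.coeff, h4, dite_true]
    rw [h3, F.coeff_eq x.2, hC, eval_G, ← F.curv_eq hc hext]
    rfl
  rw [h1, trace_eq_sum_coord (F.isLocalFrameOn.toBasisAt x.2), Finset.sum_congr rfl fun a _ => h2 a,
    Fintype.sum_sum_type]
  have h5 : ∀ m, C.G (C.curv (F.fieldOn (.inr m)) V W) (F.fieldOn (.inr m)) = 0 := fun m =>
    C.G_curv_Z _ V W m
  simp only [h5, map_zero, Finset.sum_const_zero, add_zero]
  rfl

theorem subLaplacianForm_eq (hext : ∀ v : Tan (d + h) (x : M), SmoothOn (U : Set M) (ext v))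
    (hF : ∀ i, F.X i x = S.horBasis x i) {f : M → ℝ} (hf : SmoothFun (d + h) (U : Set M) f)
    (c : Fin d ⊕ Fin h) : S.subLaplacianForm cov (diff f) x (F.field c x) =
      ∑ i, FunOn.eval x ((F.adaptedConn hc).covHess (FunOn.of f hf) ((F.adaptedConn hc).X i)
        (F.fieldOn c) ((F.adaptedConn hc).X i)) := by
  rw [subLaplacianForm, _root_.sum_apply]
  refine Finset.sum_congr rfl fun i _ => ?_
  rw [← hF]
  exact F.covForm₂_eq hc hext hf (.inl i) (.inl i) c

theorem frakRic_inl (hext : ∀ v : Tan (d + h) (x : M), SmoothOn (U : Set M) (ext v))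
    (hF : ∀ i, F.X i x = S.horBasis x i) {f : M → ℝ} (hf : SmoothFun (d + h) (U : Set M) f)
    (k : Fin d) : S.frakRic cov (diff f) x (F.field (.inl k) x) =
      ∑ i, ∑ j, FunOn.eval x ((F.adaptedConn hc).act ((F.adaptedConn hc).X j) (FunOn.of f hf) *
        (F.adaptedConn hc).G ((F.adaptedConn hc).curv ((F.adaptedConn hc).X i)
          ((F.adaptedConn hc).X j) ((F.adaptedConn hc).X k)) ((F.adaptedConn hc).X i)) := by
  set C := F.adaptedConn hc with hC
  have h1 : S.frakRic cov (diff f) x (F.field (.inl k) x) =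
      cov.ricci (x : M) (S.sharp x (diff f x)) (F.field (.inl k) x) := by
    rw [frakRic, _root_.sum_apply]
    simp only [_root_.smul_apply, flat_apply, ← hF, smul_eq_mul]
    have h2 : ∀ i, S.metric x (F.X i x) (S.horPart x (F.field (.inl k) x)) =
        if i = k then 1 else 0 := fun i => by
      simp [field, F.orthonormal x x.2]
    simp only [h2]
    simp [field]
  have h3 : (S.sharp x (diff f x) : Tan (d + h) (x : M)) =
      FieldOn.eval x (∑ j, C.act (C.X j) (FunOn.of f hf) • C.X j) :=
    congrArg (FieldOn.eval x) (F.of_horGrad hc hf)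
  have h4 := F.ricci_eq hc hext (∑ j, C.act (C.X j) (FunOn.of f hf) • C.X j) (C.X k)
  rw [h1, h3]
  refine h4.trans (Finset.sum_congr rfl fun i _ => ?_)
  -- The horizontal gradient is expanded in the frame inside the second slot of the curvature.
  have h5 : C.curv (C.X i) (∑ j, C.act (C.X j) (FunOn.of f hf) • C.X j) (C.X k) =
      ∑ j, C.act (C.X j) (FunOn.of f hf) • C.curv (C.X i) (C.X j) (C.X k) := by
    change C.curvSnd (C.X i) (C.X k) _ = _
    simp only [map_sum, map_smul]
    rfl
  rw [h5, map_sum, LinearMap.sum_apply, map_sum]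
  simp only [map_smul, LinearMap.smul_apply, smul_eq_mul]
  rfl

theorem frakRic_inr (f : M → ℝ) (m : Fin h) :
    S.frakRic cov (diff f) x (F.field (.inr m) x) = 0 := by
  rw [frakRic, _root_.sum_apply]
  simp [_root_.smul_apply, flat_apply, field, symField]

theorem frakJ_inl {f : M → ℝ} (hf : SmoothFun (d + h) (U : Set M) f)
    (k : Fin d) : S.frakJ cov (diff f) x (F.field (.inl k) x) =
      ∑ i, ∑ m, FunOn.eval x ((F.adaptedConn hc).G ((F.adaptedConn hc).tor
        ((F.adaptedConn hc).X i) ((F.adaptedConn hc).X k)) ((F.adaptedConn hc).Z m) *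
        (F.adaptedConn hc).act ((F.adaptedConn hc).X i)
          ((F.adaptedConn hc).act ((F.adaptedConn hc).Z m) (FunOn.of f hf))) := by
  set C := F.adaptedConn hc with hC
  rw [frakJ, _root_.sum_apply, Finset.sum_comm]
  refine Finset.sum_congr rfl fun m _ => ?_
  set η := diff (n := d + h) (fun y => diff f y ((S.symBasis m : ∀ y, Tan (d + h) y) y)) (x : M)
    with hη
  have h1 : S.JForm cov (S.symBasis m) x η (F.field (.inl k) x) =
      S.symMetric (S.symBasis m)
        (S.symPart x (Connection.tor cov x (S.sharp x η : Tan (d + h) (x : M)) (F.X k x))) := by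
    rw [JForm, flat_apply, ← metric_J]
    simp [field]
  rw [h1, F.sharp_eq_sum x.2]
  have h2 : Connection.tor cov x ((∑ i, η (F.X i x) • F.X i x : S.hor (x : M)) :
      Tan (d + h) (x : M)) (F.X k x) =
      ∑ i, η (F.X i x) • Connection.tor cov x (F.X i x : Tan (d + h) (x : M)) (F.X k x) := by
    simp only [Connection.tor, Submodule.coe_sum, Submodule.coe_smul, map_sum, map_smul]
    rw [_root_.sum_apply]
    rfl
  rw [h2, map_sum, map_sum]
  refine Finset.sum_congr rfl fun i _ => ?_
  rw [map_smul, map_smul, smul_eq_mul, map_mul, mul_comm]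
  congr 1
  · have h3 : FieldOn.eval x (C.tor (C.X i) (C.X k)) =
        Connection.tor cov x (F.X i x : Tan (d + h) (x : M)) (F.X k x) :=
      eval_tor cov hc.smooth x (F.smooth_field (.inl i)) (F.smooth_field (.inl k))
    rw [hC, eval_G, ← hC, h3]
    change _ = S.gEps 1 (x : M) _ (F.field (.inr m) x)
    rw [← F.coeff_eq x.2, F.coeff_inr x.2, S.symMetric_inner.symm]
  · have h4 : C.act (C.Z m) (FunOn.of f hf) =
        FunOn.of _ (SmoothOn.diff U.isOpen hf (F.smooth_field (.inr m))) :=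
      actMap_of (F.smooth_field (.inr m)) hf
    rw [h4]
    exact (F.eval_act_of hc (C.X i) _).symm

theorem frakJ_inr (f : M → ℝ) (m : Fin h) :
    S.frakJ cov (diff f) x (F.field (.inr m) x) = 0 := by
  rw [frakJ, _root_.sum_apply]
  simp [JForm, flat_apply, field, symField]

theorem sum_covTor_eq_zero (hym : S.IsYangMills cov)
    (hext : ∀ v : Tan (d + h) (x : M), SmoothOn (U : Set M) (ext v))
    (hF : ∀ i, F.X i x = S.horBasis x i) {f : M → ℝ} (hf : SmoothFun (d + h) (U : Set M) f)
    (k : Fin d) : ∑ i, FunOn.eval x ((F.adaptedConn hc).act ((F.adaptedConn hc).covTor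
      ((F.adaptedConn hc).X i) ((F.adaptedConn hc).X i) ((F.adaptedConn hc).X k))
      (FunOn.of f hf)) = 0 := by
  -- The Yang–Mills sum concerns a basis at one point. The frame takes those values there, and `∇T`
  -- is a tensor in its last two slots.
  have h1 := hym x (S.horBasis x) (S.horBasis_orthonormal x) (F.X k x)
  simp only [← hF] at h1
  have h2 : ∀ i, cov.covTor (x : M) (F.X i x : Tan (d + h) (x : M)) (F.X i x) (F.X k x) =
      FieldOn.eval x ((F.adaptedConn hc).covTor ((F.adaptedConn hc).X i)
        ((F.adaptedConn hc).X i) ((F.adaptedConn hc).X k)) := fun i =>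
    F.covTor_eq hc hext (F.smooth_field (.inl i)) (F.fieldOn (.inl i)) (F.fieldOn (.inl k))
  simp only [eval_act_of, ← h2]
  rw [← map_sum, h1, map_zero]

end Frame

/-- Both sides are covectors at `x`, so it suffices to compare them on the adapted frame: the
horizontal fields use `act_X_lap`, the vertical ones `act_Z_lap`. -/
theorem diff_subLaplacian_eq_boxInfty [T2Space M] {cov : Connection (d + h) M}
    (hc : S.IsCanonical cov) (hym : S.IsYangMills cov) {f : M → ℝ}
    (hf : ContMDiff (𝓡 (d + h)) 𝓘(ℝ, ℝ) ∞ f) (x : M) :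
    diff (S.subLaplacian f) x = S.boxInfty cov (diff f) x := by
  obtain ⟨U, hx, hext, F, hF⟩ := S.exists_frame_ext x
  have hfU : SmoothFun (d + h) (U : Set M) f := hf.contMDiffOn
  let y : U := ⟨x, hx⟩
  have key : ∀ a, diff (S.subLaplacian f) x (F.field a x) =
      S.boxInfty cov (diff f) x (F.field a x) := by
    intro a
    rw [boxInfty, _root_.sub_apply, _root_.add_apply, _root_.smul_apply]
    refine (F.diff_subLaplacian hc hfU y a).trans ?_
    rcases a with k | m
    · have h1 := F.subLaplacianForm_eq (x := y) hc hext hF hfU (.inl k)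
      have h2 := F.frakRic_inl (x := y) hc hext hF hfU k
      have h3 := F.frakJ_inl (x := y) hc hfU k
      have h4 := F.sum_covTor_eq_zero (x := y) hc hym hext hF hfU k
      have h5 := congrArg (FunOn.eval y) ((F.adaptedConn hc).act_X_lap k (FunOn.of f hfU))
      refine h5.trans ?_
      rw [h1, h2, h3]
      simp only [map_add, map_sub, map_sum, map_mul] at h4 ⊢
      rw [h4, add_zero, map_ofNat, smul_eq_mul]
      rfl
    · have h1 := F.subLaplacianForm_eq (x := y) hc hext hF hfU (.inr m)
      have h2 := F.frakRic_inr (x := y) (cov := cov) f m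
      have h3 := F.frakJ_inr (x := y) (cov := cov) f m
      have h5 := congrArg (FunOn.eval y) ((F.adaptedConn hc).act_Z_lap m (FunOn.of f hfU))
      refine h5.trans ?_
      rw [h1, h2, h3, map_sum, smul_zero, add_zero, sub_zero]
      rfl
  ext1 v
  rw [F.eq_sum hx v, map_sum, map_sum]
  simp only [map_smul, key]

/-- `L f` does not involve a connection, but its smoothness is read off from its form as a trace of
a Hessian; the constructed canonical connection supplies one. -/
theorem contMDiff_subLaplacian [T2Space M] (S : TransverseSymmetric d h M) {f : M → ℝ}
    (hf : ContMDiff (𝓡 (d + h)) 𝓘(ℝ, ℝ) ∞ f) :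
    ContMDiff (𝓡 (d + h)) 𝓘(ℝ, ℝ) ∞ (S.subLaplacian f) := fun x =>
  ((S.frameAt x).smoothFun_subLaplacian S.canonicalConnection_isCanonical
    hf.contMDiffOn).contMDiffAt ((S.frameDomain x).isOpen.mem_nhds (S.mem_frameDomain x))

end TransverseSymmetric

end SubRiem

end

theorem mainTheorem10 {d h : ℕ} {M : Type*} [TopologicalSpace M] [T2Space M] [ConnectedSpace M]
    [ChartedSpace (SubRiem.Model (d + h)) M] [IsManifold (𝓡 (d + h)) ∞ M]
    (S : SubRiem.TransverseSymmetric d h M) :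
    (∃ cov : SubRiem.Connection (d + h) M, S.IsCanonical cov) ∧
    ∀ cov : SubRiem.Connection (d + h) M, S.IsCanonical cov → S.IsYangMills cov →
      ∀ f : M → ℝ, ContMDiff (𝓡 (d + h)) 𝓘(ℝ, ℝ) ∞ f →
        ContMDiff (𝓡 (d + h)) 𝓘(ℝ, ℝ) ∞ (S.subLaplacian f) ∧
        ∀ x : M, SubRiem.diff (S.subLaplacian f) x = S.boxInfty cov (SubRiem.diff f) x := by
  refine ⟨⟨_, S.canonicalConnection_isCanonical⟩, fun cov hc hym f hf => ⟨S.contMDiff_subLaplacian hf,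
    fun x => SubRiem.TransverseSymmetric.diff_subLaplacian_eq_boxInfty hc hym hf x⟩⟩
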